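/- Let $G\rightrightarrows M$ be a Lie groupoid with source $\alpha$, target $\beta$, identity section $\epsilon$, inversion $i$ and left and right translations $l_g(h)=gh$, $r_g(h)=hg$ ($G$, $M$ smooth finite-dimensional manifolds, all structure maps smooth, $\alpha,\beta$ submersions). Let $\tau:AG\to M$ be its Lie algebroid, $A_xG=V_{\epsilon(x)}\alpha=\ker T_{\epsilon(x)}\alpha$. A section $X$ of $AG$ determines the vector fields $$\overleftarrow X(g)=(T_{\epsilon(\beta(g))}l_g)(X(\beta(g))),\qquad \overrightarrow X(g)=-(T_{\epsilon(\alpha(g))}r_g)\bigl((T_{\epsilon(\alpha(g))}i)(X(\alpha(g)))\bigr)$$ on $G$; the bracket of $AG$ is determined by $\overleftarrow{[\![X,Y]\!]}=[\overleftarrow X,\overleftarrow Y]$ and its anchor is $T\beta$. Let $\tau^*:A^*G\to M$ be the dual bundle. The differential of a $1$-section $\mu$ of the dual of a Lie algebroid with anchor $\rho$ is $d\mu(s,s')=\rho(s)(\mu(s'))-\rho(s')(\mu(s))-\mu([\![s,s']\!])$. Consider the following two Lie algebroids. * $\mathcal P^\tau G=V\beta\oplus_G V\alpha\to G$, where $V_g\beta=\ker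 T_g\beta$ and $V_g\alpha=\ker T_g\alpha$, with anchor $(u,v)\mapsto u+v$ and with the bracket characterized by $[\![(\overrightarrow X,\overleftarrow Y),(\overrightarrow{X'},\overleftarrow{Y'})]\!]=(-\overrightarrow{[\![X,X']\!]},\overleftarrow{[\![Y,Y']\!]})$. * $\mathcal P^{\tau^*}(AG)\to A^*G$, with fibre at $p\in A^*G$ the set of pairs $(v,W)\in A_{\tau^*(p)}G\times T_p(A^*G)$ such that $(T\beta)(v)=(T\tau^*)(W)$, with anchor $(v,W)\mapsto W$ and with the bracket characterized by $[\![(X\circ\tau^*,U),(X'\circ\tau^*,U')]\!]=([\![X,X']\!]\circ\tau^*,[U,U'])$ for sections $X,X'$ of $AG$ and vector fields $U,U'$ on $A^*G$ that are $\tau^*$-projectable onto $\rho(X),\rho(X')$. The Liouville section of $\mathcal P^{\tau^*}(AG)^*$ is $\Theta(p)(v,W)=p(v)$, and the canonical symplectic section is $\Omega=-d\Theta$. Let $L:G\to\mathbb R$ be a smooth function (a discrete Lagrangian). Its Poincaré–Cartan $1$-sections are, for $(u,v)\in V_g\beta\oplus V_g\alpha$, $$\Theta_L^-(g)(u,v)=-u(L),\qquad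 \Theta_L^+(g)(u,v)=v(L).$$ Its discrete Legendre transformations $\mathbb F^{\mp}L:G\to A^*G$ are $$(\mathbb F^-L)(h)(v)=-v(L\circ r_h\circ i)\ \ (v\in A_{\alpha(h)}G),\qquad (\mathbb F^+L)(g)(v)=v(L\circ l_g)\ \ (v\in A_{\beta(g)}G),$$ and their prolongations $\mathcal P^\tau\mathbb F^{\mp}L:\mathcal P^\tau G\to\mathcal P^{\tau^*}(AG)$ are, for $(u,v)\in V_g\beta\oplus V_g\alpha$, $$\mathcal P^\tau_g\mathbb F^-L(u,v)=\bigl(T_g(i\circ r_{g^{-1}})(u),\ T_g\mathbb F^-L(u+v)\bigr),\qquad \mathcal P^\tau_g\mathbb F^+L(u,v)=\bigl(T_g l_{g^{-1}}(v),\ T_g\mathbb F^+L(u+v)\bigr).$$ Then $\mathbb F^-L$ and $\mathbb F^+L$ are smooth, $d\Theta_L^+=d\Theta_L^-$ (so that the Poincaré–Cartan $2$-section $\Omega_L=-d\Theta_L^+=-d\Theta_L^-$ is well defined), the prolongations do take values in $\mathcal P^{\tau^*}(AG)$, and $$(\mathcal P^\tau\mathbb F^-L,\mathbb F^-L)^*\Theta=\Theta_L^-,\qquad(\mathcal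 P^\tau\mathbb F^-L,\mathbb F^-L)^*\Omega=\Omega_L,$$ $$(\mathcal P^\tau\mathbb F^+L,\mathbb F^+L)^*\Theta=\Theta_L^+,\qquad(\mathcal P^\tau\mathbb F^+L,\mathbb F^+L)^*\Omega=\Omega_L.$$ -/

import Mathlib

open Set Filter Topology Bundle Manifold
open scoped ContDiff

noncomputable section

set_option linter.unusedSectionVars false

/-- A Lie groupoid `G ⇉ M` with source `src` (usually `α`), target `tgt` (usually `β`), identity
section `unit` (usually `ε`), inversion `inv` and multiplication `mul`. The product `mul g h` is
only meaningful on the set of composable pairs, `tgt g = src h`: its values elsewhere are arbitrary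
and never used, and its smoothness is smoothness on the submanifold of composable pairs. -/
structure LieGroupoid (EG EM G M : Type*)
    [NormedAddCommGroup EG] [NormedSpace ℝ EG] [NormedAddCommGroup EM] [NormedSpace ℝ EM]
    [TopologicalSpace G] [ChartedSpace EG G] [TopologicalSpace M] [ChartedSpace EM M] where
  src : G → M
  tgt : G → M
  unit : M → G
  inv : G → G
  mul : G → G → G
  src_mul : ∀ g h, tgt g = src h → src (mul g h) = src g
  tgt_mul : ∀ g h, tgt g = src h → tgt (mul g h) = tgt h
  mul_assoc : ∀ g h k, tgt g = src h → tgt h = src k → mul g (mul h k) = mul (mul g h) k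
  src_unit : ∀ x, src (unit x) = x
  tgt_unit : ∀ x, tgt (unit x) = x
  unit_mul : ∀ g, mul (unit (src g)) g = g
  mul_unit : ∀ g, mul g (unit (tgt g)) = g
  src_inv : ∀ g, src (inv g) = tgt g
  tgt_inv : ∀ g, tgt (inv g) = src g
  inv_mul : ∀ g, mul (inv g) g = unit (tgt g)
  mul_inv : ∀ g, mul g (inv g) = unit (src g)
  submersion_src : IsSubmersion 𝓘(ℝ, EG) 𝓘(ℝ, EM) ∞ src
  submersion_tgt : IsSubmersion 𝓘(ℝ, EG) 𝓘(ℝ, EM) ∞ tgt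
  contMDiff_unit : ContMDiff 𝓘(ℝ, EM) 𝓘(ℝ, EG) ∞ unit
  contMDiff_inv : ContMDiff 𝓘(ℝ, EG) 𝓘(ℝ, EG) ∞ inv
  contMDiffOn_mul : ContMDiffOn (𝓘(ℝ, EG).prod 𝓘(ℝ, EG)) 𝓘(ℝ, EG) ∞
    (fun p : G × G => mul p.1 p.2) {p | tgt p.1 = src p.2}

namespace LieGroupoid

variable {EG EM G M : Type*}
  [NormedAddCommGroup EG] [NormedSpace ℝ EG] [FiniteDimensional ℝ EG]
  [NormedAddCommGroup EM] [NormedSpace ℝ EM] [FiniteDimensional ℝ EM]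
  [TopologicalSpace G] [ChartedSpace EG G] [IsManifold 𝓘(ℝ, EG) ∞ G]
  [TopologicalSpace M] [ChartedSpace EM M] [IsManifold 𝓘(ℝ, EM) ∞ M]
  (Γ : LieGroupoid EG EM G M)

/-- `V_g α`, the vectors at `g` tangent to the source fibre. -/
def kerSrc (g : G) : Submodule ℝ (TangentSpace 𝓘(ℝ, EG) g) :=
  LinearMap.ker (mfderiv 𝓘(ℝ, EG) 𝓘(ℝ, EM) Γ.src g).toLinearMap

/-- `V_g β`, the vectors at `g` tangent to the target fibre. -/
def kerTgt (g : G) : Submodule ℝ (TangentSpace 𝓘(ℝ, EG) g) :=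
  LinearMap.ker (mfderiv 𝓘(ℝ, EG) 𝓘(ℝ, EM) Γ.tgt g).toLinearMap

/-- The fibre `A_x G = V_{ε(x)} α` of the Lie algebroid of `Γ`. -/
def A (x : M) : Type _ := Γ.kerSrc (Γ.unit x)

instance (x : M) : AddCommGroup (Γ.A x) := inferInstanceAs (AddCommGroup (Γ.kerSrc (Γ.unit x)))
instance (x : M) : Module ℝ (Γ.A x) := inferInstanceAs (Module ℝ (Γ.kerSrc (Γ.unit x)))
instance (x : M) : TopologicalSpace (Γ.A x) :=
  inferInstanceAs (TopologicalSpace (Γ.kerSrc (Γ.unit x)))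
instance (x : M) : IsTopologicalAddGroup (Γ.A x) :=
  inferInstanceAs (IsTopologicalAddGroup (Γ.kerSrc (Γ.unit x)))
instance (x : M) : ContinuousSMul ℝ (Γ.A x) :=
  inferInstanceAs (ContinuousSMul ℝ (Γ.kerSrc (Γ.unit x)))
instance (x : M) : T2Space (Γ.A x) :=
  inferInstanceAs (T2Space {v : EG // v ∈ Γ.kerSrc (Γ.unit x)})
theorem finiteDimensional_A (x : M) : FiniteDimensional ℝ (Γ.A x) :=
  let l : Γ.A x →ₗ[ℝ] EG := ⟨⟨fun v => v.1, fun _ _ => rfl⟩, fun _ _ => rfl⟩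
  FiniteDimensional.of_injective l Subtype.val_injective

/-! ### The smooth vector bundle structure on `AG`

The kernel of the fibrewise surjective morphism `Tα`, restricted to the units, is a smooth vector
bundle. Near `x₀`, in the charts of `G` at `ε(x₀)` and of `M` at `x₀`, a fixed linear map `split`
onto the model fibre completes `Tα` to an isomorphism `frame`; the local trivialization of `AG` is
`split` applied to the coordinates of the vector. -/

variable (EG EM) in
/-- The model fibre of `AG`. -/
abbrev Fib : Type := EuclideanSpace ℝ (Fin (Module.finrank ℝ EG - Module.finrank ℝ EM))

theorem surj (x : M) :
    Function.Surjective (mfderiv 𝓘(ℝ, EG) 𝓘(ℝ, EM) Γ.src (Γ.unit x)) := by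
  intro w
  have h1 : MDifferentiableAt 𝓘(ℝ, EG) 𝓘(ℝ, EM) Γ.src (Γ.unit x) :=
    (Γ.submersion_src.contMDiff _).mdifferentiableAt (by simp)
  have h2 : MDifferentiableAt 𝓘(ℝ, EM) 𝓘(ℝ, EG) Γ.unit x :=
    (Γ.contMDiff_unit x).mdifferentiableAt (by simp)
  have h3 := mfderiv_comp x h1 h2
  have h4 : Γ.src ∘ Γ.unit = id := funext Γ.src_unit
  rw [h4, mfderiv_id] at h3
  exact ⟨mfderiv 𝓘(ℝ, EM) 𝓘(ℝ, EG) Γ.unit x w, (DFunLike.congr_fun h3 w).symm⟩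

/-- `T_{ε(x)} α`. -/
def Tsrc (x : M) : EG →L[ℝ] EM := mfderiv 𝓘(ℝ, EG) 𝓘(ℝ, EM) Γ.src (Γ.unit x)

/-- `T_{ε(x)} α` in the charts at `ε(x₀)` and `α(ε(x₀))`. -/
def coordT (x₀ x : M) : EG →L[ℝ] EM :=
  inTangentCoordinates 𝓘(ℝ, EG) 𝓘(ℝ, EM) Γ.unit (fun y => Γ.src (Γ.unit y)) Γ.Tsrc x₀ x

/-- Points whose unit lies in the chart of `G` at `ε(x₀)`, and which lie in the chart at `x₀`. -/
def dom (x₀ : M) : Set M :=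
  {x | Γ.unit x ∈ (chartAt EG (Γ.unit x₀)).source ∧
    Γ.src (Γ.unit x) ∈ (chartAt EM (Γ.src (Γ.unit x₀))).source}

/-- Change of tangent coordinates of `G` at `ε(z)`, from the chart at `ε(x)` to the chart at `ε(y)`. -/
def tc (x y z : M) : EG →L[ℝ] EG :=
  tangentCoordChange 𝓘(ℝ, EG) (Γ.unit x) (Γ.unit y) (Γ.unit z)

/-- Change of tangent coordinates of `M` at `z`, from the chart at `x` to the chart at `y`. -/
def tc' (x y z : M) : EM →L[ℝ] EM :=
  tangentCoordChange 𝓘(ℝ, EM) (Γ.src (Γ.unit x)) (Γ.src (Γ.unit y)) (Γ.src (Γ.unit z))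

theorem isOpen_dom (x₀ : M) : IsOpen (Γ.dom x₀) := by
  have h1 := Γ.contMDiff_unit.continuous
  have h2 := Γ.submersion_src.contMDiff.continuous
  exact ((chartAt EG (Γ.unit x₀)).open_source.preimage h1).inter
    ((chartAt EM (Γ.src (Γ.unit x₀))).open_source.preimage (h2.comp h1))

theorem mem_dom (x₀ : M) : x₀ ∈ Γ.dom x₀ := ⟨mem_chart_source _ _, mem_chart_source _ _⟩

theorem tc_comp {x y w z : M} (hx : z ∈ Γ.dom x) (hy : z ∈ Γ.dom y) (hw : z ∈ Γ.dom w) (v : EG) :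
    Γ.tc y w z (Γ.tc x y z v) = Γ.tc x w z v :=
  tangentCoordChange_comp (by simpa using ⟨⟨hx.1, hy.1⟩, hw.1⟩)

theorem tc_self {x z : M} (hx : z ∈ Γ.dom x) (v : EG) : Γ.tc x x z v = v :=
  tangentCoordChange_self (by simpa using hx.1)

theorem tc'_comp {x y w z : M} (hx : z ∈ Γ.dom x) (hy : z ∈ Γ.dom y) (hw : z ∈ Γ.dom w) (v : EM) :
    Γ.tc' y w z (Γ.tc' x y z v) = Γ.tc' x w z v :=
  tangentCoordChange_comp (by simpa using ⟨⟨hx.2, hy.2⟩, hw.2⟩)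

theorem tc'_self {x z : M} (hx : z ∈ Γ.dom x) (v : EM) : Γ.tc' x x z v = v :=
  tangentCoordChange_self (by simpa using hx.2)

theorem coordT_eq {x₀ x : M} (hx : x ∈ Γ.dom x₀) (v : EG) :
    Γ.coordT x₀ x v = Γ.tc' x x₀ x (Γ.Tsrc x (Γ.tc x₀ x x v)) := by
  unfold coordT
  rw [inTangentCoordinates_eq _ _ _ hx.1 hx.2]
  rfl

theorem contMDiffOn_tc (x y : M) :
    ContMDiffOn 𝓘(ℝ, EM) 𝓘(ℝ, EG →L[ℝ] EG) ∞ (Γ.tc x y) (Γ.dom x ∩ Γ.dom y) := by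
  have h := (tangentBundleCore.isContMDiff (n := ∞) (I := 𝓘(ℝ, EG)) (M := G)
    (h := inferInstanceAs (IsManifold 𝓘(ℝ, EG) ∞ G))).contMDiffOn_coordChange
    (achart EG (Γ.unit x)) (achart EG (Γ.unit y))
  exact h.comp Γ.contMDiff_unit.contMDiffOn fun z hz => ⟨hz.1.1, hz.2.1⟩

theorem contMDiffOn_tc' (x y : M) :
    ContMDiffOn 𝓘(ℝ, EM) 𝓘(ℝ, EM →L[ℝ] EM) ∞ (Γ.tc' x y) (Γ.dom x ∩ Γ.dom y) := by
  have h := (tangentBundleCore.isContMDiff (n := ∞) (I := 𝓘(ℝ, EM)) (M := M)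
    (h := inferInstanceAs (IsManifold 𝓘(ℝ, EM) ∞ M))).contMDiffOn_coordChange
    (achart EM (Γ.src (Γ.unit x))) (achart EM (Γ.src (Γ.unit y)))
  exact h.comp (Γ.submersion_src.contMDiff.comp Γ.contMDiff_unit).contMDiffOn
    fun z hz => ⟨hz.1.2, hz.2.2⟩

theorem contMDiffAt_coordT (x₀ : M) :
    ContMDiffAt 𝓘(ℝ, EM) 𝓘(ℝ, EG →L[ℝ] EM) ∞ (Γ.coordT x₀) x₀ :=
  ContMDiffAt.mfderiv (n := ∞) (fun _ => Γ.src) Γ.unit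
    ((Γ.submersion_src.contMDiff _).comp (x₀, Γ.unit x₀) contMDiffAt_snd)
    (Γ.contMDiff_unit x₀) (by simp)

theorem contMDiffOn_coordT (x₀ : M) :
    ContMDiffOn 𝓘(ℝ, EM) 𝓘(ℝ, EG →L[ℝ] EM) ∞ (Γ.coordT x₀) (Γ.dom x₀) := by
  intro x₁ h1
  have hn : Γ.dom x₀ ∩ Γ.dom x₁ ∈ 𝓝 x₁ :=
    ((Γ.isOpen_dom x₀).inter (Γ.isOpen_dom x₁)).mem_nhds ⟨h1, Γ.mem_dom x₁⟩
  have a1 := (Γ.contMDiffOn_tc x₀ x₁).contMDiffAt hn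
  have a2 := (Γ.contMDiffOn_tc' x₁ x₀).contMDiffAt (by rwa [inter_comm])
  have h := (a2.clm_comp (Γ.contMDiffAt_coordT x₁)).clm_comp a1
  refine (h.congr_of_eventuallyEq ?_).contMDiffWithinAt
  filter_upwards [hn] with x hx
  ext v
  have hxx := Γ.mem_dom x
  simp only [ContinuousLinearMap.comp_apply]
  rw [Γ.coordT_eq hx.1, Γ.coordT_eq hx.2, Γ.tc_comp hx.1 hx.2 hxx, Γ.tc'_comp hxx hx.2 hx.1]

theorem exists_compl (x₀ : M) : ∃ φ : EG →L[ℝ] Fib EG EM,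
    (φ.prod (Γ.coordT x₀ x₀)) ∈
      range ((↑) : (EG ≃L[ℝ] (Fib EG EM × EM)) → EG →L[ℝ] (Fib EG EM × EM)) := by
  have hK : Function.Surjective (Γ.coordT x₀ x₀) := by
    intro w
    obtain ⟨v, hv⟩ : ∃ v : EG, Γ.Tsrc x₀ v = w := Γ.surj x₀ w
    refine ⟨v, (Γ.coordT_eq (Γ.mem_dom x₀) (v : EG)).trans ?_⟩
    rw [Γ.tc_self (Γ.mem_dom x₀), Γ.tc'_self (Γ.mem_dom x₀)]
    exact hv
  set K : EG →ₗ[ℝ] EM := (Γ.coordT x₀ x₀).toLinearMap with hKdef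
  have hr := LinearMap.finrank_range_add_finrank_ker K
  rw [LinearMap.range_eq_top.2 hK, finrank_top] at hr
  have hf : Module.finrank ℝ (LinearMap.ker K) = Module.finrank ℝ (Fib EG EM) := by
    rw [finrank_euclideanSpace, Fintype.card_fin]; omega
  let e := LinearEquiv.ofFinrankEq _ _ hf
  obtain ⟨p, hp⟩ := (LinearMap.ker K).subtype.exists_leftInverse_of_injective
    (Submodule.ker_subtype _)
  let φ : EG →L[ℝ] Fib EG EM := (e.toLinearMap ∘ₗ p).toContinuousLinearMap
  refine ⟨φ, ?_⟩
  have hinj : Function.Injective (φ.prod (Γ.coordT x₀ x₀)).toLinearMap := by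
    rw [← LinearMap.ker_eq_bot, LinearMap.ker_eq_bot']
    intro v hv
    have hv1 : e (p v) = 0 := congrArg Prod.fst hv
    have hv2 : K v = 0 := congrArg Prod.snd hv
    have hpv : p v = ⟨v, hv2⟩ := DFunLike.congr_fun hp ⟨v, hv2⟩
    rw [hpv, LinearEquiv.map_eq_zero_iff] at hv1
    exact congrArg Subtype.val hv1
  have hd : Module.finrank ℝ EG = Module.finrank ℝ (Fib EG EM × EM) := by
    rw [Module.finrank_prod, ← hf]; omega
  refine ⟨(LinearEquiv.ofInjectiveOfFinrankEq _ hinj hd).toContinuousLinearEquiv, ?_⟩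
  ext v <;> rfl

/-- A linear map completing `T_{ε(x₀)} α` to an isomorphism. -/
def split (x₀ : M) : EG →L[ℝ] Fib EG EM := (Γ.exists_compl x₀).choose

def frame (x₀ x : M) : EG →L[ℝ] (Fib EG EM × EM) := (Γ.split x₀).prod (Γ.coordT x₀ x)

def base (x₀ : M) : Set M :=
  Γ.dom x₀ ∩ Γ.frame x₀ ⁻¹'
    range ((↑) : (EG ≃L[ℝ] (Fib EG EM × EM)) → EG →L[ℝ] (Fib EG EM × EM))

theorem contMDiffOn_frame (x₀ : M) :
    ContMDiffOn 𝓘(ℝ, EM) 𝓘(ℝ, EG →L[ℝ] (Fib EG EM × EM)) ∞ (Γ.frame x₀) (Γ.dom x₀) :=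
  ((ContinuousLinearMap.prodMapL ℝ EG (Fib EG EM) EG EM).contDiff.contMDiff.comp_contMDiffOn
    ((contMDiffOn_const (c := Γ.split x₀)).prodMk_space (Γ.contMDiffOn_coordT x₀))).clm_comp
    (contMDiffOn_const (c := (ContinuousLinearMap.id ℝ EG).prod (ContinuousLinearMap.id ℝ EG)))

theorem isOpen_base (x₀ : M) : IsOpen (Γ.base x₀) :=
  (Γ.contMDiffOn_frame x₀).continuousOn.isOpen_inter_preimage (Γ.isOpen_dom x₀)
    ContinuousLinearEquiv.isOpen

theorem mem_base (x₀ : M) : x₀ ∈ Γ.base x₀ := ⟨Γ.mem_dom x₀, (Γ.exists_compl x₀).choose_spec⟩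

def frameInv (x₀ x : M) : (Fib EG EM × EM) →L[ℝ] EG := (Γ.frame x₀ x).inverse

theorem frame_frameInv {x₀ x : M} (hx : x ∈ Γ.base x₀) (w : Fib EG EM × EM) :
    Γ.frame x₀ x (Γ.frameInv x₀ x w) = w := by
  obtain ⟨e, he⟩ := hx.2
  rw [frameInv, ← he, ContinuousLinearMap.inverse_equiv]; simp

theorem frameInv_frame {x₀ x : M} (hx : x ∈ Γ.base x₀) (v : EG) :
    Γ.frameInv x₀ x (Γ.frame x₀ x v) = v := by
  obtain ⟨e, he⟩ := hx.2
  rw [frameInv, ← he, ContinuousLinearMap.inverse_equiv]; simp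

theorem contMDiffOn_frameInv (x₀ : M) :
    ContMDiffOn 𝓘(ℝ, EM) 𝓘(ℝ, (Fib EG EM × EM) →L[ℝ] EG) ∞ (Γ.frameInv x₀) (Γ.base x₀) := by
  intro x hx
  obtain ⟨e, he⟩ := hx.2
  have h1 : ContMDiffAt 𝓘(ℝ, EG →L[ℝ] (Fib EG EM × EM)) 𝓘(ℝ, (Fib EG EM × EM) →L[ℝ] EG) ∞
      ContinuousLinearMap.inverse (Γ.frame x₀ x) := by
    rw [← he]; exact (contDiffAt_map_inverse e).contMDiffAt
  exact (h1.comp x ((Γ.contMDiffOn_frame x₀).contMDiffAt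
    ((Γ.isOpen_dom x₀).mem_nhds hx.1))).contMDiffWithinAt

def ofFib (x₀ x : M) : Fib EG EM →L[ℝ] EG :=
  Γ.tc x₀ x x ∘L Γ.frameInv x₀ x ∘L ContinuousLinearMap.inl ℝ (Fib EG EM) EM

def toFib (x₀ x : M) : EG →L[ℝ] Fib EG EM := Γ.split x₀ ∘L Γ.tc x x₀ x

theorem ofFib_mem {x₀ x : M} (hx : x ∈ Γ.base x₀) (f : Fib EG EM) :
    Γ.ofFib x₀ x f ∈ Γ.kerSrc (Γ.unit x) := by
  change Γ.Tsrc x (Γ.ofFib x₀ x f) = 0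
  have h := congrArg Prod.snd (Γ.frame_frameInv hx (f, 0))
  change Γ.coordT x₀ x _ = 0 at h
  rw [Γ.coordT_eq hx.1] at h
  have h2 := congrArg (Γ.tc' x₀ x x) h
  rw [Γ.tc'_comp (Γ.mem_dom x) hx.1 (Γ.mem_dom x), Γ.tc'_self (Γ.mem_dom x), map_zero] at h2
  exact h2

theorem toFib_ofFib {x₀ x : M} (hx : x ∈ Γ.base x₀) (f : Fib EG EM) :
    Γ.toFib x₀ x (Γ.ofFib x₀ x f) = f := by
  change Γ.split x₀ (Γ.tc x x₀ x (Γ.tc x₀ x x _)) = f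
  rw [Γ.tc_comp hx.1 (Γ.mem_dom x) hx.1, Γ.tc_self hx.1]
  exact congrArg Prod.fst (Γ.frame_frameInv hx (f, 0))

theorem ofFib_toFib {x₀ x : M} (hx : x ∈ Γ.base x₀) {v : EG} (hv : Γ.Tsrc x v = 0) :
    Γ.ofFib x₀ x (Γ.toFib x₀ x v) = v := by
  have h : (Γ.toFib x₀ x v, (0 : EM)) = Γ.frame x₀ x (Γ.tc x x₀ x v) := by
    refine Prod.ext rfl ?_
    change 0 = Γ.coordT x₀ x _
    rw [Γ.coordT_eq hx.1, Γ.tc_comp (Γ.mem_dom x) hx.1 (Γ.mem_dom x), Γ.tc_self (Γ.mem_dom x),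
      hv, map_zero]
  change Γ.tc x₀ x x (Γ.frameInv x₀ x (Γ.toFib x₀ x v, 0)) = v
  rw [h, Γ.frameInv_frame hx, Γ.tc_comp (Γ.mem_dom x) hx.1 (Γ.mem_dom x), Γ.tc_self (Γ.mem_dom x)]

open Classical in
def ofFibA (x₀ x : M) (f : Fib EG EM) : Γ.A x :=
  if h : x ∈ Γ.base x₀ then ⟨Γ.ofFib x₀ x f, Γ.ofFib_mem h f⟩ else 0

theorem coe_ofFibA {x₀ x : M} (hx : x ∈ Γ.base x₀) (f : Fib EG EM) :
    (Γ.ofFibA x₀ x f).1 = Γ.ofFib x₀ x f :=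
  congrArg Subtype.val (dif_pos hx : Γ.ofFibA x₀ x f = ⟨_, Γ.ofFib_mem hx f⟩)

/-- The local trivialization of `AG` near `x₀`. -/
def pretriv (x₀ : M) : Pretrivialization (Fib EG EM) (π (Fib EG EM) Γ.A) where
  toFun p := (p.1, Γ.toFib x₀ p.1 p.2.1)
  invFun q := ⟨q.1, Γ.ofFibA x₀ q.1 q.2⟩
  source := π (Fib EG EM) Γ.A ⁻¹' Γ.base x₀
  target := Γ.base x₀ ×ˢ univ
  map_source' p hp := ⟨hp, trivial⟩
  map_target' q hq := hq.1
  left_inv' := by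
    rintro ⟨x, v⟩ (hx : x ∈ Γ.base x₀)
    exact congrArg (TotalSpace.mk x) (Subtype.ext
      ((Γ.coe_ofFibA hx _).trans (Γ.ofFib_toFib hx v.2)))
  right_inv' := by
    rintro ⟨x, f⟩ ⟨hx : x ∈ Γ.base x₀, -⟩
    exact Prod.ext rfl ((congrArg (Γ.toFib x₀ x) (Γ.coe_ofFibA hx f)).trans (Γ.toFib_ofFib hx f))
  open_target := (Γ.isOpen_base x₀).prod isOpen_univ
  baseSet := Γ.base x₀
  open_baseSet := Γ.isOpen_base x₀
  source_eq := rfl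
  target_eq := rfl
  proj_toFun _ _ := rfl

instance (x₀ : M) : (Γ.pretriv x₀).IsLinear ℝ where
  linear x _ := ⟨fun v w => (Γ.toFib x₀ x).map_add v.1 w.1,
    fun c v => (Γ.toFib x₀ x).map_smul c v.1⟩

def change (x₀ x₁ x : M) : Fib EG EM →L[ℝ] Fib EG EM :=
  Γ.split x₁ ∘L Γ.tc x₀ x₁ x ∘L Γ.frameInv x₀ x ∘L ContinuousLinearMap.inl ℝ (Fib EG EM) EM

theorem contMDiffOn_change (x₀ x₁ : M) :
    ContMDiffOn 𝓘(ℝ, EM) 𝓘(ℝ, Fib EG EM →L[ℝ] Fib EG EM) ∞ (Γ.change x₀ x₁)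
      (Γ.base x₀ ∩ Γ.base x₁) :=
  contMDiffOn_const.clm_comp (((Γ.contMDiffOn_tc x₀ x₁).mono fun _ h => ⟨h.1.1, h.2.1⟩).clm_comp
    (((Γ.contMDiffOn_frameInv x₀).mono inter_subset_left).clm_comp contMDiffOn_const))

theorem change_eq (x₀ x₁ x : M) (hx : x ∈ Γ.base x₀ ∩ Γ.base x₁) (f : Fib EG EM) :
    Γ.change x₀ x₁ x f = (Γ.pretriv x₁ ⟨x, (Γ.pretriv x₀).symm x f⟩).2 := by
  have h1 : (Γ.pretriv x₀).symm x f = Γ.ofFibA x₀ x f := by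
    rw [Pretrivialization.symm_apply _ hx.1]
    rfl
  rw [h1]
  change _ = Γ.toFib x₁ x (Γ.ofFibA x₀ x f).1
  rw [Γ.coe_ofFibA hx.1]
  change _ = Γ.split x₁ (Γ.tc x x₁ x (Γ.tc x₀ x x _))
  rw [Γ.tc_comp hx.1.1 (Γ.mem_dom x) hx.2.1]
  rfl

/-- The smooth vector bundle structure of `AG`, given by its local trivializations. -/
def prebundle : VectorPrebundle ℝ (Fib EG EM) Γ.A where
  pretrivializationAtlas := range Γ.pretriv
  pretrivialization_linear' := by rintro _ ⟨x, rfl⟩; infer_instance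
  pretrivializationAt := Γ.pretriv
  mem_base_pretrivializationAt := Γ.mem_base
  pretrivialization_mem_atlas := mem_range_self
  exists_coordChange := by
    rintro _ ⟨x₀, rfl⟩ _ ⟨x₁, rfl⟩
    exact ⟨Γ.change x₀ x₁, (Γ.contMDiffOn_change x₀ x₁).continuousOn, Γ.change_eq x₀ x₁⟩
  totalSpaceMk_isInducing x := by
    have := Γ.finiteDimensional_A x
    let l : Γ.A x →ₗ[ℝ] Fib EG EM := (Γ.toFib x x).toLinearMap ∘ₗ (Γ.kerSrc (Γ.unit x)).subtype
    have hl : Function.Injective l := fun v w h => Subtype.ext <| by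
      have := congrArg (Γ.ofFib x x) h
      rwa [show Γ.ofFib x x (l v) = v.1 from Γ.ofFib_toFib (Γ.mem_base x) v.2,
        show Γ.ofFib x x (l w) = w.1 from Γ.ofFib_toFib (Γ.mem_base x) w.2] at this
    exact (isInducing_const_prod (x := x)).2
      (LinearMap.isClosedEmbedding_of_injective (LinearMap.ker_eq_bot.2 hl)).isInducing

instance : Γ.prebundle.IsContMDiff 𝓘(ℝ, EM) ∞ where
  exists_contMDiffCoordChange := by
    rintro _ ⟨x₀, rfl⟩ _ ⟨x₁, rfl⟩
    exact ⟨Γ.change x₀ x₁, Γ.contMDiffOn_change x₀ x₁, Γ.change_eq x₀ x₁⟩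

instance : TopologicalSpace (TotalSpace (Fib EG EM) Γ.A) := Γ.prebundle.totalSpaceTopology
instance : FiberBundle (Fib EG EM) Γ.A := Γ.prebundle.toFiberBundle
instance : VectorBundle ℝ (Fib EG EM) Γ.A := Γ.prebundle.toVectorBundle
instance : ContMDiffVectorBundle ∞ (Fib EG EM) Γ.A 𝓘(ℝ, EM) :=
  Γ.prebundle.contMDiffVectorBundle 𝓘(ℝ, EM)

/-- The fibres of the dual bundle `A^*G`. -/
abbrev DualFib (x : M) : Type _ := Γ.A x →L[ℝ] Bundle.Trivial M ℝ x
/-- The total space of the dual bundle `A^*G`, a smooth manifold. -/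
abbrev DualA : Type _ := TotalSpace (Fib EG EM →L[ℝ] ℝ) Γ.DualFib

/-- The model with corners of the manifold `A^*G`. -/
abbrev modelDual (_ : LieGroupoid EG EM G M) :
    ModelWithCorners ℝ (EM × (Fib EG EM →L[ℝ] ℝ)) (ModelProd EM (Fib EG EM →L[ℝ] ℝ)) :=
  𝓘(ℝ, EM).prod 𝓘(ℝ, Fib EG EM →L[ℝ] ℝ)

/-- The inclusion `A_x G → T_{ε(x)} G`. -/
def incl (x : M) : Γ.A x →L[ℝ] TangentSpace 𝓘(ℝ, EG) (Γ.unit x) :=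
  (Γ.kerSrc (Γ.unit x)).subtypeL

/-! ### The Lie algebroid `AG`

Derivatives of left and right translations are taken within the source or target fibre on which
they are defined; they are only ever applied to vectors tangent to that fibre, where they are
uniquely determined. -/

/-- The section `X` of `AG` is smooth at `x`. -/
def SmoothAt (X : ∀ x, Γ.A x) (x : M) : Prop :=
  ContMDiffAt 𝓘(ℝ, EM) (𝓘(ℝ, EM).prod 𝓘(ℝ, Fib EG EM)) ∞
    (fun y => TotalSpace.mk' (Fib EG EM) y (X y)) x

/-- The left-invariant vector field `g ↦ (T_{ε(β(g))} l_g) (X (β(g)))`. -/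
def leftField (X : ∀ x, Γ.A x) (g : G) : TangentSpace 𝓘(ℝ, EG) g :=
  mfderivWithin 𝓘(ℝ, EG) 𝓘(ℝ, EG) (fun h => Γ.mul g h) {h | Γ.src h = Γ.tgt g}
    (Γ.unit (Γ.tgt g)) (Γ.incl _ (X (Γ.tgt g)))

/-- The right-invariant vector field `g ↦ -(T_{ε(α(g))} r_g) ((T_{ε(α(g))} i) (X (α(g))))`. -/
def rightField (X : ∀ x, Γ.A x) (g : G) : TangentSpace 𝓘(ℝ, EG) g :=
  -(mfderivWithin 𝓘(ℝ, EG) 𝓘(ℝ, EG) (fun h => Γ.mul h g) {h | Γ.tgt h = Γ.src g}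
    (Γ.unit (Γ.src g))
    (mfderiv 𝓘(ℝ, EG) 𝓘(ℝ, EG) Γ.inv (Γ.unit (Γ.src g)) (Γ.incl _ (X (Γ.src g)))))

open Classical in
/-- The bracket of sections of `AG`: the bracket of the left-invariant vector fields, at the units.
Where `X` and `Y` are smooth, that bracket is tangent to the source fibre, so that the second
alternative does not occur. -/
def bracket (X Y : ∀ x, Γ.A x) (x : M) : Γ.A x :=
  if h : VectorField.mlieBracket 𝓘(ℝ, EG) (Γ.leftField X) (Γ.leftField Y) (Γ.unit x) ∈
      Γ.kerSrc (Γ.unit x) then ⟨_, h⟩ else 0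

open Classical in
/-- The value of a linear form `φ` on a subspace `S` at a vector `w` of `S` (and `0` elsewhere). -/
def evalForm {V : Type*} [AddCommGroup V] [Module ℝ V] {S : Submodule ℝ V} (φ : S →ₗ[ℝ] ℝ)
    (w : V) : ℝ :=
  if h : w ∈ S then φ ⟨w, h⟩ else 0

/-- The action `v ↦ v(f)` of tangent vectors at `p` on a function `f`. -/
def dirDeriv {E H N : Type*} [NormedAddCommGroup E] [NormedSpace ℝ E] [TopologicalSpace H]
    (I : ModelWithCorners ℝ E H) [TopologicalSpace N] [ChartedSpace H N] (f : N → ℝ) (p : N) :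
    TangentSpace I p →L[ℝ] ℝ :=
  mfderiv I 𝓘(ℝ, ℝ) f p

/-! ### The Lie algebroid `P^τ G = Vβ ⊕ Vα` over `G` -/

/-- The fibre `V_g β ⊕ V_g α` of `P^τ G`. -/
def PG (g : G) : Submodule ℝ (TangentSpace 𝓘(ℝ, EG) g × TangentSpace 𝓘(ℝ, EG) g) :=
  (Γ.kerTgt g).prod (Γ.kerSrc g)

/-- The section `(X_right, Y_left)` of `P^τ G` given by two sections `X`, `Y` of `AG`. The anchor
of `P^τ G` is `(u, v) ↦ u + v`, and its Lie bracket is characterized on these sections, which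
generate all sections locally, by
`[(X_right, Y_left), (X'_right, Y'_left)] = (-[X, X']_right, [Y, Y']_left)`. -/
def invSection (X Y : ∀ x, Γ.A x) (g : G) :
    TangentSpace 𝓘(ℝ, EG) g × TangentSpace 𝓘(ℝ, EG) g :=
  (Γ.rightField X g, Γ.leftField Y g)

/-- `dμ (s, s') = ρ(s)(μ(s')) - ρ(s')(μ(s)) - μ([s, s'])` at `g`, for the sections
`s = (X_right, Y_left)` and `s' = (X'_right, Y'_left)` of `P^τ G`. -/
def koszulPG (μ : ∀ g, Γ.PG g →ₗ[ℝ] ℝ) (X Y X' Y' : ∀ x, Γ.A x) (g : G) : ℝ :=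
  dirDeriv 𝓘(ℝ, EG) (fun h => evalForm (μ h) (Γ.invSection X' Y' h)) g
      (Γ.rightField X g + Γ.leftField Y g)
    - dirDeriv 𝓘(ℝ, EG) (fun h => evalForm (μ h) (Γ.invSection X Y h)) g
      (Γ.rightField X' g + Γ.leftField Y' g)
    - evalForm (μ g)
      (-Γ.rightField (Γ.bracket X X') g, Γ.leftField (Γ.bracket Y Y') g)

/-- The differential of a 1-section `μ` of `P^τ G`, as a 2-section: `dμ(g)(u, v)` is computed by
extending `u` and `v` to smooth local sections `(X_right, Y_left)` and `(X'_right, Y'_left)`. The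
value does not depend on the extensions. -/
def dPG (μ : ∀ g, Γ.PG g →ₗ[ℝ] ℝ) (g : G) (u v : Γ.PG g) : ℝ :=
  Classical.epsilon fun c : ℝ => ∃ X Y X' Y' : ∀ x, Γ.A x,
    Γ.SmoothAt X (Γ.src g) ∧ Γ.SmoothAt Y (Γ.tgt g) ∧
    Γ.SmoothAt X' (Γ.src g) ∧ Γ.SmoothAt Y' (Γ.tgt g) ∧
    Γ.invSection X Y g = u.1 ∧ Γ.invSection X' Y' g = v.1 ∧
    c = Γ.koszulPG μ X Y X' Y' g

/-! ### The Lie algebroid `P^{τ*}(AG)` over `A^*G` -/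

/-- The fibre of `P^{τ*}(AG)` at `p`: the pairs `(v, W)` of `v ∈ A_x G`, `x = τ*(p)`, and
`W ∈ T_p (A^*G)` such that `(T β) v = (T τ*) W`. -/
def Prol (p : Γ.DualA) :
    Submodule ℝ (TangentSpace 𝓘(ℝ, EG) (Γ.unit p.proj) × TangentSpace Γ.modelDual p) where
  carrier := {w | w.1 ∈ Γ.kerSrc (Γ.unit p.proj) ∧
    (mfderiv 𝓘(ℝ, EG) 𝓘(ℝ, EM) Γ.tgt (Γ.unit p.proj) w.1 : EM) =
      mfderiv Γ.modelDual 𝓘(ℝ, EM) (fun q : Γ.DualA => q.proj) p w.2}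
  add_mem' := by
    rintro a b ⟨ha, ha'⟩ ⟨hb, hb'⟩
    refine ⟨add_mem ha hb, ?_⟩
    rw [Prod.fst_add, Prod.snd_add, ContinuousLinearMap.map_add, ContinuousLinearMap.map_add]
    exact congrArg₂ (fun s t : EM => s + t) ha' hb'
  zero_mem' :=
    ⟨zero_mem _, (ContinuousLinearMap.map_zero _).trans (ContinuousLinearMap.map_zero _).symm⟩
  smul_mem' := by
    rintro c a ⟨ha, ha'⟩
    refine ⟨Submodule.smul_mem _ c ha, ?_⟩
    rw [Prod.smul_fst, Prod.smul_snd, ContinuousLinearMap.map_smul, ContinuousLinearMap.map_smul]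
    exact congrArg (fun s : EM => c • s) ha'

theorem fst_mem_of_mem_Prol {p : Γ.DualA}
    {w : TangentSpace 𝓘(ℝ, EG) (Γ.unit p.proj) × TangentSpace Γ.modelDual p}
    (h : w ∈ Γ.Prol p) : w.1 ∈ Γ.kerSrc (Γ.unit p.proj) :=
  And.left h

/-- The pair `(X ∘ τ*, U)` of a section `X` of `AG` and a vector field `U` on `A^*G` is a smooth
projectable section of `P^{τ*}(AG)` near `p`. The anchor of `P^{τ*}(AG)` is `(v, W) ↦ W`, and its
Lie bracket is characterized on these sections, which generate all sections locally, by
`[(X ∘ τ*, U), (X' ∘ τ*, U')] = ([X, X'] ∘ τ*, [U, U'])`. -/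
def IsProjectable (X : ∀ x, Γ.A x) (U : ∀ q : Γ.DualA, TangentSpace Γ.modelDual q)
    (p : Γ.DualA) : Prop :=
  Γ.SmoothAt X p.proj ∧
  ContMDiffAt Γ.modelDual Γ.modelDual.tangent ∞
    (fun q => (⟨q, U q⟩ : TangentBundle Γ.modelDual Γ.DualA)) p ∧
  ∀ᶠ q in 𝓝 p, (Γ.incl q.proj (X q.proj), U q) ∈ Γ.Prol q

/-- `dμ (s, s') = ρ(s)(μ(s')) - ρ(s')(μ(s)) - μ([s, s'])` at `p`, for the projectable sections
`s = (X ∘ τ*, U)` and `s' = (X' ∘ τ*, U')` of `P^{τ*}(AG)`. -/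
def koszulProl (μ : ∀ p, Γ.Prol p →ₗ[ℝ] ℝ) (X : ∀ x, Γ.A x)
    (U : ∀ q : Γ.DualA, TangentSpace Γ.modelDual q) (X' : ∀ x, Γ.A x)
    (U' : ∀ q : Γ.DualA, TangentSpace Γ.modelDual q) (p : Γ.DualA) : ℝ :=
  dirDeriv Γ.modelDual
      (fun q => evalForm (μ q) (Γ.incl q.proj (X' q.proj), U' q)) p (U p)
    - dirDeriv Γ.modelDual
      (fun q => evalForm (μ q) (Γ.incl q.proj (X q.proj), U q)) p (U' p)
    - evalForm (μ p) (Γ.incl p.proj (Γ.bracket X X' p.proj),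
      VectorField.mlieBracket Γ.modelDual U U' p)

/-- The differential of a 1-section `μ` of `P^{τ*}(AG)`, as a 2-section: `dμ(p)(u, v)` is computed
by extending `u` and `v` to smooth projectable local sections. The value does not depend on the
extensions. -/
def dProl (μ : ∀ p, Γ.Prol p →ₗ[ℝ] ℝ) (p : Γ.DualA) (u v : Γ.Prol p) : ℝ :=
  Classical.epsilon fun c : ℝ =>
    ∃ (X : ∀ x, Γ.A x) (U : ∀ q : Γ.DualA, TangentSpace Γ.modelDual q)
      (X' : ∀ x, Γ.A x) (U' : ∀ q : Γ.DualA, TangentSpace Γ.modelDual q),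
    Γ.IsProjectable X U p ∧ Γ.IsProjectable X' U' p ∧
    (Γ.incl p.proj (X p.proj), U p) = u.1 ∧ (Γ.incl p.proj (X' p.proj), U' p) = v.1 ∧
    c = Γ.koszulProl μ X U X' U' p

/-- The Liouville section `Θ(p)(v, W) = p(v)`. -/
def liouville (p : Γ.DualA) : Γ.Prol p →ₗ[ℝ] ℝ where
  toFun w := p.2 ⟨w.1.1, Γ.fst_mem_of_mem_Prol w.2⟩
  map_add' a b := p.2.map_add ⟨a.1.1, Γ.fst_mem_of_mem_Prol a.2⟩ ⟨b.1.1, Γ.fst_mem_of_mem_Prol b.2⟩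
  map_smul' c a := p.2.map_smul c ⟨a.1.1, Γ.fst_mem_of_mem_Prol a.2⟩

/-- The canonical symplectic section `Ω = -dΘ`. -/
def omega (p : Γ.DualA) (u v : Γ.Prol p) : ℝ := -Γ.dProl Γ.liouville p u v

/-! ### Poincaré-Cartan sections -/

/-- `Θ_L^-(g)(u, v) = -u(L)`. -/
def thetaMinus (L : G → ℝ) (g : G) : Γ.PG g →ₗ[ℝ] ℝ :=
  -((dirDeriv 𝓘(ℝ, EG) L g).toLinearMap ∘ₗ LinearMap.fst ℝ _ _ ∘ₗ (Γ.PG g).subtype)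

/-- `Θ_L^+(g)(u, v) = v(L)`. -/
def thetaPlus (L : G → ℝ) (g : G) : Γ.PG g →ₗ[ℝ] ℝ :=
  (dirDeriv 𝓘(ℝ, EG) L g).toLinearMap ∘ₗ LinearMap.snd ℝ _ _ ∘ₗ (Γ.PG g).subtype

/-- The Poincaré-Cartan 2-section `Ω_L = -dΘ_L^+`. -/
def omegaLag (L : G → ℝ) (g : G) (u v : Γ.PG g) : ℝ := -Γ.dPG (Γ.thetaPlus L) g u v

/-! ### Discrete Legendre transformations and their prolongations -/

/-- `(F^-L)(h)(v) = -v(L ∘ r_h ∘ i)` for `v ∈ A_{α(h)} G`. -/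
def legMinus (L : G → ℝ) (h : G) : Γ.DualA :=
  ⟨Γ.src h, -((mfderivWithin 𝓘(ℝ, EG) 𝓘(ℝ, ℝ) (fun k => L (Γ.mul (Γ.inv k) h))
    {k | Γ.src k = Γ.src h} (Γ.unit (Γ.src h))).comp (Γ.incl (Γ.src h)))⟩

/-- `(F^+L)(g)(v) = v(L ∘ l_g)` for `v ∈ A_{β(g)} G`. -/
def legPlus (L : G → ℝ) (g : G) : Γ.DualA :=
  ⟨Γ.tgt g, (mfderivWithin 𝓘(ℝ, EG) 𝓘(ℝ, ℝ) (fun k => L (Γ.mul g k))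
    {k | Γ.src k = Γ.tgt g} (Γ.unit (Γ.tgt g))).comp (Γ.incl (Γ.tgt g))⟩

/-- `A_g(Φ^α)(u, v) = (T_g(i ∘ r_{g⁻¹}) u, u + v)`, a map into `P^α_g(AG)`. -/
def isoSrc (g : G) (w : Γ.PG g) :
    TangentSpace 𝓘(ℝ, EG) (Γ.unit (Γ.src g)) × TangentSpace 𝓘(ℝ, EG) g :=
  (mfderivWithin 𝓘(ℝ, EG) 𝓘(ℝ, EG) (fun k => Γ.inv (Γ.mul k (Γ.inv g)))
    {k | Γ.tgt k = Γ.tgt g} g w.1.1, w.1.1 + w.1.2)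

/-- `A_g(Φ^β)(u, v) = (T_g(l_{g⁻¹}) v, u + v)`, a map into `P^β_g(AG)`. -/
def isoTgt (g : G) (w : Γ.PG g) :
    TangentSpace 𝓘(ℝ, EG) (Γ.unit (Γ.tgt g)) × TangentSpace 𝓘(ℝ, EG) g :=
  (mfderivWithin 𝓘(ℝ, EG) 𝓘(ℝ, EG) (fun k => Γ.mul (Γ.inv g) k)
    {k | Γ.src k = Γ.src g} g w.1.2, w.1.1 + w.1.2)

/-- The prolongation `P^τ F^-L = (Id, T F^-L) ∘ A(Φ^α)`. -/
def prolMinus (L : G → ℝ) (g : G) (w : Γ.PG g) :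
    TangentSpace 𝓘(ℝ, EG) (Γ.unit (Γ.legMinus L g).proj) ×
      TangentSpace Γ.modelDual (Γ.legMinus L g) :=
  ((Γ.isoSrc g w).1, mfderiv 𝓘(ℝ, EG) Γ.modelDual (Γ.legMinus L) g (Γ.isoSrc g w).2)

/-- The prolongation `P^τ F^+L = (Id, T F^+L) ∘ A(Φ^β)`. -/
def prolPlus (L : G → ℝ) (g : G) (w : Γ.PG g) :
    TangentSpace 𝓘(ℝ, EG) (Γ.unit (Γ.legPlus L g).proj) ×
      TangentSpace Γ.modelDual (Γ.legPlus L g) :=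
  ((Γ.isoTgt g w).1, mfderiv 𝓘(ℝ, EG) Γ.modelDual (Γ.legPlus L) g (Γ.isoTgt g w).2)

end LieGroupoid

end

/-! Write $\overrightarrow X$ and $\overleftarrow X$ for the invariant fields of a section $X$ of
$AG$. Everything rests on two facts. First, pairing $\mathbb F^+L$ with $X$ gives the function
$\overleftarrow X(L)$ on $G$, and pairing $\mathbb F^-L$ with $X$ gives $\overrightarrow X(L)$
(`legPlus_apply_section`, `legMinus_apply_section`); smoothness of both transformations and the
pullback of $\Theta$ reduce to this. Second, left- and right-invariant fields commute as derivations
of $L$ (`lfD_rfD_comm`), because $L(\gamma(s)\delta(t))$ has symmetric mixed partials.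

In the Koszul formula for $d\Theta_L^+$ on $(\overrightarrow X,\overleftarrow Y)$,
$(\overrightarrow{X'},\overleftarrow{Y'})$ the left-left terms form a commutator, which the bracket
term cancels. What remains is $\overrightarrow
X\,\overleftarrow{Y'}L-\overrightarrow{X'}\,\overleftarrow YL$. For $\Theta_L^-$ the right-right
terms cancel and the same expression remains with the order of the derivations exchanged, so
commutation gives $d\Theta_L^+=d\Theta_L^-$. Commutation also shows that these mixed terms depend
only on the values of the fields at $g$ (`rfD_lfD_congr`), which makes the differential independent
of the extensions.

For $\Omega$, take any projectable extensions $(Z\circ\tau^*,U)$, $(Z'\circ\tau^*,U')$ of two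
prolonged vectors. The chain rule turns the Koszul formula for $\Theta$ into derivatives on $G$ of
the pairings of $\mathbb F^{\pm}L$ with $Z$ and $Z'$ (`koszulProl_liouville`), and the same
cancellation leaves the same mixed terms (`dProl_legPlus`, `dProl_legMinus`).

The analytic difficulty is that a translation is defined only on one fibre of $\alpha$ or $\beta$.
Its derivative is taken within that fibre and is pinned down on tangent vectors by curves in the
fibre (`exists_curve`, `hasMdWithinAt_unique`). When a map on an open set is needed, a local
retraction onto the fibres (`exists_retraction`) extends the translation; this gives smoothness of
the invariant fields and left invariance of their brackets (`lf_bracket`).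

Derivatives and fields are recorded in the model spaces, so that equalities between base points can
be rewritten without transport. -/

noncomputable section

set_option linter.unusedSectionVars false

/-! ### Lie brackets on manifolds as commutators of derivations -/

section MBracket

variable {E H N : Type*} [NormedAddCommGroup E] [NormedSpace ℝ E]
  [TopologicalSpace H] [TopologicalSpace N] [ChartedSpace H N]
  {E' H' N' : Type*} [NormedAddCommGroup E'] [NormedSpace ℝ E']
  [TopologicalSpace H'] [TopologicalSpace N'] [ChartedSpace H' N']
  {E'' H'' N'' : Type*} [NormedAddCommGroup E''] [NormedSpace ℝ E'']
  [TopologicalSpace H''] [TopologicalSpace N''] [ChartedSpace H'' N'']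
  {F : Type*} [NormedAddCommGroup F] [NormedSpace ℝ F]

/-- The derivative of a map between manifolds, as a map between the model spaces. -/
def mdCoord (I : ModelWithCorners ℝ E H) (I' : ModelWithCorners ℝ E' H') (f : N → N') (x : N) :
    E →L[ℝ] E' :=
  mfderiv I I' f x

/-- The Lie bracket of vector fields given as maps into the model space. -/
def brCoord (I : ModelWithCorners ℝ E H) (V W : N → E) (x : N) : E :=
  VectorField.mlieBracket I V W x

variable {I : ModelWithCorners ℝ E H} {I' : ModelWithCorners ℝ E' H'}
  {I'' : ModelWithCorners ℝ E'' H''}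

/-- `HasMFDerivAt`, for derivatives given as maps between the model spaces. -/
def HasMdAt (I : ModelWithCorners ℝ E H) (I' : ModelWithCorners ℝ E' H') (f : N → N') (x : N)
    (A : E →L[ℝ] E') : Prop :=
  HasMFDerivAt I I' f x A

/-- `HasMFDerivWithinAt`, for derivatives given as maps between the model spaces. -/
def HasMdWithinAt (I : ModelWithCorners ℝ E H) (I' : ModelWithCorners ℝ E' H') (f : N → N')
    (s : Set N) (x : N) (A : E →L[ℝ] E') : Prop :=
  HasMFDerivWithinAt I I' f s x A

theorem HasMdAt.mdCoord_eq {f : N → N'} {x : N} {A : E →L[ℝ] E'} (h : HasMdAt I I' f x A) :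
    mdCoord I I' f x = A :=
  h.mfderiv

theorem MDifferentiableAt.hasMdAt {f : N → N'} {x : N} (h : MDifferentiableAt I I' f x) :
    HasMdAt I I' f x (mdCoord I I' f x) :=
  h.hasMFDerivAt

theorem HasMdAt.prodMk {f : N → N'} {g : N → N''} {x : N} {A : E →L[ℝ] E'} {B : E →L[ℝ] E''}
    (hf : HasMdAt I I' f x A) (hg : HasMdAt I I'' g x B) :
    HasMdAt I (I'.prod I'') (fun y => (f y, g y)) x (A.prod B) :=
  HasMFDerivAt.prodMk hf hg

theorem HasMdWithinAt.comp {f : N → N'} {g : N' → N''} {s : Set N} {t : Set N'} {x : N} {y : N'}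
    {A : E →L[ℝ] E'} {B : E' →L[ℝ] E''} (hy : f x = y) (hg : HasMdWithinAt I' I'' g t y B)
    (hf : HasMdWithinAt I I' f s x A) (hst : MapsTo f s t) :
    HasMdWithinAt I I'' (g ∘ f) s x (B ∘L A) := by
  subst hy
  exact HasMFDerivWithinAt.comp x hg hf hst

theorem HasMdAt.hasMdWithinAt {f : N → N'} {s : Set N} {x : N} {A : E →L[ℝ] E'}
    (h : HasMdAt I I' f x A) : HasMdWithinAt I I' f s x A :=
  HasMFDerivAt.hasMFDerivWithinAt h

theorem hasMdWithinAt_univ {f : N → N'} {x : N} {A : E →L[ℝ] E'} :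
    HasMdWithinAt I I' f univ x A ↔ HasMdAt I I' f x A :=
  _root_.hasMFDerivWithinAt_univ

theorem mdCoord_const (c : N') (x : N) (v : E) : mdCoord I I' (fun _ : N => c) x v = 0 := by
  rw [HasMdAt.mdCoord_eq (A := 0) (hasMFDerivAt_const c x)]; rfl

theorem mdCoord_comp {f : N → N'} {g : N' → N''} {x : N} {y : N'} (hy : f x = y)
    (hg : MDifferentiableAt I' I'' g y) (hf : MDifferentiableAt I I' f x) (v : E) :
    mdCoord I I'' (g ∘ f) x v = mdCoord I' I'' g y (mdCoord I I' f x v) := by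
  subst hy
  exact congrArg (fun A : E →L[ℝ] E'' => A v) (mfderiv_comp x hg hf)

theorem mdCoord_congr {f g : N → N'} {x : N} (h : f =ᶠ[𝓝 x] g) :
    mdCoord I I' f x = mdCoord I I' g x :=
  h.mfderiv_eq

theorem mdCoord_extChartAt_self [IsManifold I 1 N] (x : N) (v : E) :
    mdCoord I 𝓘(ℝ, E) (extChartAt I x) x v = v :=
  congrArg (fun A : E →L[ℝ] E => A v) (mfderiv_extChartAt_self (I := I) (x := x))

variable [CompleteSpace E] [I.Boundaryless] [IsManifold I ∞ N]

/-- The expression of a vector field in the chart at `x`. -/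
def chartField (I : ModelWithCorners ℝ E H) (x : N) (V : N → E) : E → E :=
  VectorField.mpullbackWithin 𝓘(ℝ, E) I (extChartAt I x).symm V (range I)

theorem chartField_apply (x : N) (V : N → E) (z : E) : chartField I x V z =
    (mfderivWithin 𝓘(ℝ, E) I (extChartAt I x).symm (range I) z : E →L[ℝ] E).inverse
      (V ((extChartAt I x).symm z)) := rfl

/-- Chain rule through the inverse chart, whose derivative undoes the inverse occurring in
`chartField`. -/
theorem mdCoord_chartField {f : N → F} {x y : N}
    (hy : y ∈ (extChartAt I x).source) (hf : MDifferentiableAt I 𝓘(ℝ, F) f y) (V : N → E) :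
    mdCoord I 𝓘(ℝ, F) f y (V y) = fderiv ℝ (f ∘ (extChartAt I x).symm) (extChartAt I x y)
      (chartField I x V (extChartAt I x y)) := by
  have hz := (extChartAt I x).map_source hy
  have e1 : (extChartAt I x).symm (extChartAt I x y) = y := (extChartAt I x).left_inv hy
  have hd := mdifferentiableWithinAt_extChartAt_symm (I := I) hz
  rw [I.range_eq_univ, mdifferentiableWithinAt_univ] at hd
  have h1 := mdCoord_comp (I'' := 𝓘(ℝ, F)) e1 hf hd (chartField I x V (extChartAt I x y))
  have h2 : mdCoord 𝓘(ℝ, E) I (extChartAt I x).symm (extChartAt I x y)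
      (chartField I x V (extChartAt I x y)) = V y := by
    -- `ContinuousLinearMap.inverse` is zero on non-invertible maps, so invertibility has to be
    -- supplied.
    have hi := isInvertible_mfderivWithin_extChartAt_symm (I := I) hz
    have h3 : ∀ A : E →L[ℝ] E, A.IsInvertible → ∀ v, A (A.inverse v) = v := by
      rintro _ ⟨A, rfl⟩ v
      rw [ContinuousLinearMap.inverse_equiv]; exact A.apply_symm_apply v
    have h4 := h3 _ hi (V ((extChartAt I x).symm (extChartAt I x y)))
    rw [e1, I.range_eq_univ, mfderivWithin_univ] at h4
    rw [chartField_apply, e1, I.range_eq_univ, mfderivWithin_univ]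
    exact h4
  rw [h2] at h1
  rw [← h1, mdCoord, mfderiv_eq_fderiv]

theorem chartField_self (V : N → E) (x : N) : chartField I x V (extChartAt I x x) = V x := by
  have h := mfderivWithin_extChartAt_symm_inverse_apply (I := I) (x := x) (V x)
  rw [chartField_apply, extChartAt_to_inv]
  exact h

theorem differentiableAt_chartField {V : N → E} {x : N}
    (hV : MDifferentiableAt I I.tangent (fun y => (⟨y, V y⟩ : TangentBundle I N)) x) :
    DifferentiableAt ℝ (chartField I x V) (extChartAt I x x) := by
  have := MDifferentiableWithinAt.differentiableWithinAt_mpullbackWithin_vectorField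
    (hV.mdifferentiableWithinAt (s := univ))
  rw [preimage_univ, univ_inter] at this
  exact this.differentiableAt (by rw [I.range_eq_univ]; exact univ_mem)

/-- The manifold bracket is the chart bracket pulled back along the chart, and the chart at `x` has
identity derivative at `x`. -/
theorem brCoord_eq_lieBracket (V W : N → E) (x : N) : brCoord I V W x =
    VectorField.lieBracket ℝ (chartField I x V) (chartField I x W) (extChartAt I x x) := by
  have h : ∀ A : E →L[ℝ] E, A = ContinuousLinearMap.id ℝ E → ∀ v, A.inverse v = v := by
    rintro A rfl v
    rw [ContinuousLinearMap.inverse_id]; rfl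
  refine (h _ (mfderiv_extChartAt_self (I := I) (x := x)) _).trans ?_
  rw [preimage_univ, univ_inter]
  change VectorField.lieBracketWithin ℝ (chartField I x V) (chartField I x W) _ _ = _
  rw [I.range_eq_univ, VectorField.lieBracketWithin_univ]

theorem ContMDiffAt.eventually_mdifferentiableAt [IsManifold I' ∞ N'] {f : N → N'} {x : N}
    (hf : ContMDiffAt I I' 1 f x) : ∀ᶠ y in 𝓝 x, MDifferentiableAt I I' f y :=
  ((contMDiffAt_iff_contMDiffAt_nhds (by simp)).1 hf).mono
    fun _ hy => hy.mdifferentiableAt (by simp)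

theorem ContMDiffAt.contDiffAt_comp_extChartAt_symm {f : N → F} {x : N}
    (hf : ContMDiffAt I 𝓘(ℝ, F) 2 f x) :
    ContDiffAt ℝ 2 (f ∘ (extChartAt I x).symm) (extChartAt I x x) := by
  have h1 := contMDiffWithinAt_extChartAt_symm_range (I := I) (n := 2) x
    ((extChartAt I x).map_source (mem_extChartAt_source x))
  rw [I.range_eq_univ, contMDiffWithinAt_univ] at h1
  refine contMDiffAt_iff_contDiffAt.1 (ContMDiffAt.comp (I' := I) _ ?_ h1)
  rwa [extChartAt_to_inv]

/-- Reduces second derivatives along fields to the model space. An equality near `x`, not only at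
`x`, is needed in order to differentiate again. -/
theorem mdCoord_apply_eventuallyEq {f : N → F} {x : N} (hf : ContMDiffAt I 𝓘(ℝ, F) 2 f x)
    (V : N → E) : (fun y => mdCoord I 𝓘(ℝ, F) f y (V y)) =ᶠ[𝓝 x]
      (fun z => fderiv ℝ (f ∘ (extChartAt I x).symm) z (chartField I x V z)) ∘ extChartAt I x := by
  filter_upwards [extChartAt_source_mem_nhds (I := I) x,
    (hf.of_le (by norm_num)).eventually_mdifferentiableAt] with y h1 h2
  exact mdCoord_chartField h1 h2 V

theorem differentiableAt_fderiv_chartField {f : N → F} {V : N → E} {x : N}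
    (hf : ContMDiffAt I 𝓘(ℝ, F) 2 f x)
    (hV : MDifferentiableAt I I.tangent (fun y => (⟨y, V y⟩ : TangentBundle I N)) x) :
    DifferentiableAt ℝ (fun z => fderiv ℝ (f ∘ (extChartAt I x).symm) z (chartField I x V z))
      (extChartAt I x x) :=
  DifferentiableAt.clm_apply ((hf.contDiffAt_comp_extChartAt_symm.fderiv_right
    (m := 1) (by norm_num)).differentiableAt (by simp)) (differentiableAt_chartField hV)

/-- The derivative of a `C^2` function along a differentiable vector field is differentiable. -/
theorem mdifferentiableAt_mdCoord_apply {f : N → F} {V : N → E} {x : N}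
    (hf : ContMDiffAt I 𝓘(ℝ, F) 2 f x)
    (hV : MDifferentiableAt I I.tangent (fun y => (⟨y, V y⟩ : TangentBundle I N)) x) :
    MDifferentiableAt I 𝓘(ℝ, F) (fun y => mdCoord I 𝓘(ℝ, F) f y (V y)) x :=
  ((differentiableAt_fderiv_chartField hf hV).mdifferentiableAt.comp x
    (mdifferentiableAt_extChartAt (mem_chart_source H x))).congr_of_eventuallyEq
      (mdCoord_apply_eventuallyEq hf V)

/-- The Lie bracket acts on functions as the commutator of the derivations. -/
theorem mdCoord_brCoord {f : N → F} {V W : N → E} {x : N}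
    (hf : ContMDiffAt I 𝓘(ℝ, F) 2 f x)
    (hV : MDifferentiableAt I I.tangent (fun y => (⟨y, V y⟩ : TangentBundle I N)) x)
    (hW : MDifferentiableAt I I.tangent (fun y => (⟨y, W y⟩ : TangentBundle I N)) x) :
    mdCoord I 𝓘(ℝ, F) f x (brCoord I V W x) =
      mdCoord I 𝓘(ℝ, F) (fun y => mdCoord I 𝓘(ℝ, F) f y (W y)) x (V x) -
      mdCoord I 𝓘(ℝ, F) (fun y => mdCoord I 𝓘(ℝ, F) f y (V y)) x (W x) := by
  have hcomp : ∀ (U : N → E) (_ : MDifferentiableAt I I.tangent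
      (fun y => (⟨y, U y⟩ : TangentBundle I N)) x) (v : E),
      mdCoord I 𝓘(ℝ, F) (fun y => mdCoord I 𝓘(ℝ, F) f y (U y)) x v =
      fderiv ℝ (fun z => fderiv ℝ (f ∘ (extChartAt I x).symm) z (chartField I x U z))
        (extChartAt I x x) v := by
    intro U hU v
    rw [mdCoord_congr (mdCoord_apply_eventuallyEq hf U), mdCoord_comp (I' := 𝓘(ℝ, E)) rfl
      (differentiableAt_fderiv_chartField hf hU).mdifferentiableAt
      (mdifferentiableAt_extChartAt (mem_chart_source H x)), mdCoord_extChartAt_self, mdCoord,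
      mfderiv_eq_fderiv]
  rw [hcomp _ hV, hcomp _ hW, mdCoord_chartField (mem_extChartAt_source x)
      (hf.mdifferentiableAt (by simp)), chartField_self, brCoord_eq_lieBracket,
    VectorField.fderiv_apply_lieBracket hf.contDiffAt_comp_extChartAt_symm (by simp)
      (differentiableAt_chartField hW) (differentiableAt_chartField hV),
    chartField_self, chartField_self]

variable [CompleteSpace E'] [I'.Boundaryless] [IsManifold I' ∞ N']

/-- The brackets of related vector fields are related. -/
theorem mdCoord_brCoord_of_related {f : N → N'} {V W : N → E} {V' W' : N' → E'} {x : N} {y : N'}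
    (hy : f x = y) (hf : ContMDiffAt I I' 2 f x)
    (hV : MDifferentiableAt I I.tangent (fun z => (⟨z, V z⟩ : TangentBundle I N)) x)
    (hW : MDifferentiableAt I I.tangent (fun z => (⟨z, W z⟩ : TangentBundle I N)) x)
    (hV' : MDifferentiableAt I' I'.tangent (fun z => (⟨z, V' z⟩ : TangentBundle I' N')) y)
    (hW' : MDifferentiableAt I' I'.tangent (fun z => (⟨z, W' z⟩ : TangentBundle I' N')) y)
    (hVV : ∀ᶠ z in 𝓝 x, mdCoord I I' f z (V z) = V' (f z))
    (hWW : ∀ᶠ z in 𝓝 x, mdCoord I I' f z (W z) = W' (f z)) :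
    mdCoord I I' f x (brCoord I V W x) = brCoord I' V' W' y := by
  subst hy
  -- A vector at `f x` is recovered from the derivative of the chart at `f x`, which is the identity
  -- there. Testing on `ψ` therefore turns relatedness of brackets into the commutator formula, with
  -- no invertibility of `f`.
  set ψ := extChartAt I' (f x) with hψ
  have hψs : ContMDiffAt I' 𝓘(ℝ, E') 2 ψ (f x) := contMDiffAt_extChartAt
  have hψf : ContMDiffAt I 𝓘(ℝ, E') 2 (ψ ∘ f) x := hψs.comp x hf
  have hdf : MDifferentiableAt I I' f x := hf.mdifferentiableAt (by simp)
  have hd : ∀ U : N' → E', MDifferentiableAt I' I'.tangent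
      (fun z => (⟨z, U z⟩ : TangentBundle I' N')) (f x) →
      MDifferentiableAt I' 𝓘(ℝ, E') (fun z => mdCoord I' 𝓘(ℝ, E') ψ z (U z)) (f x) :=
    fun U hU => mdifferentiableAt_mdCoord_apply hψs hU
  have hrel : ∀ (U : N → E) (U' : N' → E'), (∀ᶠ z in 𝓝 x, mdCoord I I' f z (U z) = U' (f z)) →
      (fun z => mdCoord I 𝓘(ℝ, E') (ψ ∘ f) z (U z)) =ᶠ[𝓝 x]
        (fun z => mdCoord I' 𝓘(ℝ, E') ψ z (U' z)) ∘ f := by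
    intro U U' hU
    filter_upwards [hU, (hf.of_le (by norm_num)).eventually_mdifferentiableAt,
      hf.continuousAt.eventually (hψs.of_le (by norm_num)).eventually_mdifferentiableAt]
      with z h1 h2 h3
    rw [Function.comp_apply, ← h1, mdCoord_comp rfl h3 h2]
  have h1 := mdCoord_brCoord hψf hV hW
  rw [mdCoord_congr (hrel V V' hVV), mdCoord_congr (hrel W W' hWW),
    mdCoord_comp rfl (hd V' hV') hdf, mdCoord_comp rfl (hd W' hW') hdf, hVV.self_of_nhds,
    hWW.self_of_nhds, ← mdCoord_brCoord hψs hV' hW',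
    mdCoord_comp rfl (hψs.mdifferentiableAt (by simp)) hdf, hψ, mdCoord_extChartAt_self,
    mdCoord_extChartAt_self] at h1
  exact h1

end MBracket

/-! ### Retractions onto the fibres of a submersion, and curves in a fibre -/

section Submersion

variable {E E' N N' : Type*} [NormedAddCommGroup E] [NormedSpace ℝ E]
  [NormedAddCommGroup E'] [NormedSpace ℝ E']
  [TopologicalSpace N] [ChartedSpace E N] [IsManifold 𝓘(ℝ, E) ∞ N]
  [TopologicalSpace N'] [ChartedSpace E' N'] [IsManifold 𝓘(ℝ, E') ∞ N']
  {f : N → N'}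

/-- Near a point, a submersion has a smooth family of retractions onto its fibres. -/
theorem Manifold.IsSubmersion.exists_retraction (hf : IsSubmersion 𝓘(ℝ, E) 𝓘(ℝ, E') ∞ f) (k : N) :
    ∃ R : N' × N → N, R (f k, k) = k ∧
      ContMDiffAt (𝓘(ℝ, E').prod 𝓘(ℝ, E)) 𝓘(ℝ, E) ∞ R (f k, k) ∧
      (∀ᶠ p in 𝓝 (f k, k), f (R p) = p.1) ∧ ∀ᶠ l in 𝓝 k, R (f l, l) = l := by
  obtain ⟨F, _, _, h⟩ := hf.isSubmersionAt k
  set φ := h.domChart.extend 𝓘(ℝ, E) with hφ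
  set ψ := h.codChart.extend 𝓘(ℝ, E') with hψ
  have hw : ∀ l ∈ φ.source, ψ (f l) = (h.equiv (φ l)).1 := by
    intro l hl
    have := h.writtenInCharts (φ.map_source hl)
    simp only [Function.comp_apply] at this
    rwa [← hφ, φ.left_inv hl] at this
  -- In charts where `f` is the first projection, the retraction keeps the fibre coordinate of the
  -- second argument and replaces its base coordinate by that of the first.
  let Z : N' × N → E := fun p => h.equiv.symm (ψ p.1, (h.equiv (φ p.2)).2)
  have hZ : ∀ l ∈ φ.source, Z (f l, l) = φ l := by
    intro l hl
    change h.equiv.symm (ψ (f l), (h.equiv (φ l)).2) = _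
    rw [hw l hl, Prod.mk.eta, h.equiv.symm_apply_apply]
  have hk : k ∈ φ.source := by
    rw [hφ, OpenPartialHomeomorph.extend_source]; exact h.mem_domChart_source
  have hfk : f k ∈ h.codChart.source := h.mem_codChart_source
  have hφ0 : ContMDiffAt 𝓘(ℝ, E) 𝓘(ℝ, E) ∞ φ k :=
    h.domChart.contMDiffAt_extend h.domChart_mem_maximalAtlas h.mem_domChart_source
  have hψ0 : ContMDiffAt 𝓘(ℝ, E') 𝓘(ℝ, E') ∞ ψ (f k) :=
    h.codChart.contMDiffAt_extend h.codChart_mem_maximalAtlas h.mem_codChart_source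
  have hZs : ContMDiffAt (𝓘(ℝ, E').prod 𝓘(ℝ, E)) 𝓘(ℝ, E) ∞ Z (f k, k) := by
    have h1 : ContMDiffAt (𝓘(ℝ, E').prod 𝓘(ℝ, E)) 𝓘(ℝ, E') ∞ (fun p : N' × N => ψ p.1)
      (f k, k) := ContMDiffAt.comp (I' := 𝓘(ℝ, E')) (f k, k) hψ0 contMDiffAt_fst
    have h2 : ContMDiffAt (𝓘(ℝ, E').prod 𝓘(ℝ, E)) 𝓘(ℝ, E) ∞ (fun p : N' × N => φ p.2)
      (f k, k) := ContMDiffAt.comp (I' := 𝓘(ℝ, E)) (f k, k) hφ0 contMDiffAt_snd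
    have h3 : ContMDiff 𝓘(ℝ, E' × E) 𝓘(ℝ, E) ∞
        (fun q : E' × E => h.equiv.symm (q.1, (h.equiv q.2).2)) := by
      rw [contMDiff_iff_contDiff]; fun_prop
    exact ContMDiffAt.comp (I' := 𝓘(ℝ, E' × E)) (g := fun q : E' × E => h.equiv.symm (q.1, (h.equiv q.2).2))
      (f := fun p : N' × N => (ψ p.1, φ p.2)) (f k, k) h3.contMDiffAt (h1.prodMk_space h2)
  have hopen : IsOpen φ.target := h.domChart.isOpen_extend_target
  have hsym : ContMDiffAt 𝓘(ℝ, E) 𝓘(ℝ, E) ∞ φ.symm (φ k) := by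
    have h1 := contMDiffOn_extend_symm (I := 𝓘(ℝ, E)) h.domChart_mem_maximalAtlas
    rw [← h.domChart.extend_target'] at h1
    exact h1.contMDiffAt (hopen.mem_nhds (φ.map_source hk))
  refine ⟨φ.symm ∘ Z, ?_, ?_, ?_, ?_⟩
  · rw [Function.comp_apply, hZ k hk, φ.left_inv hk]
  · exact ContMDiffAt.comp (I' := 𝓘(ℝ, E)) (f k, k) (by rwa [hZ k hk]) hZs
  · have h1 : ∀ᶠ p in 𝓝 (f k, k), Z p ∈ φ.target :=
      hZs.continuousAt.eventually_mem (hopen.mem_nhds (by rw [hZ k hk]; exact φ.map_source hk))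
    have h2 : ∀ᶠ p in 𝓝 (f k, k), p.1 ∈ h.codChart.source :=
      continuousAt_fst.eventually_mem (h.codChart.open_source.mem_nhds hfk)
    filter_upwards [h1, h2] with p hp1 hp2
    have h3 := φ.map_target hp1
    have h4 := hw _ h3
    rw [φ.right_inv hp1] at h4
    have h5 : (h.equiv (Z p)).1 = ψ p.1 := by
      change (h.equiv (h.equiv.symm _)).1 = _
      rw [h.equiv.apply_symm_apply]
    rw [h5] at h4
    refine ψ.injOn ?_ ?_ h4
    · rw [hψ, OpenPartialHomeomorph.extend_source]
      refine h.mapsto_domChart_source_codChart_source ?_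
      rwa [hφ, OpenPartialHomeomorph.extend_source] at h3
    · rwa [hψ, OpenPartialHomeomorph.extend_source]
  · have h1 : ∀ᶠ l in 𝓝 k, l ∈ φ.source := by
      rw [hφ, OpenPartialHomeomorph.extend_source]
      exact h.domChart.open_source.mem_nhds h.mem_domChart_source
    filter_upwards [h1] with l hl
    rw [Function.comp_apply, hZ l hl, φ.left_inv hl]

/-- A vector tangent to a fibre of a submersion is the velocity of a curve in the fibre. -/
theorem Manifold.IsSubmersion.exists_curve (hf : IsSubmersion 𝓘(ℝ, E) 𝓘(ℝ, E') ∞ f) {k : N} {v : E}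
    (hv : mdCoord 𝓘(ℝ, E) 𝓘(ℝ, E') f k v = 0) :
    ∃ δ : ℝ → N, δ 0 = k ∧ (∀ t, f (δ t) = f k) ∧ ContMDiffAt 𝓘(ℝ, ℝ) 𝓘(ℝ, E) ∞ δ 0 ∧
      mdCoord 𝓘(ℝ, ℝ) 𝓘(ℝ, E) δ 0 1 = v := by
  classical
  obtain ⟨R, hR0, hR, hR1, hR2⟩ := hf.exists_retraction k
  have hsub := hf.contMDiff
  let φ := extChartAt 𝓘(ℝ, E) k
  -- The line `c` has velocity `v` but may leave the fibre; because `v` is vertical, it does so only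
  -- to second order.
  let ℓ : ℝ → E := fun t => φ k + t • v
  let c : ℝ → N := fun t => φ.symm (ℓ t)
  have hℓ : ContMDiff 𝓘(ℝ, ℝ) 𝓘(ℝ, E) ∞ ℓ := by
    rw [contMDiff_iff_contDiff]; fun_prop
  have hℓ0 : ℓ 0 = φ k := by simp [ℓ]
  have hc0 : c 0 = k := by simp [c, hℓ0, φ]
  have hsym : ContMDiffAt 𝓘(ℝ, E) 𝓘(ℝ, E) ∞ φ.symm (φ k) :=
    (contMDiffOn_extChartAt_symm (I := 𝓘(ℝ, E)) k).contMDiffAt (extChartAt_target_mem_nhds k)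
  have hc : ContMDiffAt 𝓘(ℝ, ℝ) 𝓘(ℝ, E) ∞ c 0 :=
    ContMDiffAt.comp (I' := 𝓘(ℝ, E)) 0 (by rwa [hℓ0]) hℓ.contMDiffAt
  have hφc : φ ∘ c =ᶠ[𝓝 0] ℓ := by
    have : ∀ᶠ t in 𝓝 (0 : ℝ), ℓ t ∈ φ.target := hℓ.continuous.continuousAt.eventually_mem
      (by rw [hℓ0]; exact extChartAt_target_mem_nhds k)
    exact this.mono fun t ht => φ.right_inv ht
  have hc' : mdCoord 𝓘(ℝ, ℝ) 𝓘(ℝ, E) c 0 1 = v := by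
    have h1 := mdCoord_comp (I := 𝓘(ℝ, ℝ)) (I' := 𝓘(ℝ, E)) (I'' := 𝓘(ℝ, E)) (f := c) (g := φ) hc0
      (mdifferentiableAt_extChartAt (mem_chart_source E k)) (hc.mdifferentiableAt (by simp)) 1
    rw [mdCoord_extChartAt_self, mdCoord_congr hφc] at h1
    rw [← h1, mdCoord, mfderiv_eq_fderiv]
    have : HasDerivAt ℓ ((1 : ℝ) • v) 0 := ((hasDerivAt_id _).smul_const v).const_add _
    change fderiv ℝ ℓ 0 1 = v
    rw [fderiv_apply_one_eq_deriv, this.deriv, one_smul]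
  -- When `a` has zero velocity, the velocity of `R (a t, c t)` does not depend on `a`. The choice
  -- `a = f ∘ c` gives back `c`, hence velocity `v`; constant `a` gives a curve in the fibre with
  -- the same velocity.
  have key : ∀ a : ℝ → N', ContMDiffAt 𝓘(ℝ, ℝ) 𝓘(ℝ, E') ∞ a 0 → a 0 = f k →
      mdCoord 𝓘(ℝ, ℝ) 𝓘(ℝ, E') a 0 1 = 0 →
      ContMDiffAt 𝓘(ℝ, ℝ) 𝓘(ℝ, E) ∞ (fun t => R (a t, c t)) 0 ∧
      mdCoord 𝓘(ℝ, ℝ) 𝓘(ℝ, E) (fun t => R (a t, c t)) 0 1 =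
        mdCoord (𝓘(ℝ, E').prod 𝓘(ℝ, E)) 𝓘(ℝ, E) R (f k, k) (0, v) := by
    intro a ha ha0 ha1
    have h0 : (fun t => (a t, c t)) 0 = (f k, k) := Prod.ext ha0 hc0
    refine ⟨ContMDiffAt.comp (I' := 𝓘(ℝ, E').prod 𝓘(ℝ, E)) 0 (by rwa [ha0, hc0]) (ha.prodMk hc), ?_⟩
    refine (mdCoord_comp (I' := 𝓘(ℝ, E').prod 𝓘(ℝ, E)) (g := R) (f := fun t => (a t, c t)) h0 (hR.mdifferentiableAt (by simp))
      ((ha.prodMk hc).mdifferentiableAt (by simp)) 1).trans ?_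
    have h2 := ((ha.mdifferentiableAt (by simp)).hasMdAt.prodMk
      (hc.mdifferentiableAt (by simp)).hasMdAt)
    rw [h2.mdCoord_eq]
    refine congrArg _ (Prod.ext ha1 hc')
  have hfc : ContMDiffAt 𝓘(ℝ, ℝ) 𝓘(ℝ, E') ∞ (f ∘ c) 0 :=
    ContMDiffAt.comp (I' := 𝓘(ℝ, E)) 0 hsub.contMDiffAt hc
  have hfc' : mdCoord 𝓘(ℝ, ℝ) 𝓘(ℝ, E') (f ∘ c) 0 1 = 0 := by
    rw [mdCoord_comp hc0 (hsub.mdifferentiable (by simp) _) (hc.mdifferentiableAt (by simp)), hc', hv]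
  obtain ⟨-, k2⟩ := key _ hfc (congrArg f hc0) hfc'
  obtain ⟨k3, k4⟩ := key (fun _ => f k) contMDiffAt_const rfl (by
    exact mdCoord_const _ _ _)
  have hck : Tendsto c (𝓝 0) (𝓝 k) := by
    have := hc.continuousAt; rwa [ContinuousAt, hc0] at this
  have e1 : (fun t => R ((f ∘ c) t, c t)) =ᶠ[𝓝 0] c := hck.eventually hR2
  rw [mdCoord_congr e1, hc'] at k2
  have e2 : ∀ᶠ t in 𝓝 (0 : ℝ), f (R (f k, c t)) = f k :=
    (tendsto_const_nhds.prodMk_nhds hck).eventually hR1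
  -- The retracted point is known to lie in the fibre only for small `t`; the default value `k`
  -- keeps the curve there for all `t`.
  have e3 : (fun t => if f (R (f k, c t)) = f k then R (f k, c t) else k) =ᶠ[𝓝 0]
      fun t => R (f k, c t) := e2.mono fun t ht => if_pos ht
  refine ⟨fun t => if f (R (f k, c t)) = f k then R (f k, c t) else k, ?_, ?_, ?_, ?_⟩
  · simp only [hc0, hR0, if_true]
  · intro t
    by_cases ht : f (R (f k, c t)) = f k
    · simp only [if_pos ht]; exact ht
    · simp only [if_neg ht]
  · exact k3.congr_of_eventuallyEq e3
  · rw [mdCoord_congr e3, k4, ← k2]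

end Submersion

/-! ### Derivatives within a fibre, determined by curves in the fibre -/

section CurveVelocity

variable {E E' N N' : Type*} [NormedAddCommGroup E] [NormedSpace ℝ E]
  [NormedAddCommGroup E'] [NormedSpace ℝ E']
  [TopologicalSpace N] [ChartedSpace E N] [IsManifold 𝓘(ℝ, E) ∞ N]
  [TopologicalSpace N'] [ChartedSpace E' N'] [IsManifold 𝓘(ℝ, E') ∞ N']
  {E'' H'' N'' : Type*} [NormedAddCommGroup E''] [NormedSpace ℝ E'']
  [TopologicalSpace H''] {I'' : ModelWithCorners ℝ E'' H''}
  [TopologicalSpace N''] [ChartedSpace H'' N'']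

theorem HasMdWithinAt.mdCoord_comp_curve {F : N → N''} {s : Set N} {k : N} {A : E →L[ℝ] E''}
    (hF : HasMdWithinAt 𝓘(ℝ, E) I'' F s k A) {δ : ℝ → N} (h0 : δ 0 = k)
    (hδ : MDifferentiableAt 𝓘(ℝ, ℝ) 𝓘(ℝ, E) δ 0) (hs : ∀ t, δ t ∈ s) :
    mdCoord 𝓘(ℝ, ℝ) I'' (F ∘ δ) 0 1 = A (mdCoord 𝓘(ℝ, ℝ) 𝓘(ℝ, E) δ 0 1) := by
  have h := HasMdWithinAt.comp h0 hF (hasMdWithinAt_univ.2 hδ.hasMdAt) fun t _ => hs t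
  rw [(hasMdWithinAt_univ.1 h).mdCoord_eq]
  rfl

/-- Derivatives within a fibre of a submersion are determined on the vectors tangent to it. -/
theorem Manifold.IsSubmersion.hasMdWithinAt_unique {f : N → N'}
    (hf : IsSubmersion 𝓘(ℝ, E) 𝓘(ℝ, E') ∞ f) {k : N} {v : E}
    (hv : mdCoord 𝓘(ℝ, E) 𝓘(ℝ, E') f k v = 0) {y : N'} (hk : f k = y) {F F' : N → N''}
    {A B : E →L[ℝ] E''} (hF : HasMdWithinAt 𝓘(ℝ, E) I'' F {l | f l = y} k A)
    (hF' : HasMdWithinAt 𝓘(ℝ, E) I'' F' {l | f l = y} k B) (h : ∀ l, f l = y → F l = F' l) :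
    A v = B v := by
  obtain ⟨δ, h0, h1, h2, h3⟩ := hf.exists_curve hv
  have hδ := h2.mdifferentiableAt (by simp : (∞ : WithTop ℕ∞) ≠ 0)
  have hs : ∀ t, f (δ t) = y := fun t => (h1 t).trans hk
  -- A fibre is in general not a set of unique differentiability, so the two derivatives can be
  -- compared only on tangent vectors: both values are the velocity of the image of one curve.
  rw [← h3, ← hF.mdCoord_comp_curve h0 hδ hs, ← hF'.mdCoord_comp_curve h0 hδ hs]
  exact congrArg (fun γ : ℝ → N'' => mdCoord 𝓘(ℝ, ℝ) I'' γ 0 1) (funext fun t => h _ (hs t))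

end CurveVelocity

namespace LieGroupoid

variable {EG EM G M : Type*}
  [NormedAddCommGroup EG] [NormedSpace ℝ EG] [FiniteDimensional ℝ EG]
  [NormedAddCommGroup EM] [NormedSpace ℝ EM] [FiniteDimensional ℝ EM]
  [TopologicalSpace G] [ChartedSpace EG G] [IsManifold 𝓘(ℝ, EG) ∞ G]
  [TopologicalSpace M] [ChartedSpace EM M] [IsManifold 𝓘(ℝ, EM) ∞ M]
  (Γ : LieGroupoid EG EM G M)

/-! ### Algebra -/

theorem eq_inv_of_mul_eq_unit {g h : G} (hgh : Γ.tgt g = Γ.src h)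
    (h1 : Γ.mul g h = Γ.unit (Γ.src g)) : h = Γ.inv g := by
  have h2 := Γ.mul_assoc (Γ.inv g) g h (Γ.tgt_inv g) hgh
  have h3 := Γ.mul_unit (Γ.inv g)
  rw [Γ.tgt_inv] at h3
  rw [h1, Γ.inv_mul, hgh, Γ.unit_mul, h3] at h2
  exact h2.symm

theorem inv_inv (g : G) : Γ.inv (Γ.inv g) = g :=
  (Γ.eq_inv_of_mul_eq_unit (Γ.tgt_inv g) (by rw [Γ.inv_mul, Γ.src_inv])).symm

theorem inv_unit (x : M) : Γ.inv (Γ.unit x) = Γ.unit x := by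
  refine (Γ.eq_inv_of_mul_eq_unit (by rw [Γ.tgt_unit, Γ.src_unit]) ?_).symm
  have h := Γ.mul_unit (Γ.unit x)
  rw [Γ.tgt_unit] at h
  rw [h, Γ.src_unit]

theorem mul_unit' {g : G} {x : M} (h : x = Γ.tgt g) : Γ.mul g (Γ.unit x) = g :=
  h ▸ Γ.mul_unit g

theorem mul_inv_rev {g h : G} (hgh : Γ.tgt g = Γ.src h) :
    Γ.inv (Γ.mul g h) = Γ.mul (Γ.inv h) (Γ.inv g) := by
  have e1 : Γ.tgt (Γ.inv h) = Γ.src (Γ.inv g) := by rw [Γ.tgt_inv, Γ.src_inv, hgh]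
  have e2 : Γ.tgt h = Γ.src (Γ.mul (Γ.inv h) (Γ.inv g)) := by rw [Γ.src_mul _ _ e1, Γ.src_inv]
  refine (Γ.eq_inv_of_mul_eq_unit (by rw [Γ.tgt_mul _ _ hgh, e2]) ?_).symm
  rw [← Γ.mul_assoc g h _ hgh e2, Γ.mul_assoc h _ _ (Γ.src_inv h).symm e1, Γ.mul_inv, ← hgh,
    ← Γ.src_inv g, Γ.unit_mul, Γ.mul_inv, Γ.src_mul _ _ hgh]

/-! ### Smoothness of products -/

section Products

variable {EN HN N : Type*} [NormedAddCommGroup EN] [NormedSpace ℝ EN] [TopologicalSpace HN]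
  {J : ModelWithCorners ℝ EN HN} [TopologicalSpace N] [ChartedSpace HN N]

/-- The product is smooth only within the composable pairs, so the composition is formed on the part
of `s` where the factors are composable; by the last hypothesis that part is a neighbourhood of `z`
within `s`. -/
theorem contMDiffWithinAt_mul {a b : N → G} {s : Set N} {z : N}
    (ha : ContMDiffWithinAt J 𝓘(ℝ, EG) ∞ a s z) (hb : ContMDiffWithinAt J 𝓘(ℝ, EG) ∞ b s z)
    (hz : Γ.tgt (a z) = Γ.src (b z)) (h : ∀ᶠ w in 𝓝[s] z, Γ.tgt (a w) = Γ.src (b w)) :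
    ContMDiffWithinAt J 𝓘(ℝ, EG) ∞ (fun w => Γ.mul (a w) (b w)) s z :=
  ((Γ.contMDiffOn_mul (a z, b z) hz).comp (f := fun w => (a w, b w)) z
    ((ha.prodMk hb).mono inter_subset_left) inter_subset_right).mono_of_mem_nhdsWithin
    (inter_mem self_mem_nhdsWithin h)

theorem contMDiffAt_mul {a b : N → G} {z : N}
    (ha : ContMDiffAt J 𝓘(ℝ, EG) ∞ a z) (hb : ContMDiffAt J 𝓘(ℝ, EG) ∞ b z)
    (h : ∀ᶠ w in 𝓝 z, Γ.tgt (a w) = Γ.src (b w)) :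
    ContMDiffAt J 𝓘(ℝ, EG) ∞ (fun w => Γ.mul (a w) (b w)) z :=
  Γ.contMDiffWithinAt_mul ha hb h.self_of_nhds (by rwa [nhdsWithin_univ])

end Products

/-! ### Derivatives of the structure maps -/

abbrev dSrc (g : G) : EG →L[ℝ] EM := mdCoord 𝓘(ℝ, EG) 𝓘(ℝ, EM) Γ.src g

abbrev dTgt (g : G) : EG →L[ℝ] EM := mdCoord 𝓘(ℝ, EG) 𝓘(ℝ, EM) Γ.tgt g

abbrev dInv (g : G) : EG →L[ℝ] EG := mdCoord 𝓘(ℝ, EG) 𝓘(ℝ, EG) Γ.inv g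

/-- The derivative at `h` of the left translation by `g`. -/
def dL (g h : G) : EG →L[ℝ] EG :=
  mfderivWithin 𝓘(ℝ, EG) 𝓘(ℝ, EG) (fun k => Γ.mul g k) {k | Γ.src k = Γ.tgt g} h

/-- The derivative at `h` of the right translation by `g`. -/
def dR (g h : G) : EG →L[ℝ] EG :=
  mfderivWithin 𝓘(ℝ, EG) 𝓘(ℝ, EG) (fun k => Γ.mul k g) {k | Γ.tgt k = Γ.src g} h

theorem hasMdAt_src (g : G) : HasMdAt 𝓘(ℝ, EG) 𝓘(ℝ, EM) Γ.src g (Γ.dSrc g) :=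
  (Γ.submersion_src.contMDiff.mdifferentiable (by simp) g).hasMdAt

theorem hasMdAt_tgt (g : G) : HasMdAt 𝓘(ℝ, EG) 𝓘(ℝ, EM) Γ.tgt g (Γ.dTgt g) :=
  (Γ.submersion_tgt.contMDiff.mdifferentiable (by simp) g).hasMdAt

theorem hasMdAt_inv (g : G) : HasMdAt 𝓘(ℝ, EG) 𝓘(ℝ, EG) Γ.inv g (Γ.dInv g) :=
  (Γ.contMDiff_inv.mdifferentiable (by simp) g).hasMdAt

theorem hasMdWithinAt_mul_left {g h : G} (hgh : Γ.src h = Γ.tgt g) :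
    HasMdWithinAt 𝓘(ℝ, EG) 𝓘(ℝ, EG) (fun k => Γ.mul g k) {k | Γ.src k = Γ.tgt g} h (Γ.dL g h) :=
  ((Γ.contMDiffWithinAt_mul (a := fun _ => g) (b := fun k => k) (s := {k | Γ.src k = Γ.tgt g})
    contMDiffWithinAt_const contMDiffWithinAt_id hgh.symm
    (eventually_mem_nhdsWithin.mono fun _ h => h.symm)).mdifferentiableWithinAt
    (by simp)).hasMFDerivWithinAt

theorem hasMdWithinAt_mul_right {g h : G} (hgh : Γ.tgt h = Γ.src g) :
    HasMdWithinAt 𝓘(ℝ, EG) 𝓘(ℝ, EG) (fun k => Γ.mul k g) {k | Γ.tgt k = Γ.src g} h (Γ.dR g h) :=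
  ((Γ.contMDiffWithinAt_mul (a := fun k => k) (b := fun _ => g) (s := {k | Γ.tgt k = Γ.src g})
    contMDiffWithinAt_id contMDiffWithinAt_const hgh eventually_mem_nhdsWithin
    ).mdifferentiableWithinAt (by simp)).hasMFDerivWithinAt

theorem dTgt_dInv (g : G) (v : EG) : Γ.dTgt (Γ.inv g) (Γ.dInv g v) = Γ.dSrc g v := by
  have h := mdCoord_comp (I := 𝓘(ℝ, EG)) (I' := 𝓘(ℝ, EG)) (f := Γ.inv) rfl
    (Γ.hasMdAt_tgt (Γ.inv g)).mdifferentiableAt (Γ.hasMdAt_inv g).mdifferentiableAt v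
  rw [← h]
  exact congrArg (fun f => mdCoord 𝓘(ℝ, EG) 𝓘(ℝ, EM) f g v) (funext Γ.tgt_inv)

theorem dSrc_dInv (g : G) (v : EG) : Γ.dSrc (Γ.inv g) (Γ.dInv g v) = Γ.dTgt g v := by
  have h := mdCoord_comp (I := 𝓘(ℝ, EG)) (I' := 𝓘(ℝ, EG)) (f := Γ.inv) rfl
    (Γ.hasMdAt_src (Γ.inv g)).mdifferentiableAt (Γ.hasMdAt_inv g).mdifferentiableAt v
  rw [← h]
  exact congrArg (fun f => mdCoord 𝓘(ℝ, EG) 𝓘(ℝ, EM) f g v) (funext Γ.src_inv)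

theorem dInv_dInv (g : G) (v : EG) : Γ.dInv (Γ.inv g) (Γ.dInv g v) = v := by
  have h := mdCoord_comp (I := 𝓘(ℝ, EG)) (I' := 𝓘(ℝ, EG)) (f := Γ.inv) rfl
    (Γ.hasMdAt_inv (Γ.inv g)).mdifferentiableAt (Γ.hasMdAt_inv g).mdifferentiableAt v
  rw [← h, show Γ.inv ∘ Γ.inv = id from funext Γ.inv_inv,
    HasMdAt.mdCoord_eq (A := ContinuousLinearMap.id ℝ EG) (hasMFDerivAt_id g)]
  rfl

/-- The map $\alpha\circ l_g$ is constant on the source fibre. This and the next identities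
differentiate a groupoid law along a fibre by means of `hasMdWithinAt_unique`. -/
theorem dSrc_dL {g h : G} (hgh : Γ.src h = Γ.tgt g) {v : EG} (hv : Γ.dSrc h v = 0) :
    Γ.dSrc (Γ.mul g h) (Γ.dL g h v) = 0 :=
  Γ.submersion_src.hasMdWithinAt_unique hv hgh (F := Γ.src ∘ fun k => Γ.mul g k)
    (A := Γ.dSrc (Γ.mul g h) ∘L Γ.dL g h) (B := 0)
    (HasMdWithinAt.comp rfl (Γ.hasMdAt_src _).hasMdWithinAt (t := univ)
      (Γ.hasMdWithinAt_mul_left hgh) (mapsTo_univ _ _))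
    (hasMFDerivWithinAt_const (Γ.src g) _ _) fun k hk => Γ.src_mul g k hk.symm

theorem dTgt_dL {g h : G} (hgh : Γ.src h = Γ.tgt g) {v : EG} (hv : Γ.dSrc h v = 0) :
    Γ.dTgt (Γ.mul g h) (Γ.dL g h v) = Γ.dTgt h v :=
  Γ.submersion_src.hasMdWithinAt_unique hv hgh (F := Γ.tgt ∘ fun k => Γ.mul g k)
    (A := Γ.dTgt (Γ.mul g h) ∘L Γ.dL g h)
    (HasMdWithinAt.comp rfl (Γ.hasMdAt_tgt _).hasMdWithinAt (t := univ)
      (Γ.hasMdWithinAt_mul_left hgh) (mapsTo_univ _ _))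
    (Γ.hasMdAt_tgt h).hasMdWithinAt fun k hk => Γ.tgt_mul g k hk.symm

theorem dL_dL {g h k : G} (hgh : Γ.src h = Γ.tgt g) (hhk : Γ.src k = Γ.tgt h) {v : EG}
    (hv : Γ.dSrc k v = 0) : Γ.dL g (Γ.mul h k) (Γ.dL h k v) = Γ.dL (Γ.mul g h) k v := by
  have e : Γ.tgt (Γ.mul g h) = Γ.tgt h := Γ.tgt_mul g h hgh.symm
  have h1 := Γ.hasMdWithinAt_mul_left (g := Γ.mul g h) (h := k) (hhk.trans e.symm)
  rw [e] at h1
  exact Γ.submersion_src.hasMdWithinAt_unique hv hhk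
    (F := (fun l => Γ.mul g l) ∘ fun l => Γ.mul h l) (A := Γ.dL g (Γ.mul h k) ∘L Γ.dL h k)
    (HasMdWithinAt.comp rfl (Γ.hasMdWithinAt_mul_left
      (by rw [Γ.src_mul h k hhk.symm, hgh])) (Γ.hasMdWithinAt_mul_left hhk)
      fun l (hl : Γ.src l = Γ.tgt h) => (Γ.src_mul h l hl.symm).trans hgh) h1
    fun l hl => Γ.mul_assoc g h l hgh.symm hl.symm

theorem dL_unit {x : M} {h : G} (hx : Γ.src h = x) {v : EG} (hv : Γ.dSrc h v = 0) :
    Γ.dL (Γ.unit x) h v = v := by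
  subst hx
  have e := Γ.tgt_unit (Γ.src h)
  have h1 := Γ.hasMdWithinAt_mul_left (g := Γ.unit (Γ.src h)) (h := h) e.symm
  rw [e] at h1
  exact Γ.submersion_src.hasMdWithinAt_unique hv rfl (B := ContinuousLinearMap.id ℝ EG) h1
    (hasMFDerivWithinAt_id _ h) fun l hl => by rw [← hl]; exact Γ.unit_mul l

/-- Differentiates $r_g=i\circ l_{g^{-1}}\circ i$; it lets statements about right translations be
deduced from those about left translations. -/
theorem dR_eq {g h : G} (hgh : Γ.tgt h = Γ.src g) {v : EG} (hv : Γ.dTgt h v = 0) :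
    Γ.dR g h v = Γ.dInv (Γ.mul (Γ.inv g) (Γ.inv h)) (Γ.dL (Γ.inv g) (Γ.inv h) (Γ.dInv h v)) := by
  have e : Γ.src (Γ.inv h) = Γ.tgt (Γ.inv g) := by rw [Γ.src_inv, Γ.tgt_inv, hgh]
  have h1 : HasMdWithinAt 𝓘(ℝ, EG) 𝓘(ℝ, EG) _ {k | Γ.tgt k = Γ.src g} h _ :=
    HasMdWithinAt.comp rfl (Γ.hasMdAt_inv _).hasMdWithinAt (t := univ)
    (HasMdWithinAt.comp rfl (Γ.hasMdWithinAt_mul_left e) (Γ.hasMdAt_inv h).hasMdWithinAt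
      fun l (hl : Γ.tgt l = Γ.src g) => by
        rw [mem_ofPred_eq, Γ.src_inv, Γ.tgt_inv, hl]) (mapsTo_univ _ _)
  refine (Γ.submersion_tgt.hasMdWithinAt_unique hv hgh (Γ.hasMdWithinAt_mul_right hgh) h1
    fun l hl => ?_).trans rfl
  change _ = Γ.inv (Γ.mul (Γ.inv g) (Γ.inv l))
  rw [Γ.mul_inv_rev (by rw [Γ.src_inv, Γ.tgt_inv, hl]), Γ.inv_inv, Γ.inv_inv]

end LieGroupoid

/-! ### Smoothness of differentials in families -/

section TangentSmooth

variable {E H N : Type*} [NormedAddCommGroup E] [NormedSpace ℝ E]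
  [TopologicalSpace H] [TopologicalSpace N] [ChartedSpace H N]
  {E' H' N' : Type*} [NormedAddCommGroup E'] [NormedSpace ℝ E']
  [TopologicalSpace H'] [TopologicalSpace N'] [ChartedSpace H' N']
  {E'' H'' N'' : Type*} [NormedAddCommGroup E''] [NormedSpace ℝ E'']
  [TopologicalSpace H''] [TopologicalSpace N''] [ChartedSpace H'' N'']
  {I : ModelWithCorners ℝ E H} {I' : ModelWithCorners ℝ E' H'}
  {I'' : ModelWithCorners ℝ E'' H''}
  [IsManifold I ∞ N] [IsManifold I' ∞ N'] [IsManifold I'' ∞ N'']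

/-- The derivatives of a smooth family of maps, along a smooth family of vectors, form a smooth
family. -/
theorem ContMDiffAt.tangent_mdCoord {F : N → N' → N''} {b : N → N'} {v : N → E'} {z : N}
    (hF : ContMDiffAt (I.prod I') I'' ∞ (Function.uncurry F) (z, b z))
    (hv : ContMDiffAt I I'.tangent ∞ (fun w => (⟨b w, v w⟩ : TangentBundle I' N')) z) :
    ContMDiffAt I I''.tangent ∞
      (fun w => (⟨F w (b w), mdCoord I' I'' (F w) (b w) (v w)⟩ : TangentBundle I'' N'')) z := by
  have hb : ContMDiffAt I I' ∞ b z := (contMDiffAt_totalSpace.1 hv).1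
  have hFb : ContMDiffAt I I'' ∞ (fun w => F w (b w)) z :=
    ContMDiffAt.comp (I' := I.prod I') (g := Function.uncurry F) (f := fun w => (w, b w)) z hF
      (contMDiffAt_id.prodMk hb)
  exact ContMDiffAt.clm_apply_of_inCoordinates
    (ϕ := fun w => mfderiv I' I'' (F w) (b w)) (v := v)
    (ContMDiffAt.mfderiv F b hF hb (by simp)) hv hFb

/-- The coordinate of a tangent vector in the trivialization of the tangent bundle at `x`. -/
theorem snd_trivializationAt_eq_mdCoord {x y : N} (hy : y ∈ (chartAt H x).source) (v : E) :
    (trivializationAt E (TangentSpace I) x (⟨y, v⟩ : TangentBundle I N)).2 =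
      mdCoord I 𝓘(ℝ, E) (extChartAt I x) y v := by
  have h := TangentBundle.continuousLinearMapAt_trivializationAt (I := I) hy
  have h2 := congrArg (fun A : E →L[ℝ] E => A v) h
  refine Eq.trans ?_ h2
  exact ((trivializationAt E (TangentSpace I) x).continuousLinearMapAt_apply_of_mem ℝ
    (by simpa using hy) (v : TangentSpace I y)).symm

end TangentSmooth

theorem HasMdWithinAt.congr_of_eventuallyEq {E H N E' H' N' : Type*} [NormedAddCommGroup E]
    [NormedSpace ℝ E] [TopologicalSpace H] [TopologicalSpace N] [ChartedSpace H N]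
    [NormedAddCommGroup E'] [NormedSpace ℝ E']
    [TopologicalSpace H'] [TopologicalSpace N'] [ChartedSpace H' N']
    {I : ModelWithCorners ℝ E H} {I' : ModelWithCorners ℝ E' H'}
    {f g : N → N'} {s : Set N} {x : N} {A : E →L[ℝ] E'}
    (h : HasMdWithinAt I I' f s x A) (hfg : g =ᶠ[𝓝[s] x] f) (hx : x ∈ s) :
    HasMdWithinAt I I' g s x A :=
  HasMFDerivWithinAt.congr_of_eventuallyEq h hfg (hfg.self_of_nhdsWithin hx)

namespace LieGroupoid

variable {EG EM G M : Type*}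
  [NormedAddCommGroup EG] [NormedSpace ℝ EG] [FiniteDimensional ℝ EG]
  [NormedAddCommGroup EM] [NormedSpace ℝ EM] [FiniteDimensional ℝ EM]
  [TopologicalSpace G] [ChartedSpace EG G] [IsManifold 𝓘(ℝ, EG) ∞ G]
  [TopologicalSpace M] [ChartedSpace EM M] [IsManifold 𝓘(ℝ, EM) ∞ M]
  (Γ : LieGroupoid EG EM G M)

/-! ### Smooth sections -/

theorem smoothAt_iff {X : ∀ x, Γ.A x} {x : M} : Γ.SmoothAt X x ↔
    ContMDiffAt 𝓘(ℝ, EM) 𝓘(ℝ, Fib EG EM) ∞ (fun y => Γ.toFib x y (X y).1) x :=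
  contMDiffAt_section x

/-- The local section of `AG` with constant coordinate. -/
theorem smoothAt_ofFibA (x : M) (f : Fib EG EM) {y : M} (hy : y ∈ Γ.base x) :
    Γ.SmoothAt (fun z => Γ.ofFibA x z f) y := by
  rw [smoothAt_iff]
  have h1 : ContMDiffAt 𝓘(ℝ, EM) 𝓘(ℝ, Fib EG EM) ∞ (fun z => Γ.change x y z f) y :=
    (((Γ.contMDiffOn_change x y).contMDiffAt (((Γ.isOpen_base x).inter (Γ.isOpen_base y)).mem_nhds
      ⟨hy, Γ.mem_base y⟩)).clm_apply contMDiffAt_const)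
  refine h1.congr_of_eventuallyEq ?_
  filter_upwards [(Γ.isOpen_base x).mem_nhds hy, (Γ.isOpen_base y).mem_nhds (Γ.mem_base y)]
    with z hz hz'
  rw [Γ.coe_ofFibA hz]
  change Γ.split y (Γ.tc z y z (Γ.tc x z z _)) = _
  rw [Γ.tc_comp hz.1 (Γ.mem_dom z) hz'.1]
  rfl

/-- Every element of `AG` is the value of a smooth section. -/
theorem exists_smoothAt (x : M) {v : EG} (hv : Γ.dSrc (Γ.unit x) v = 0) :
    ∃ X : ∀ x, Γ.A x, Γ.SmoothAt X x ∧ (X x).1 = v :=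
  ⟨fun z => Γ.ofFibA x z (Γ.toFib x x v), Γ.smoothAt_ofFibA x _ (Γ.mem_base x),
    (Γ.coe_ofFibA (Γ.mem_base x) _).trans (Γ.ofFib_toFib (Γ.mem_base x) hv)⟩

-- Smoothness in $AG$ concerns the fibre coordinate only. Since $T\alpha$ kills `X y`, the inverse
-- frame applied to that coordinate and `0` recovers all its tangent coordinates in $TG$.
variable {Γ} in
theorem SmoothAt.contMDiffAt_tangent {X : ∀ x, Γ.A x} {x : M} (hX : Γ.SmoothAt X x) :
    ContMDiffAt 𝓘(ℝ, EM) 𝓘(ℝ, EG).tangent ∞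
      (fun y => (⟨Γ.unit y, (X y).1⟩ : TangentBundle 𝓘(ℝ, EG) G)) x := by
  rw [smoothAt_iff] at hX
  refine contMDiffAt_totalSpace.2 ⟨Γ.contMDiff_unit x, ?_⟩
  have h1 : ContMDiffAt 𝓘(ℝ, EM) 𝓘(ℝ, EG) ∞
      (fun y => Γ.frameInv x y (ContinuousLinearMap.inl ℝ (Fib EG EM) EM (Γ.toFib x y (X y).1))) x :=
    ((Γ.contMDiffOn_frameInv x).contMDiffAt ((Γ.isOpen_base x).mem_nhds (Γ.mem_base x))).clm_apply
      (contMDiffAt_const.clm_apply hX)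
  refine h1.congr_of_eventuallyEq ?_
  filter_upwards [(Γ.isOpen_base x).mem_nhds (Γ.mem_base x)] with y hy
  have h2 : ∀ w : EG, Γ.Tsrc y w = 0 →
      Γ.tc y x y w = Γ.frameInv x y (Γ.toFib x y w, (0 : EM)) := by
    intro w hw
    have h3 : (Γ.toFib x y w, (0 : EM)) = Γ.frame x y (Γ.tc y x y w) := by
      refine Prod.ext rfl ?_
      change 0 = Γ.coordT x y _
      rw [Γ.coordT_eq hy.1, Γ.tc_comp (Γ.mem_dom y) hy.1 (Γ.mem_dom y), Γ.tc_self (Γ.mem_dom y),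
        hw, map_zero]
    rw [h3, Γ.frameInv_frame hy]
  exact h2 (X y).1 (X y).2

/-! ### Invariant vector fields -/

/-- The left-invariant vector field of a section, as a map into the model space. -/
def lf (X : ∀ x, Γ.A x) (g : G) : EG := Γ.dL g (Γ.unit (Γ.tgt g)) (X (Γ.tgt g)).1

/-- The right-invariant vector field of a section, as a map into the model space. -/
def rf (X : ∀ x, Γ.A x) (g : G) : EG :=
  -Γ.dR g (Γ.unit (Γ.src g)) (Γ.dInv (Γ.unit (Γ.src g)) (X (Γ.src g)).1)

/-- Inversion carries a left-invariant field to minus the right-invariant one, so results on left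
fields transfer to right fields. -/
theorem rf_eq (X : ∀ x, Γ.A x) (g : G) : Γ.rf X g = -Γ.dInv (Γ.inv g) (Γ.lf X (Γ.inv g)) := by
  have hv : Γ.dTgt (Γ.unit (Γ.src g)) (Γ.dInv (Γ.unit (Γ.src g)) (X (Γ.src g)).1) = 0 := by
    have h := Γ.dTgt_dInv (Γ.unit (Γ.src g)) (X (Γ.src g)).1
    rw [Γ.inv_unit] at h
    exact h.trans (X (Γ.src g)).2
  have h1 := Γ.dInv_dInv (Γ.unit (Γ.src g)) (X (Γ.src g)).1
  rw [Γ.inv_unit] at h1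
  rw [rf, Γ.dR_eq (Γ.tgt_unit _) hv, Γ.inv_unit, h1, Γ.mul_unit' (Γ.tgt_inv g).symm, lf, Γ.tgt_inv]

theorem dSrc_lf (X : ∀ x, Γ.A x) (g : G) : Γ.dSrc g (Γ.lf X g) = 0 := by
  have h := Γ.dSrc_dL (Γ.src_unit (Γ.tgt g)) (v := (X (Γ.tgt g)).1) (X (Γ.tgt g)).2
  rwa [Γ.mul_unit] at h

theorem dTgt_lf (X : ∀ x, Γ.A x) (g : G) :
    Γ.dTgt g (Γ.lf X g) = Γ.dTgt (Γ.unit (Γ.tgt g)) (X (Γ.tgt g)).1 := by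
  have h := Γ.dTgt_dL (Γ.src_unit (Γ.tgt g)) (v := (X (Γ.tgt g)).1) (X (Γ.tgt g)).2
  rwa [Γ.mul_unit] at h

theorem dTgt_rf (X : ∀ x, Γ.A x) (g : G) : Γ.dTgt g (Γ.rf X g) = 0 := by
  have h := Γ.dTgt_dInv (Γ.inv g) (Γ.lf X (Γ.inv g))
  rw [Γ.inv_inv, dSrc_lf] at h
  rw [rf_eq, map_neg, h, neg_zero]

theorem lf_unit (X : ∀ x, Γ.A x) (x : M) : Γ.lf X (Γ.unit x) = (X x).1 := by
  rw [lf, Γ.tgt_unit]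
  exact Γ.dL_unit (Γ.src_unit x) (X x).2

/-- Left-invariant vector fields are related to themselves by left translations. -/
theorem dL_lf (X : ∀ x, Γ.A x) {g h : G} (hgh : Γ.src h = Γ.tgt g) :
    Γ.dL g h (Γ.lf X h) = Γ.lf X (Γ.mul g h) := by
  have h1 := Γ.dL_dL hgh (Γ.src_unit (Γ.tgt h)) (v := (X (Γ.tgt h)).1) (X (Γ.tgt h)).2
  rw [Γ.mul_unit] at h1
  rw [lf, h1, lf, Γ.tgt_mul _ _ hgh.symm]

variable {Γ} in
/-- The left-invariant vector field of a smooth section is smooth. -/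
theorem SmoothAt.lf {X : ∀ x, Γ.A x} {g : G} (hX : Γ.SmoothAt X (Γ.tgt g)) :
    ContMDiffAt 𝓘(ℝ, EG) 𝓘(ℝ, EG).tangent ∞
      (fun h => (⟨h, Γ.lf X h⟩ : TangentBundle 𝓘(ℝ, EG) G)) g := by
  obtain ⟨R, hR0, hR, hR1, hR2⟩ := Γ.submersion_src.exists_retraction (Γ.unit (Γ.tgt g))
  rw [Γ.src_unit] at hR0 hR hR1
  -- Left translation by `h` lives on one source fibre. Retracting onto that fibre first gives a
  -- family that is smooth near the unit in `h` and `k` jointly and agrees with the translation on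
  -- the fibre.
  let F : G → G → G := fun h k => Γ.mul h (R (Γ.tgt h, k))
  have hp : ContMDiff (𝓘(ℝ, EG).prod 𝓘(ℝ, EG)) (𝓘(ℝ, EM).prod 𝓘(ℝ, EG)) ∞
      (fun p : G × G => (Γ.tgt p.1, p.2)) :=
    (Γ.submersion_tgt.contMDiff.comp contMDiff_fst).prodMk contMDiff_snd
  have hF : ContMDiffAt (𝓘(ℝ, EG).prod 𝓘(ℝ, EG)) 𝓘(ℝ, EG) ∞ (Function.uncurry F)
      (g, Γ.unit (Γ.tgt g)) := by
    refine Γ.contMDiffAt_mul contMDiffAt_fst (ContMDiffAt.comp (I' := 𝓘(ℝ, EM).prod 𝓘(ℝ, EG))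
      (f := fun p : G × G => (Γ.tgt p.1, p.2)) _ hR hp.contMDiffAt) ?_
    have h1 := (hp.continuous.tendsto (g, Γ.unit (Γ.tgt g))).eventually hR1
    exact h1.mono fun p hp => hp.symm
  have hut : ContMDiff 𝓘(ℝ, EG) 𝓘(ℝ, EG) ∞ (fun h => Γ.unit (Γ.tgt h)) :=
    Γ.contMDiff_unit.comp Γ.submersion_tgt.contMDiff
  have hXt := ContMDiffAt.comp (I' := 𝓘(ℝ, EM)) (f := Γ.tgt) g hX.contMDiffAt_tangent
    (Γ.submersion_tgt.contMDiff g)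
  have main := ContMDiffAt.tangent_mdCoord (b := fun h => Γ.unit (Γ.tgt h))
    (v := fun h => (X (Γ.tgt h)).1) hF hXt
  refine main.congr_of_eventuallyEq ?_
  have hu : Tendsto (fun h => Γ.unit (Γ.tgt h)) (𝓝 g) (𝓝 (Γ.unit (Γ.tgt g))) :=
    hut.continuous.tendsto g
  have hd := (tendsto_id.prodMk_nhds hu).eventually
    (hF.of_le (m := 1) (by simp)).eventually_mdifferentiableAt
  filter_upwards [hu.eventually hR2.eventually_nhds, hd] with h h1 h2
  have e : ∀ k, Γ.src k = Γ.tgt h → R (Γ.src k, k) = k → F h k = Γ.mul h k := by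
    intro k hk hk'
    change Γ.mul h (R (Γ.tgt h, k)) = _
    rw [← hk, hk']
  have e0 := e _ (Γ.src_unit _) h1.self_of_nhds
  have h3 : MDifferentiableAt 𝓘(ℝ, EG) 𝓘(ℝ, EG) (F h) (Γ.unit (Γ.tgt h)) :=
    MDifferentiableAt.comp (I' := 𝓘(ℝ, EG).prod 𝓘(ℝ, EG)) (g := Function.uncurry F)
      (f := fun k => (h, k)) _ h2 (mdifferentiableAt_const.prodMk mdifferentiableAt_id)
  have h4 := (h3.hasMdAt.hasMdWithinAt (s := {k | Γ.src k = Γ.tgt h})).congr_of_eventuallyEq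
    (g := fun k => Γ.mul h k) (by
      filter_upwards [nhdsWithin_le_nhds h1, self_mem_nhdsWithin] with k hk hk'
      exact (e k hk' hk).symm) (Γ.src_unit _)
  -- The value of `X` is tangent to the source fibre, where the extension and the translation have
  -- the same derivative.
  have h5 : Γ.lf X h = mdCoord 𝓘(ℝ, EG) 𝓘(ℝ, EG) (F h) (Γ.unit (Γ.tgt h)) (X (Γ.tgt h)).1 :=
    Γ.submersion_src.hasMdWithinAt_unique (X (Γ.tgt h)).2 (Γ.src_unit _)
      (Γ.hasMdWithinAt_mul_left (Γ.src_unit _)) h4 fun _ _ => rfl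
  have h6 : F h (Γ.unit (Γ.tgt h)) = h := by rw [e0, Γ.mul_unit]
  rw [h5, h6]

variable {Γ} in
/-- The right-invariant vector field of a smooth section is smooth. -/
theorem SmoothAt.rf {X : ∀ x, Γ.A x} {g : G} (hX : Γ.SmoothAt X (Γ.src g)) :
    ContMDiffAt 𝓘(ℝ, EG) 𝓘(ℝ, EG).tangent ∞
      (fun h => (⟨h, Γ.rf X h⟩ : TangentBundle 𝓘(ℝ, EG) G)) g := by
  have h1 : ContMDiffAt 𝓘(ℝ, EG) 𝓘(ℝ, EG).tangent ∞
      (fun h => (⟨h, Γ.lf X h⟩ : TangentBundle 𝓘(ℝ, EG) G)) (Γ.inv g) :=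
    SmoothAt.lf (by rwa [Γ.tgt_inv])
  have h2 := ContMDiffAt.comp (I' := 𝓘(ℝ, EG)) (f := Γ.inv) g h1 (Γ.contMDiff_inv g)
  have h3 := ContMDiffAt.tangent_mdCoord (F := fun _ k => Γ.inv k) (b := Γ.inv)
    (v := fun h => Γ.lf X (Γ.inv h))
    ((Γ.contMDiff_inv.comp contMDiff_snd).contMDiffAt) h2
  have hm : ∀ {a b : G} (_ : a = b) (w : EG),
      (⟨a, w⟩ : TangentBundle 𝓘(ℝ, EG) G) = ⟨b, w⟩ := by rintro a _ rfl w; rfl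
  have h4 : ContMDiffAt 𝓘(ℝ, EG) 𝓘(ℝ, EG).tangent ∞
      (fun h => (⟨h, Γ.dInv (Γ.inv h) (Γ.lf X (Γ.inv h))⟩ : TangentBundle 𝓘(ℝ, EG) G)) g :=
    h3.congr_of_eventuallyEq (Eventually.of_forall fun h => hm (Γ.inv_inv h).symm _)
  exact (ContMDiffAt.neg_section h4).congr_of_eventuallyEq (Eventually.of_forall fun h =>
    (congrArg (fun w : EG => (⟨h, w⟩ : TangentBundle 𝓘(ℝ, EG) G)) (Γ.rf_eq X h)).trans rfl)

end LieGroupoid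

/-! ### Signs in brackets, and mixed partial derivatives -/

section Calculus

variable {E H N : Type*} [NormedAddCommGroup E] [NormedSpace ℝ E] [CompleteSpace E]
  [TopologicalSpace H] {I : ModelWithCorners ℝ E H} [I.Boundaryless]
  [TopologicalSpace N] [ChartedSpace H N] [IsManifold I ∞ N]

theorem brCoord_neg_neg {V W : N → E} {x : N}
    (hV : MDifferentiableAt I I.tangent (fun y => (⟨y, V y⟩ : TangentBundle I N)) x)
    (hW : MDifferentiableAt I I.tangent (fun y => (⟨y, W y⟩ : TangentBundle I N)) x) :
    brCoord I (fun y => -V y) (fun y => -W y) x = brCoord I V W x := by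
  have e : ∀ U : N → E, (fun y => -U y) = (-1 : ℝ) • U := fun U => by
    funext y; simp
  have h1 : brCoord I ((-1 : ℝ) • V) ((-1 : ℝ) • W) x = (-1 : ℝ) • brCoord I V ((-1 : ℝ) • W) x :=
    VectorField.mlieBracket_const_smul_left (I := I) (V := V) (W := (-1 : ℝ) • W) hV
  have h2 : brCoord I V ((-1 : ℝ) • W) x = (-1 : ℝ) • brCoord I V W x :=
    VectorField.mlieBracket_const_smul_right (I := I) (V := V) (W := W) hW
  rw [e, e, h1, h2, smul_smul]
  norm_num

theorem brCoord_zero_zero (x : N) : brCoord I (fun _ : N => (0 : E)) (fun _ => 0) x = 0 :=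
  congrFun (VectorField.mlieBracket_zero_left (I := I) (W := fun _ : N => (0 : E))) x

theorem HasDerivAt.clm_apply_const' {E F : Type*} [NormedAddCommGroup E] [NormedSpace ℝ E]
    [NormedAddCommGroup F] [NormedSpace ℝ F] {c : ℝ → E →L[ℝ] F} {c' : E →L[ℝ] F} {t : ℝ}
    (h : HasDerivAt c c' t) (v : E) : HasDerivAt (fun s => c s v) (c' v) t := by
  simpa using h.clm_apply (hasDerivAt_const t v)

theorem HasMdAt.hasDerivAt {F : Type*} [NormedAddCommGroup F] [NormedSpace ℝ F] {c : ℝ → F}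
    {A : ℝ →L[ℝ] F} {t : ℝ} (h : HasMdAt 𝓘(ℝ, ℝ) 𝓘(ℝ, F) c t A) : HasDerivAt c (A 1) t :=
  HasFDerivAt.hasDerivAt (f' := A) (hasMFDerivAt_iff_hasFDerivAt.1 h)

theorem two_le_infty : (2 : WithTop ℕ∞) ≤ ∞ := WithTop.coe_le_coe.2 le_top

/-- Mixed partial derivatives of a `C^2` function of two real variables commute. -/
theorem deriv_partial_comm {ψ : ℝ × ℝ → ℝ} (hψ : ContDiffAt ℝ 2 ψ 0) {a b : ℝ → ℝ}
    (ha : ∀ᶠ s in 𝓝 (0 : ℝ), HasDerivAt (fun t => ψ (s, t)) (a s) 0)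
    (hb : ∀ᶠ t in 𝓝 (0 : ℝ), HasDerivAt (fun s => ψ (s, t)) (b t) 0) :
    deriv a 0 = deriv b 0 := by
  have h1 : DifferentiableAt ℝ (fderiv ℝ ψ) 0 :=
    (hψ.fderiv_right (m := 1) (by norm_num)).differentiableAt (by simp)
  have hd : ∀ᶠ z in 𝓝 (0 : ℝ × ℝ), DifferentiableAt ℝ ψ z :=
    ((hψ.of_le (m := 1) (by norm_num)).eventually (by simp)).mono
      fun z hz => hz.differentiableAt (by simp)
  have c1 : HasDerivAt (fun s : ℝ => ((s, 0) : ℝ × ℝ)) (1, 0) 0 :=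
    (hasDerivAt_id _).prodMk (hasDerivAt_const _ _)
  have c2 : HasDerivAt (fun t : ℝ => ((0, t) : ℝ × ℝ)) (0, 1) 0 :=
    (hasDerivAt_const _ _).prodMk (hasDerivAt_id _)
  have ea : a =ᶠ[𝓝 0] fun s => fderiv ℝ ψ (s, 0) (0, 1) := by
    have h2 : ∀ᶠ s in 𝓝 (0 : ℝ), DifferentiableAt ℝ ψ (s, 0) :=
      c1.continuousAt.eventually hd
    filter_upwards [ha, h2] with s hs hs'
    have h3 : HasDerivAt (fun t : ℝ => ((s, t) : ℝ × ℝ)) (0, 1) 0 :=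
      (hasDerivAt_const _ _).prodMk (hasDerivAt_id _)
    exact hs.unique (hs'.hasFDerivAt.comp_hasDerivAt (0 : ℝ) h3)
  have eb : b =ᶠ[𝓝 0] fun t => fderiv ℝ ψ (0, t) (1, 0) := by
    have h2 : ∀ᶠ t in 𝓝 (0 : ℝ), DifferentiableAt ℝ ψ (0, t) :=
      c2.continuousAt.eventually hd
    filter_upwards [hb, h2] with t ht ht'
    have h3 : HasDerivAt (fun s : ℝ => ((s, t) : ℝ × ℝ)) (1, 0) 0 :=
      (hasDerivAt_id _).prodMk (hasDerivAt_const _ _)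
    exact ht.unique (ht'.hasFDerivAt.comp_hasDerivAt (0 : ℝ) h3)
  have d1 : HasDerivAt (fun s : ℝ => fderiv ℝ ψ (s, 0) (0, 1))
      (fderiv ℝ (fderiv ℝ ψ) 0 (1, 0) (0, 1)) 0 :=
    (HasFDerivAt.comp_hasDerivAt (f := fun s : ℝ => ((s, 0) : ℝ × ℝ)) (0 : ℝ) h1.hasFDerivAt
      c1).clm_apply_const' (0, 1)
  have d2 : HasDerivAt (fun t : ℝ => fderiv ℝ ψ (0, t) (1, 0))
      (fderiv ℝ (fderiv ℝ ψ) 0 (0, 1) (1, 0)) 0 :=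
    (HasFDerivAt.comp_hasDerivAt (f := fun t : ℝ => ((0, t) : ℝ × ℝ)) (0 : ℝ) h1.hasFDerivAt
      c2).clm_apply_const' (1, 0)
  rw [ea.deriv_eq, eb.deriv_eq, d1.deriv, d2.deriv]
  exact hψ.isSymmSndFDerivAt (by simp) _ _

end Calculus

namespace LieGroupoid

variable {EG EM G M : Type*}
  [NormedAddCommGroup EG] [NormedSpace ℝ EG] [FiniteDimensional ℝ EG]
  [NormedAddCommGroup EM] [NormedSpace ℝ EM] [FiniteDimensional ℝ EM]
  [TopologicalSpace G] [ChartedSpace EG G] [IsManifold 𝓘(ℝ, EG) ∞ G]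
  [TopologicalSpace M] [ChartedSpace EM M] [IsManifold 𝓘(ℝ, EM) ∞ M]
  {Γ : LieGroupoid EG EM G M}

/-! ### Brackets of invariant vector fields -/

/-- Left-invariant fields are $\alpha$-related to the zero field, hence so is their bracket. This
rules out the default branch of `bracket`. -/
theorem dSrc_brCoord_lf {X Y : ∀ x, Γ.A x} {g : G} (hX : Γ.SmoothAt X (Γ.tgt g))
    (hY : Γ.SmoothAt Y (Γ.tgt g)) :
    Γ.dSrc g (brCoord 𝓘(ℝ, EG) (Γ.lf X) (Γ.lf Y) g) = 0 := by
  have := FiniteDimensional.complete ℝ EG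
  have := FiniteDimensional.complete ℝ EM
  have h0 : MDifferentiableAt 𝓘(ℝ, EM) 𝓘(ℝ, EM).tangent
      (fun z => (⟨z, (0 : EM)⟩ : TangentBundle 𝓘(ℝ, EM) M)) (Γ.src g) :=
    (contMDiffAt_zeroSection ℝ (TangentSpace 𝓘(ℝ, EM) : M → Type _)
      (n := 1)).mdifferentiableAt (by simp)
  refine (mdCoord_brCoord_of_related (V' := fun _ => 0) (W' := fun _ => 0) rfl
    ((Γ.submersion_src.contMDiff g).of_le two_le_infty) (hX.lf.mdifferentiableAt (by simp))
    (hY.lf.mdifferentiableAt (by simp)) h0 h0 (Eventually.of_forall fun z => Γ.dSrc_lf X z)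
    (Eventually.of_forall fun z => Γ.dSrc_lf Y z)).trans (brCoord_zero_zero _)

theorem coe_bracket {X Y : ∀ x, Γ.A x} {x : M} (hX : Γ.SmoothAt X x) (hY : Γ.SmoothAt Y x) :
    ((Γ.bracket X Y x).1 : EG) = brCoord 𝓘(ℝ, EG) (Γ.lf X) (Γ.lf Y) (Γ.unit x) := by
  have h : VectorField.mlieBracket 𝓘(ℝ, EG) (Γ.leftField X) (Γ.leftField Y) (Γ.unit x) ∈
      Γ.kerSrc (Γ.unit x) :=
    show Γ.dSrc (Γ.unit x) (brCoord 𝓘(ℝ, EG) (Γ.lf X) (Γ.lf Y) (Γ.unit x)) = 0 from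
      dSrc_brCoord_lf (by rwa [Γ.tgt_unit]) (by rwa [Γ.tgt_unit])
  exact congrArg Subtype.val (dif_pos h : Γ.bracket X Y x = ⟨_, h⟩)

/-- The bracket of left-invariant vector fields is left-invariant. -/
theorem lf_bracket {X Y : ∀ x, Γ.A x} {g : G} (hX : Γ.SmoothAt X (Γ.tgt g))
    (hY : Γ.SmoothAt Y (Γ.tgt g)) :
    Γ.lf (Γ.bracket X Y) g = brCoord 𝓘(ℝ, EG) (Γ.lf X) (Γ.lf Y) g := by
  have := FiniteDimensional.complete ℝ EG
  obtain ⟨R, hR0, hR, hR1, -⟩ := Γ.submersion_tgt.exists_retraction g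
  set e := Γ.unit (Γ.tgt g) with he
  have hse : Γ.src e = Γ.tgt g := Γ.src_unit _
  have hte : Γ.tgt e = Γ.tgt g := Γ.tgt_unit _
  let σ : G → G := fun h => R (Γ.src h, g)
  have hpc : ContMDiff 𝓘(ℝ, EG) (𝓘(ℝ, EM).prod 𝓘(ℝ, EG)) ∞ (fun h => (Γ.src h, g)) :=
    Γ.submersion_src.contMDiff.prodMk contMDiff_const
  have hσ : ContMDiffAt 𝓘(ℝ, EG) 𝓘(ℝ, EG) ∞ σ e :=
    ContMDiffAt.comp (I' := 𝓘(ℝ, EM).prod 𝓘(ℝ, EG)) (g := R) (f := fun h => (Γ.src h, g)) e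
      (by rwa [hse]) hpc.contMDiffAt
  have hσt : ∀ᶠ h in 𝓝 e, Γ.tgt (σ h) = Γ.src h := by
    have h1 := hpc.continuous.tendsto e
    rw [hse] at h1
    exact h1.eventually hR1
  have hσe : σ e = g := by
    change R (Γ.src e, g) = g
    rw [hse, hR0]
  let F : G → G := fun h => Γ.mul (σ h) h
  have hF : ContMDiffAt 𝓘(ℝ, EG) 𝓘(ℝ, EG) ∞ F e := Γ.contMDiffAt_mul hσ contMDiffAt_id hσt
  have hFe : F e = g := by
    change Γ.mul (σ e) e = g
    rw [hσe, he, Γ.mul_unit]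
  have hder : ∀ᶠ h in 𝓝 e, ∀ v, Γ.dSrc h v = 0 →
      mdCoord 𝓘(ℝ, EG) 𝓘(ℝ, EG) F h v = Γ.dL (σ h) h v := by
    filter_upwards [hσt, (hF.of_le (m := 1) (by simp)).eventually_mdifferentiableAt] with h h1 h2
    intro v hv
    refine Γ.submersion_src.hasMdWithinAt_unique hv h1.symm h2.hasMdAt.hasMdWithinAt
      (Γ.hasMdWithinAt_mul_left h1.symm) fun k hk => ?_
    change Γ.mul (R (Γ.src k, g)) k = Γ.mul (R (Γ.src h, g)) k
    rw [hk, h1]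
  have hrel : ∀ Z : ∀ x, Γ.A x, ∀ᶠ h in 𝓝 e,
      mdCoord 𝓘(ℝ, EG) 𝓘(ℝ, EG) F h (Γ.lf Z h) = Γ.lf Z (F h) := by
    intro Z
    filter_upwards [hder, hσt] with h h1 h2
    rw [h1 _ (Γ.dSrc_lf Z h), Γ.dL_lf Z h2.symm]
  -- Left-invariant fields are `F`-related to themselves, so the bracket at `g` is the image of the
  -- bracket at the unit. The latter is tangent to the source fibre, where the derivative of `F` is
  -- that of $l_g$.
  have hb := mdCoord_brCoord_of_related hFe (hF.of_le two_le_infty)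
    ((SmoothAt.lf (g := e) (by rwa [hte])).mdifferentiableAt (by simp))
    ((SmoothAt.lf (g := e) (by rwa [hte])).mdifferentiableAt (by simp))
    (hX.lf.mdifferentiableAt (by simp)) (hY.lf.mdifferentiableAt (by simp)) (hrel X) (hrel Y)
  rw [← hb, hder.self_of_nhds _ (dSrc_brCoord_lf (g := e) (by rwa [hte]) (by rwa [hte])), hσe, lf,
    coe_bracket hX hY]

/-- Inversion relates each left field to minus the right field. The two signs cancel inside the
bracket; the one in `rf_eq` survives. -/
theorem rf_bracket {X Y : ∀ x, Γ.A x} {g : G} (hX : Γ.SmoothAt X (Γ.src g))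
    (hY : Γ.SmoothAt Y (Γ.src g)) :
    Γ.rf (Γ.bracket X Y) g = -brCoord 𝓘(ℝ, EG) (Γ.rf X) (Γ.rf Y) g := by
  have := FiniteDimensional.complete ℝ EG
  have hX' : Γ.SmoothAt X (Γ.tgt (Γ.inv g)) := by rwa [Γ.tgt_inv]
  have hY' : Γ.SmoothAt Y (Γ.tgt (Γ.inv g)) := by rwa [Γ.tgt_inv]
  have hrel : ∀ Z : ∀ x, Γ.A x, ∀ k,
      mdCoord 𝓘(ℝ, EG) 𝓘(ℝ, EG) Γ.inv k (Γ.lf Z k) = -Γ.rf Z (Γ.inv k) := by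
    intro Z k
    rw [rf_eq, neg_neg, Γ.inv_inv]
  have hn : ∀ Z : ∀ x, Γ.A x, Γ.SmoothAt Z (Γ.src g) → MDifferentiableAt 𝓘(ℝ, EG)
      𝓘(ℝ, EG).tangent (fun h => (⟨h, -Γ.rf Z h⟩ : TangentBundle 𝓘(ℝ, EG) G)) g :=
    fun Z hZ => (ContMDiffAt.neg_section hZ.rf).mdifferentiableAt (by simp)
  rw [rf_eq, lf_bracket hX' hY', ← brCoord_neg_neg (hX.rf.mdifferentiableAt (by simp))
    (hY.rf.mdifferentiableAt (by simp))]
  exact congrArg Neg.neg (mdCoord_brCoord_of_related (Γ.inv_inv g)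
    ((Γ.contMDiff_inv _).of_le two_le_infty) (hX'.lf.mdifferentiableAt (by simp))
    (hY'.lf.mdifferentiableAt (by simp)) (hn X hX) (hn Y hY)
    (Eventually.of_forall (hrel X)) (Eventually.of_forall (hrel Y)))

/-! ### Left- and right-invariant vector fields commute -/

theorem dR_rf (X : ∀ x, Γ.A x) {g h : G} (hgh : Γ.tgt g = Γ.src h) :
    Γ.dR h g (Γ.rf X g) = Γ.rf X (Γ.mul g h) := by
  have h1 := Γ.dInv_dInv (Γ.inv g) (Γ.lf X (Γ.inv g))
  rw [Γ.inv_inv] at h1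
  rw [Γ.dR_eq hgh (Γ.dTgt_rf X g), rf_eq, map_neg, h1, rf_eq, Γ.mul_inv_rev hgh, map_neg, map_neg,
    Γ.dL_lf X (by rw [Γ.src_inv, Γ.tgt_inv, hgh])]

/-- The derivative of `f` along the left-invariant vector field of `X`. -/
def lfD (X : ∀ x, Γ.A x) (f : G → ℝ) (g : G) : ℝ := mdCoord 𝓘(ℝ, EG) 𝓘(ℝ, ℝ) f g (Γ.lf X g)

/-- The derivative of `f` along the right-invariant vector field of `X`. -/
def rfD (X : ∀ x, Γ.A x) (f : G → ℝ) (g : G) : ℝ := mdCoord 𝓘(ℝ, EG) 𝓘(ℝ, ℝ) f g (Γ.rf X g)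

/-- Take $\gamma$ in the target fibre of $g$ with velocity $\overrightarrow X(g)$, and $\delta$ in
the source fibre through $\epsilon(\beta(g))$ with velocity $Y$. All $\gamma(s)\delta(t)$ are
defined. Differentiating $L(\gamma(s)\delta(t))$ at $t=0$ gives $\overleftarrow YL$ at $\gamma(s)$,
and at $s=0$ gives $\overrightarrow XL$ at $g\,\delta(t)$; both sides are the mixed partial at the
origin. No flows are needed. -/
theorem lfD_rfD_comm {L : G → ℝ} (hL : ContMDiff 𝓘(ℝ, EG) 𝓘(ℝ, ℝ) ∞ L) {X Y : ∀ x, Γ.A x} {g : G}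
    (hX : Γ.SmoothAt X (Γ.src g)) (hY : Γ.SmoothAt Y (Γ.tgt g)) :
    rfD X (lfD Y L) g = lfD Y (rfD X L) g := by
  have := FiniteDimensional.complete ℝ EG
  obtain ⟨γ, γ0, γt, γs, γ'⟩ := Γ.submersion_tgt.exists_curve (Γ.dTgt_rf X g)
  obtain ⟨δ, δ0, δt, δs, δ'⟩ := Γ.submersion_src.exists_curve (k := Γ.unit (Γ.tgt g))
    (v := (Y (Γ.tgt g)).1) (Y (Γ.tgt g)).2
  rw [Γ.src_unit] at δt
  have hcomp : ∀ s t, Γ.tgt (γ s) = Γ.src (δ t) := fun s t => (γt s).trans (δt t).symm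
  have hP : ContMDiffAt 𝓘(ℝ, ℝ × ℝ) 𝓘(ℝ, EG) ∞ (fun p : ℝ × ℝ => Γ.mul (γ p.1) (δ p.2)) 0 := by
    refine Γ.contMDiffAt_mul ?_ ?_ (Eventually.of_forall fun p => hcomp _ _)
    · exact ContMDiffAt.comp (I' := 𝓘(ℝ, ℝ)) (g := γ) (f := Prod.fst) 0 γs
        contDiff_fst.contMDiff.contMDiffAt
    · exact ContMDiffAt.comp (I' := 𝓘(ℝ, ℝ)) (g := δ) (f := Prod.snd) 0 δs
        contDiff_snd.contMDiff.contMDiffAt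
  have hψ : ContDiffAt ℝ 2 (fun p : ℝ × ℝ => L (Γ.mul (γ p.1) (δ p.2))) 0 :=
    (ContMDiffAt.comp (I' := 𝓘(ℝ, EG)) (g := L) 0 hL.contMDiffAt hP).contDiffAt.of_le
      two_le_infty
  have hLd : ∀ h, HasMdAt 𝓘(ℝ, EG) 𝓘(ℝ, ℝ) L h (mdCoord 𝓘(ℝ, EG) 𝓘(ℝ, ℝ) L h) :=
    fun h => (hL.mdifferentiable (by simp) h).hasMdAt
  have γd : HasMdAt 𝓘(ℝ, ℝ) 𝓘(ℝ, EG) γ 0 _ := (γs.mdifferentiableAt (by simp)).hasMdAt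
  have δd : HasMdAt 𝓘(ℝ, ℝ) 𝓘(ℝ, EG) δ 0 _ := (δs.mdifferentiableAt (by simp)).hasMdAt
  have key := deriv_partial_comm hψ (a := fun s => lfD Y L (γ s))
    (b := fun t => rfD X L (Γ.mul g (δ t))) (Eventually.of_forall fun s => ?_)
    (Eventually.of_forall fun t => ?_)
  · have e1 : deriv (fun s => lfD Y L (γ s)) 0 = rfD X (lfD Y L) g := by
      have h1 := HasMdWithinAt.comp γ0 (mdifferentiableAt_mdCoord_apply (I := 𝓘(ℝ, EG))
        (hL.contMDiffAt.of_le two_le_infty)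
        (hY.lf.mdifferentiableAt (by simp))).hasMdAt.hasMdWithinAt (hasMdWithinAt_univ.2 γd)
        (mapsTo_univ _ univ)
      rw [rfD, ← γ']
      exact (hasMdWithinAt_univ.1 h1).hasDerivAt.deriv
    have e2 : deriv (fun t => rfD X L (Γ.mul g (δ t))) 0 = lfD Y (rfD X L) g := by
      have e0 : Γ.mul g (δ 0) = g := by rw [δ0, Γ.mul_unit]
      have h1 := HasMdWithinAt.comp (f := (fun k => Γ.mul g k) ∘ δ) e0 (mdifferentiableAt_mdCoord_apply (I := 𝓘(ℝ, EG))
        (hL.contMDiffAt.of_le two_le_infty)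
        (hX.rf.mdifferentiableAt (by simp))).hasMdAt.hasMdWithinAt (HasMdWithinAt.comp δ0
          (Γ.hasMdWithinAt_mul_left (g := g) (h := Γ.unit (Γ.tgt g)) (Γ.src_unit _))
          (hasMdWithinAt_univ.2 δd) fun t _ => δt t) (mapsTo_univ _ univ)
      rw [lfD, lf, ← δ']
      exact (hasMdWithinAt_univ.1 h1).hasDerivAt.deriv
    rw [← e1, ← e2, key]
  · have e0 : Γ.mul (γ s) (δ 0) = γ s := by rw [δ0, Γ.mul_unit' (γt s).symm]
    have h1 := HasMdWithinAt.comp (f := (fun k => Γ.mul (γ s) k) ∘ δ) e0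
      (hLd _).hasMdWithinAt (t := univ) (HasMdWithinAt.comp δ0
      (Γ.hasMdWithinAt_mul_left (g := γ s) (h := Γ.unit (Γ.tgt g)) (by rw [Γ.src_unit, γt]))
      (hasMdWithinAt_univ.2 δd) fun t _ => (hcomp s t).symm) (mapsTo_univ _ _)
    refine (hasMdWithinAt_univ.1 h1).hasDerivAt.congr_deriv ?_
    simp only [ContinuousLinearMap.comp_apply]
    rw [δ', lfD, lf, γt]
  · have e0 : Γ.mul (γ 0) (δ t) = Γ.mul g (δ t) := by rw [γ0]
    have h1 := HasMdWithinAt.comp (f := (fun k => Γ.mul k (δ t)) ∘ γ) e0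
      (hLd _).hasMdWithinAt (t := univ) (HasMdWithinAt.comp γ0
      (Γ.hasMdWithinAt_mul_right (g := δ t) (h := g) (δt t).symm)
      (hasMdWithinAt_univ.2 γd) fun s _ => hcomp s t) (mapsTo_univ _ _)
    refine (hasMdWithinAt_univ.1 h1).hasDerivAt.congr_deriv ?_
    simp only [ContinuousLinearMap.comp_apply]
    rw [γ', Γ.dR_rf X (δt t).symm, rfD]

end LieGroupoid

namespace LieGroupoid

variable {EG EM G M : Type*}
  [NormedAddCommGroup EG] [NormedSpace ℝ EG] [FiniteDimensional ℝ EG]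
  [NormedAddCommGroup EM] [NormedSpace ℝ EM] [FiniteDimensional ℝ EM]
  [TopologicalSpace G] [ChartedSpace EG G] [IsManifold 𝓘(ℝ, EG) ∞ G]
  [TopologicalSpace M] [ChartedSpace EM M] [IsManifold 𝓘(ℝ, EM) ∞ M]
  {Γ : LieGroupoid EG EM G M}

/-! ### Values of the discrete Legendre transformations -/

theorem legPlus_apply {L : G → ℝ} (hL : ContMDiff 𝓘(ℝ, EG) 𝓘(ℝ, ℝ) ∞ L) (g : G)
    (w : Γ.A (Γ.tgt g)) : ((Γ.legPlus L g).2 w : ℝ) =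
      mdCoord 𝓘(ℝ, EG) 𝓘(ℝ, ℝ) L g (Γ.dL g (Γ.unit (Γ.tgt g)) w.1) := by
  have h1 := HasMdWithinAt.comp (f := fun k => Γ.mul g k) (Γ.mul_unit g)
    (hL.mdifferentiable (by simp) g).hasMdAt.hasMdWithinAt (t := univ)
    (Γ.hasMdWithinAt_mul_left (Γ.src_unit _)) (mapsTo_univ _ _)
  exact Γ.submersion_src.hasMdWithinAt_unique w.2 (Γ.src_unit _)
    (MDifferentiableWithinAt.hasMFDerivWithinAt (HasMFDerivWithinAt.mdifferentiableWithinAt h1)) h1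
    fun _ _ => rfl

/-- The sign in $\mathbb F^-L$ is the sign in the definition of the right-invariant field. -/
theorem legMinus_apply {L : G → ℝ} (hL : ContMDiff 𝓘(ℝ, EG) 𝓘(ℝ, ℝ) ∞ L) (g : G)
    (w : Γ.A (Γ.src g)) : ((Γ.legMinus L g).2 w : ℝ) = mdCoord 𝓘(ℝ, EG) 𝓘(ℝ, ℝ) L g
      (-Γ.dR g (Γ.unit (Γ.src g)) (Γ.dInv (Γ.unit (Γ.src g)) w.1)) := by
  have e : Γ.mul (Γ.unit (Γ.src g)) g = g := Γ.unit_mul g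
  have h0 := HasMdWithinAt.comp (f := Γ.inv) (s := {k | Γ.src k = Γ.src g})
    (Γ.inv_unit (Γ.src g)) (Γ.hasMdWithinAt_mul_right (g := g) (Γ.tgt_unit _))
    (Γ.hasMdAt_inv _).hasMdWithinAt fun k hk => (Γ.tgt_inv k).trans hk
  have h1 := HasMdWithinAt.comp (f := (fun k => Γ.mul k g) ∘ Γ.inv)
    (show Γ.mul (Γ.inv (Γ.unit (Γ.src g))) g = g by rw [Γ.inv_unit, e])
    (hL.mdifferentiable (by simp) g).hasMdAt.hasMdWithinAt (t := univ) h0 (mapsTo_univ _ _)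
  rw [map_neg]
  exact congrArg Neg.neg (Γ.submersion_src.hasMdWithinAt_unique w.2 (Γ.src_unit _)
    (MDifferentiableWithinAt.hasMFDerivWithinAt (HasMFDerivWithinAt.mdifferentiableWithinAt h1)) h1
    fun _ _ => rfl)

/-- This lemma and the next translate questions about $\mathbb F^{\pm}L$ into derivatives of `L`
along invariant fields. -/
theorem legPlus_apply_section {L : G → ℝ} (hL : ContMDiff 𝓘(ℝ, EG) 𝓘(ℝ, ℝ) ∞ L)
    (X : ∀ x, Γ.A x) (g : G) : ((Γ.legPlus L g).2 (X (Γ.tgt g)) : ℝ) = lfD X L g :=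
  legPlus_apply hL g _

theorem legMinus_apply_section {L : G → ℝ} (hL : ContMDiff 𝓘(ℝ, EG) 𝓘(ℝ, ℝ) ∞ L)
    (X : ∀ x, Γ.A x) (g : G) : ((Γ.legMinus L g).2 (X (Γ.src g)) : ℝ) = rfD X L g :=
  legMinus_apply hL g _

/-! ### Differentials of the Poincaré-Cartan 1-sections -/

theorem evalForm_of_mem {V : Type*} [AddCommGroup V] [Module ℝ V] {S : Submodule ℝ V}
    (φ : S →ₗ[ℝ] ℝ) {w : V} (h : w ∈ S) : evalForm φ w = φ ⟨w, h⟩ :=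
  dif_pos h

theorem mem_PG_iff {g : G} {u v : EG} :
    ((u, v) : TangentSpace 𝓘(ℝ, EG) g × TangentSpace 𝓘(ℝ, EG) g) ∈ Γ.PG g ↔
      Γ.dTgt g u = 0 ∧ Γ.dSrc g v = 0 :=
  Iff.rfl

theorem evalForm_thetaPlus (L : G → ℝ) {g : G} {u v : EG} (hu : Γ.dTgt g u = 0)
    (hv : Γ.dSrc g v = 0) : evalForm (Γ.thetaPlus L g)
      ((u, v) : TangentSpace 𝓘(ℝ, EG) g × TangentSpace 𝓘(ℝ, EG) g) =
      mdCoord 𝓘(ℝ, EG) 𝓘(ℝ, ℝ) L g v :=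
  evalForm_of_mem _ (mem_PG_iff.2 ⟨hu, hv⟩)

theorem evalForm_thetaMinus (L : G → ℝ) {g : G} {u v : EG} (hu : Γ.dTgt g u = 0)
    (hv : Γ.dSrc g v = 0) : evalForm (Γ.thetaMinus L g)
      ((u, v) : TangentSpace 𝓘(ℝ, EG) g × TangentSpace 𝓘(ℝ, EG) g) =
      -mdCoord 𝓘(ℝ, EG) 𝓘(ℝ, ℝ) L g u :=
  evalForm_of_mem _ (mem_PG_iff.2 ⟨hu, hv⟩)

theorem lfD_bracket {L : G → ℝ} (hL : ContMDiff 𝓘(ℝ, EG) 𝓘(ℝ, ℝ) ∞ L) {X Y : ∀ x, Γ.A x} {g : G}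
    (hX : Γ.SmoothAt X (Γ.tgt g)) (hY : Γ.SmoothAt Y (Γ.tgt g)) :
    lfD (Γ.bracket X Y) L g = lfD X (lfD Y L) g - lfD Y (lfD X L) g := by
  have := FiniteDimensional.complete ℝ EG
  rw [lfD, lf_bracket hX hY]
  exact mdCoord_brCoord (hL.contMDiffAt.of_le two_le_infty) (hX.lf.mdifferentiableAt (by simp))
    (hY.lf.mdifferentiableAt (by simp))

/-- The order is opposite to `lfD_bracket` because of the sign in `rf_bracket`. -/
theorem rfD_bracket {L : G → ℝ} (hL : ContMDiff 𝓘(ℝ, EG) 𝓘(ℝ, ℝ) ∞ L) {X Y : ∀ x, Γ.A x} {g : G}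
    (hX : Γ.SmoothAt X (Γ.src g)) (hY : Γ.SmoothAt Y (Γ.src g)) :
    rfD (Γ.bracket X Y) L g = rfD Y (rfD X L) g - rfD X (rfD Y L) g := by
  have := FiniteDimensional.complete ℝ EG
  rw [rfD, rf_bracket hX hY, map_neg, ← neg_sub]
  exact congrArg Neg.neg (mdCoord_brCoord (hL.contMDiffAt.of_le two_le_infty)
    (hX.rf.mdifferentiableAt (by simp)) (hY.rf.mdifferentiableAt (by simp)))

/-- $\Theta_L^+$ sees only left components, so the left-left derivatives form the commutator that
the bracket term removes; only mixed terms survive. -/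
theorem koszulPG_thetaPlus {L : G → ℝ} (hL : ContMDiff 𝓘(ℝ, EG) 𝓘(ℝ, ℝ) ∞ L)
    {X Y X' Y' : ∀ x, Γ.A x} {g : G}
    (hY : Γ.SmoothAt Y (Γ.tgt g)) (hY' : Γ.SmoothAt Y' (Γ.tgt g)) :
    Γ.koszulPG (Γ.thetaPlus L) X Y X' Y' g = rfD X (lfD Y' L) g - rfD X' (lfD Y L) g := by
  have h : Γ.koszulPG (Γ.thetaPlus L) X Y X' Y' g =
      mdCoord 𝓘(ℝ, EG) 𝓘(ℝ, ℝ) (fun h => evalForm (Γ.thetaPlus L h)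
        ((Γ.rf X' h, Γ.lf Y' h) : TangentSpace 𝓘(ℝ, EG) h × TangentSpace 𝓘(ℝ, EG) h)) g
        (Γ.rf X g + Γ.lf Y g)
      - mdCoord 𝓘(ℝ, EG) 𝓘(ℝ, ℝ) (fun h => evalForm (Γ.thetaPlus L h)
        ((Γ.rf X h, Γ.lf Y h) : TangentSpace 𝓘(ℝ, EG) h × TangentSpace 𝓘(ℝ, EG) h)) g
        (Γ.rf X' g + Γ.lf Y' g)
      - evalForm (Γ.thetaPlus L g) ((-Γ.rf (Γ.bracket X X') g, Γ.lf (Γ.bracket Y Y') g) :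
        TangentSpace 𝓘(ℝ, EG) g × TangentSpace 𝓘(ℝ, EG) g) := rfl
  have e : ∀ X Y : ∀ x, Γ.A x, (fun h => evalForm (Γ.thetaPlus L h)
      ((Γ.rf X h, Γ.lf Y h) : TangentSpace 𝓘(ℝ, EG) h × TangentSpace 𝓘(ℝ, EG) h)) = lfD Y L :=
    fun X Y => funext fun h => evalForm_thetaPlus L (Γ.dTgt_rf X h) (Γ.dSrc_lf Y h)
  rw [h, e, e, evalForm_thetaPlus L (by rw [map_neg, Γ.dTgt_rf, neg_zero]) (Γ.dSrc_lf _ g)]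
  change _ - lfD (Γ.bracket Y Y') L g = _
  rw [lfD_bracket hL hY hY', map_add, map_add, lfD, lfD, rfD, rfD]
  ring

/-- Mirror image of the preceding lemma: now the right-right terms cancel, and the mixed terms have
the left derivative outside. -/
theorem koszulPG_thetaMinus {L : G → ℝ} (hL : ContMDiff 𝓘(ℝ, EG) 𝓘(ℝ, ℝ) ∞ L)
    {X Y X' Y' : ∀ x, Γ.A x} {g : G}
    (hX : Γ.SmoothAt X (Γ.src g)) (hX' : Γ.SmoothAt X' (Γ.src g)) :
    Γ.koszulPG (Γ.thetaMinus L) X Y X' Y' g = lfD Y' (rfD X L) g - lfD Y (rfD X' L) g := by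
  have h : Γ.koszulPG (Γ.thetaMinus L) X Y X' Y' g =
      mdCoord 𝓘(ℝ, EG) 𝓘(ℝ, ℝ) (fun h => evalForm (Γ.thetaMinus L h)
        ((Γ.rf X' h, Γ.lf Y' h) : TangentSpace 𝓘(ℝ, EG) h × TangentSpace 𝓘(ℝ, EG) h)) g
        (Γ.rf X g + Γ.lf Y g)
      - mdCoord 𝓘(ℝ, EG) 𝓘(ℝ, ℝ) (fun h => evalForm (Γ.thetaMinus L h)
        ((Γ.rf X h, Γ.lf Y h) : TangentSpace 𝓘(ℝ, EG) h × TangentSpace 𝓘(ℝ, EG) h)) g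
        (Γ.rf X' g + Γ.lf Y' g)
      - evalForm (Γ.thetaMinus L g) ((-Γ.rf (Γ.bracket X X') g, Γ.lf (Γ.bracket Y Y') g) :
        TangentSpace 𝓘(ℝ, EG) g × TangentSpace 𝓘(ℝ, EG) g) := rfl
  have e : ∀ X Y : ∀ x, Γ.A x, (fun h => evalForm (Γ.thetaMinus L h)
      ((Γ.rf X h, Γ.lf Y h) : TangentSpace 𝓘(ℝ, EG) h × TangentSpace 𝓘(ℝ, EG) h)) =
      fun h => -rfD X L h :=
    fun X Y => funext fun h => evalForm_thetaMinus L (Γ.dTgt_rf X h) (Γ.dSrc_lf Y h)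
  have hn : ∀ f : G → ℝ, ∀ v : EG, mdCoord 𝓘(ℝ, EG) 𝓘(ℝ, ℝ) (fun h => -f h) g v =
      -mdCoord 𝓘(ℝ, EG) 𝓘(ℝ, ℝ) f g v := fun f v =>
    congrArg (fun A : EG →L[ℝ] ℝ => A v) (mfderiv_neg (I := 𝓘(ℝ, EG)) (f := f) (x := g))
  rw [h, e, e, hn, hn, evalForm_thetaMinus L (by rw [map_neg, Γ.dTgt_rf, neg_zero])
    (Γ.dSrc_lf _ g), map_neg, neg_neg]
  change _ - rfD (Γ.bracket X X') L g = _
  rw [rfD_bracket hL hX hX', map_add, map_add, lfD, lfD, rfD, rfD]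
  ring

/-- The two Poincaré-Cartan 1-sections have the same differential. -/
theorem dPG_thetaPlus_eq {L : G → ℝ} (hL : ContMDiff 𝓘(ℝ, EG) 𝓘(ℝ, ℝ) ∞ L) :
    Γ.dPG (Γ.thetaPlus L) = Γ.dPG (Γ.thetaMinus L) := by
  funext g u v
  -- The Koszul values agree for every admissible choice of extensions, so both `epsilon`s choose
  -- from the same predicate; independence of the extensions is not needed here.
  refine congrArg Classical.epsilon (funext fun c => propext ?_)
  refine exists_congr fun X => exists_congr fun Y => exists_congr fun X' => exists_congr fun Y' => ?_
  refine and_congr_right fun hX => and_congr_right fun hY => and_congr_right fun hX' =>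
    and_congr_right fun hY' => and_congr_right fun _ => and_congr_right fun _ => ?_
  rw [koszulPG_thetaPlus hL hY hY', koszulPG_thetaMinus hL hX hX', lfD_rfD_comm hL hX hY',
    lfD_rfD_comm hL hX' hY]

/-! ### Extension of vectors to invariant vector fields -/

/-- The element of `AG` at `β(g)` corresponding to a vector at `g` tangent to the source fibre. -/
theorem exists_lf_eq {g : G} {v : EG} (hv : Γ.dSrc g v = 0) :
    ∃ Y : ∀ x, Γ.A x, Γ.SmoothAt Y (Γ.tgt g) ∧ (Y (Γ.tgt g)).1 = Γ.dL (Γ.inv g) g v := by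
  refine Γ.exists_smoothAt (Γ.tgt g) ?_
  have h := Γ.dSrc_dL (Γ.tgt_inv g).symm hv
  rwa [Γ.inv_mul] at h

theorem dL_dL_inv {g : G} {v : EG} (hv : Γ.dSrc g v = 0) :
    Γ.dL g (Γ.unit (Γ.tgt g)) (Γ.dL (Γ.inv g) g v) = v := by
  have h := Γ.dL_dL (Γ.src_inv g) (Γ.tgt_inv g).symm hv
  rw [Γ.inv_mul, Γ.mul_inv] at h
  rw [h, Γ.dL_unit rfl hv]

theorem lf_eq_iff {Y : ∀ x, Γ.A x} {g : G} {v : EG} (hv : Γ.dSrc g v = 0) :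
    Γ.lf Y g = v ↔ (Y (Γ.tgt g)).1 = Γ.dL (Γ.inv g) g v := by
  constructor
  · rintro rfl
    rw [Γ.dL_lf Y (Γ.tgt_inv g).symm, Γ.inv_mul, Γ.lf_unit]
  · intro h
    rw [lf]
    exact (congrArg (fun w : EG => Γ.dL g (Γ.unit (Γ.tgt g)) w) h).trans (dL_dL_inv hv)

/-- The vector on the right is $T(i\circ r_{g^{-1}})(u)$, so a section extending it has right field
$-u$ at $g$. This is the source of the signs in the computations with $\mathbb F^-L$. -/
theorem rf_eq_iff {X : ∀ x, Γ.A x} {g : G} {u : EG} (hu : Γ.dTgt g u = 0) :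
    Γ.rf X g = -u ↔ (X (Γ.src g)).1 = Γ.dL g (Γ.inv g) (Γ.dInv g u) := by
  have hv : Γ.dSrc (Γ.inv g) (Γ.dInv g u) = 0 := by rw [Γ.dSrc_dInv, hu]
  have h := lf_eq_iff (Y := X) hv
  rw [Γ.inv_inv, Γ.tgt_inv] at h
  rw [← h, Γ.rf_eq, neg_inj]
  constructor
  · intro h1
    have h2 := Γ.dInv_dInv (Γ.inv g) (Γ.lf X (Γ.inv g))
    rw [Γ.inv_inv, h1] at h2
    exact h2.symm
  · intro h1
    rw [h1, Γ.dInv_dInv]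

theorem exists_smoothAt_lf {g : G} {v : EG} (hv : Γ.dSrc g v = 0) :
    ∃ Y : ∀ x, Γ.A x, Γ.SmoothAt Y (Γ.tgt g) ∧ Γ.lf Y g = v :=
  let ⟨Y, h, h'⟩ := exists_lf_eq hv
  ⟨Y, h, (lf_eq_iff hv).2 h'⟩

theorem exists_smoothAt_rf {g : G} {u : EG} (hu : Γ.dTgt g u = 0) :
    ∃ X : ∀ x, Γ.A x, Γ.SmoothAt X (Γ.src g) ∧ Γ.rf X g = u := by
  have hv : Γ.dSrc (Γ.inv g) (Γ.dInv g (-u)) = 0 := by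
    rw [Γ.dSrc_dInv, map_neg, hu, neg_zero]
  obtain ⟨X, h1, h2⟩ := exists_smoothAt_lf hv
  rw [Γ.tgt_inv] at h1
  refine ⟨X, h1, ?_⟩
  rw [Γ.rf_eq, h2, Γ.dInv_dInv, neg_neg]

end LieGroupoid

/-- A family of linear forms on a Euclidean space is smooth if its values are. -/
theorem contMDiffAt_dual_euclidean {E H N : Type*} [NormedAddCommGroup E] [NormedSpace ℝ E]
    [TopologicalSpace H] [TopologicalSpace N] [ChartedSpace H N] {I : ModelWithCorners ℝ E H}
    {n : ℕ} {A : N → EuclideanSpace ℝ (Fin n) →L[ℝ] ℝ} {z : N}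
    (h : ∀ v, ContMDiffAt I 𝓘(ℝ, ℝ) ∞ (fun w => A w v) z) :
    ContMDiffAt I 𝓘(ℝ, EuclideanSpace ℝ (Fin n) →L[ℝ] ℝ) ∞ A z := by
  let b := EuclideanSpace.basisFun (Fin n) ℝ
  let T : (Fin n → ℝ) →L[ℝ] (EuclideanSpace ℝ (Fin n) →L[ℝ] ℝ) :=
    LinearMap.toContinuousLinearMap (∑ i : Fin n,
      (LinearMap.proj i : (Fin n → ℝ) →ₗ[ℝ] ℝ).smulRight (EuclideanSpace.proj (𝕜 := ℝ) i))
  have e : A = fun w => T fun i => A w (b i) := by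
    funext w
    ext v
    have h1 := congrArg (A w) (b.sum_repr v)
    rw [map_sum] at h1
    rw [← h1]
    simp only [T, LinearMap.coe_toContinuousLinearMap', LinearMap.sum_apply,
      _root_.sum_apply, LinearMap.smulRight_apply, LinearMap.proj_apply,
      _root_.smul_apply, map_smul, smul_eq_mul]
    exact Finset.sum_congr rfl fun i _ => mul_comm _ _
  rw [e]
  exact contMDiffAt_const.clm_apply (contMDiffAt_pi_space.2 fun i => h (b i))

namespace LieGroupoid

variable {EG EM G M : Type*}
  [NormedAddCommGroup EG] [NormedSpace ℝ EG] [FiniteDimensional ℝ EG]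
  [NormedAddCommGroup EM] [NormedSpace ℝ EM] [FiniteDimensional ℝ EM]
  [TopologicalSpace G] [ChartedSpace EG G] [IsManifold 𝓘(ℝ, EG) ∞ G]
  [TopologicalSpace M] [ChartedSpace EM M] [IsManifold 𝓘(ℝ, EM) ∞ M]
  {Γ : LieGroupoid EG EM G M}

/-! ### Smoothness of the discrete Legendre transformations -/

/-- The coordinates of a covector in the dual trivialization are its values on the local sections
`ofFibA` of constant coordinate, so smoothness may be tested on these. -/
theorem contMDiffAt_dualA {E H N : Type*} [NormedAddCommGroup E] [NormedSpace ℝ E]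
    [TopologicalSpace H] [TopologicalSpace N] [ChartedSpace H N] {I : ModelWithCorners ℝ E H}
    {f : N → Γ.DualA} {z : N} (h0 : ContMDiffAt I 𝓘(ℝ, EM) ∞ (fun w => (f w).proj) z)
    (h : ∀ e, ContMDiffAt I 𝓘(ℝ, ℝ) ∞
      (fun w => ((f w).2 (Γ.ofFibA (f z).proj (f w).proj e) : ℝ)) z) :
    ContMDiffAt I Γ.modelDual ∞ f z := by
  refine (contMDiffAt_hom_bundle f).2 ⟨h0, contMDiffAt_dual_euclidean fun e => ?_⟩
  refine (h e).congr_of_eventuallyEq ?_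
  filter_upwards [h0.continuousAt.eventually
    ((Γ.isOpen_base (f z).proj).mem_nhds (Γ.mem_base _))] with w hw
  have h1 : (trivializationAt (Fib EG EM) Γ.A (f z).proj).symmL ℝ (f w).proj e =
      Γ.ofFibA (f z).proj (f w).proj e :=
    by
    have h2 := (trivializationAt (Fib EG EM) Γ.A (f z).proj).symm_apply_apply_mk hw
      (Γ.ofFibA (f z).proj (f w).proj e)
    have h3 : (trivializationAt (Fib EG EM) Γ.A (f z).proj
        ⟨(f w).proj, Γ.ofFibA (f z).proj (f w).proj e⟩).2 = e :=
      (congrArg (Γ.toFib (f z).proj (f w).proj) (Γ.coe_ofFibA hw e)).trans (Γ.toFib_ofFib hw e)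
    rw [h3] at h2
    exact (Trivialization.symmL_apply (R := ℝ) _ hw _).trans h2
  have h4 : ∀ x : M, ∀ r : ℝ, (trivializationAt ℝ (Bundle.Trivial M ℝ)
      (f z).proj).continuousLinearMapAt ℝ x r = r := fun x r => by simp
  exact (h4 _ _).trans (congrArg (f w).2 h1)

theorem contMDiffAt_mdCoord_apply {L : G → ℝ} (hL : ContMDiff 𝓘(ℝ, EG) 𝓘(ℝ, ℝ) ∞ L) {V : G → EG}
    {g : G} (hV : ContMDiffAt 𝓘(ℝ, EG) 𝓘(ℝ, EG).tangent ∞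
      (fun h => (⟨h, V h⟩ : TangentBundle 𝓘(ℝ, EG) G)) g) :
    ContMDiffAt 𝓘(ℝ, EG) 𝓘(ℝ, ℝ) ∞ (fun h => mdCoord 𝓘(ℝ, EG) 𝓘(ℝ, ℝ) L h (V h)) g :=
  (contMDiff_snd_tangentBundle_modelSpace ℝ 𝓘(ℝ, ℝ)).contMDiffAt.comp g
    (ContMDiffAt.tangent_mdCoord (F := fun _ k => L k) (b := fun h => h) (v := V)
      (hL.comp contMDiff_snd).contMDiffAt hV)

theorem contMDiff_legPlus {L : G → ℝ} (hL : ContMDiff 𝓘(ℝ, EG) 𝓘(ℝ, ℝ) ∞ L) :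
    ContMDiff 𝓘(ℝ, EG) Γ.modelDual ∞ (Γ.legPlus L) := fun g => by
  refine contMDiffAt_dualA (Γ.submersion_tgt.contMDiff g) fun e => ?_
  refine (contMDiffAt_mdCoord_apply hL
    (Γ.smoothAt_ofFibA (Γ.tgt g) e (Γ.mem_base _)).lf).congr_of_eventuallyEq
    (Eventually.of_forall fun h => ?_)
  exact legPlus_apply_section hL (fun x => Γ.ofFibA (Γ.tgt g) x e) h

theorem contMDiff_legMinus {L : G → ℝ} (hL : ContMDiff 𝓘(ℝ, EG) 𝓘(ℝ, ℝ) ∞ L) :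
    ContMDiff 𝓘(ℝ, EG) Γ.modelDual ∞ (Γ.legMinus L) := fun g => by
  refine contMDiffAt_dualA (Γ.submersion_src.contMDiff g) fun e => ?_
  refine (contMDiffAt_mdCoord_apply hL
    (Γ.smoothAt_ofFibA (Γ.src g) e (Γ.mem_base _)).rf).congr_of_eventuallyEq
    (Eventually.of_forall fun h => ?_)
  exact legMinus_apply_section hL (fun x => Γ.ofFibA (Γ.src g) x e) h

end LieGroupoid

/-! ### Vector fields with prescribed chart coordinates -/

section Fields

variable {E H N : Type*} [NormedAddCommGroup E] [NormedSpace ℝ E]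
  [TopologicalSpace H] [TopologicalSpace N] [ChartedSpace H N] {I : ModelWithCorners ℝ E H}
  [IsManifold I ∞ N]

theorem mdCoord_extChartAt_isInvertible {x y : N} (hy : y ∈ (chartAt H x).source) :
    (mdCoord I 𝓘(ℝ, E) (extChartAt I x) y).IsInvertible :=
  isInvertible_mfderiv_extChartAt (I := I) (by simpa using hy)

theorem ContinuousLinearMap.IsInvertible.apply_inverse {A : E →L[ℝ] E} (hA : A.IsInvertible)
    (v : E) : A (A.inverse v) = v := by
  obtain ⟨e, rfl⟩ := hA
  rw [ContinuousLinearMap.inverse_equiv]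
  exact e.apply_symm_apply v

/-- A smooth vector field with given coordinates in a chart. -/
theorem exists_contMDiffAt_field {c : N → E} {p : N} (hc : ContMDiffAt I 𝓘(ℝ, E) ∞ c p) :
    ∃ U : N → E, ContMDiffAt I I.tangent ∞ (fun q => (⟨q, U q⟩ : TangentBundle I N)) p ∧
      U p = c p ∧ ∀ᶠ q in 𝓝 p, mdCoord I 𝓘(ℝ, E) (extChartAt I p) q (U q) = c q := by
  have hev : ∀ᶠ q in 𝓝 p, mdCoord I 𝓘(ℝ, E) (extChartAt I p) q
      ((mdCoord I 𝓘(ℝ, E) (extChartAt I p) q).inverse (c q)) = c q := by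
    filter_upwards [(chartAt H p).open_source.mem_nhds (mem_chart_source H p)] with q hq
    exact (mdCoord_extChartAt_isInvertible hq).apply_inverse _
  refine ⟨_, contMDiffAt_totalSpace.2 ⟨contMDiffAt_id, hc.congr_of_eventuallyEq ?_⟩, ?_, hev⟩
  · filter_upwards [hev, (chartAt H p).open_source.mem_nhds (mem_chart_source H p)] with q h1 h2
    exact (snd_trivializationAt_eq_mdCoord h2 _).trans h1
  · have h := hev.self_of_nhds
    rwa [mdCoord_extChartAt_self] at h

theorem ContMDiffAt.mdCoord_extChartAt_apply {V : N → E} {x : N}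
    (hV : ContMDiffAt I I.tangent ∞ (fun y => (⟨y, V y⟩ : TangentBundle I N)) x) :
    ContMDiffAt I 𝓘(ℝ, E) ∞ (fun y => mdCoord I 𝓘(ℝ, E) (extChartAt I x) y (V y)) x := by
  refine (contMDiffAt_totalSpace.1 hV).2.congr_of_eventuallyEq ?_
  filter_upwards [(chartAt H x).open_source.mem_nhds (mem_chart_source H x)] with y hy
  exact (snd_trivializationAt_eq_mdCoord hy _).symm

end Fields

namespace LieGroupoid

variable {EG EM G M : Type*}
  [NormedAddCommGroup EG] [NormedSpace ℝ EG] [FiniteDimensional ℝ EG]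
  [NormedAddCommGroup EM] [NormedSpace ℝ EM] [FiniteDimensional ℝ EM]
  [TopologicalSpace G] [ChartedSpace EG G] [IsManifold 𝓘(ℝ, EG) ∞ G]
  [TopologicalSpace M] [ChartedSpace EM M] [IsManifold 𝓘(ℝ, EM) ∞ M]
  {Γ : LieGroupoid EG EM G M}

/-! ### The anchor -/

/-- The anchor `Tβ`, on sections of `AG`. -/
def anchor (Γ : LieGroupoid EG EM G M) (X : ∀ x, Γ.A x) (x : M) : EM := Γ.dTgt (Γ.unit x) (X x).1

theorem SmoothAt.anchor {X : ∀ x, Γ.A x} {x : M} (hX : Γ.SmoothAt X x) :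
    ContMDiffAt 𝓘(ℝ, EM) 𝓘(ℝ, EM).tangent ∞
      (fun y => (⟨y, Γ.anchor X y⟩ : TangentBundle 𝓘(ℝ, EM) M)) x := by
  have h := ContMDiffAt.tangent_mdCoord (F := fun _ k => Γ.tgt k) (b := Γ.unit)
    (v := fun y => (X y).1) (Γ.submersion_tgt.contMDiff.comp contMDiff_snd).contMDiffAt
    hX.contMDiffAt_tangent
  have hm : ∀ {a b : M} (_ : a = b) (w : EM),
      (⟨a, w⟩ : TangentBundle 𝓘(ℝ, EM) M) = ⟨b, w⟩ := by rintro a _ rfl w; rfl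
  exact h.congr_of_eventuallyEq (Eventually.of_forall fun y => hm (Γ.tgt_unit y).symm _)

/-- A left-invariant field is $\beta$-related to the anchor of its section, and brackets respect
relatedness. -/
theorem anchor_bracket {X Y : ∀ x, Γ.A x} {x : M} (hX : Γ.SmoothAt X x) (hY : Γ.SmoothAt Y x) :
    Γ.anchor (Γ.bracket X Y) x = brCoord 𝓘(ℝ, EM) (Γ.anchor X) (Γ.anchor Y) x := by
  have := FiniteDimensional.complete ℝ EG
  have := FiniteDimensional.complete ℝ EM
  rw [anchor, coe_bracket hX hY]
  have e := Γ.tgt_unit x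
  exact mdCoord_brCoord_of_related e ((Γ.submersion_tgt.contMDiff _).of_le two_le_infty)
    ((SmoothAt.lf (g := Γ.unit x) (by rwa [e])).mdifferentiableAt (by simp))
    ((SmoothAt.lf (g := Γ.unit x) (by rwa [e])).mdifferentiableAt (by simp))
    (hX.anchor.mdifferentiableAt (by simp)) (hY.anchor.mdifferentiableAt (by simp))
    (Eventually.of_forall fun h => Γ.dTgt_lf X h) (Eventually.of_forall fun h => Γ.dTgt_lf Y h)

/-! ### Sections of the prolongation -/

variable (Γ) in
/-- The derivative of the projection `A^*G → M`. -/
abbrev dProj (p : Γ.DualA) : EM × (Fib EG EM →L[ℝ] ℝ) →L[ℝ] EM :=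
  mdCoord Γ.modelDual 𝓘(ℝ, EM) (fun q : Γ.DualA => q.proj) p

theorem mem_Prol_iff {p : Γ.DualA} {v : EG} {W : EM × (Fib EG EM →L[ℝ] ℝ)} :
    ((v, W) : TangentSpace 𝓘(ℝ, EG) (Γ.unit p.proj) × TangentSpace Γ.modelDual p) ∈ Γ.Prol p ↔
      Γ.dSrc (Γ.unit p.proj) v = 0 ∧ Γ.dTgt (Γ.unit p.proj) v = Γ.dProj p W :=
  Iff.rfl

theorem mdifferentiableAt_proj (p : Γ.DualA) :
    MDifferentiableAt Γ.modelDual 𝓘(ℝ, EM) (fun q : Γ.DualA => q.proj) p :=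
  (contMDiff_proj Γ.DualFib (n := 1)).mdifferentiableAt (by simp)

theorem proj_mem_chartAt_source {p q : Γ.DualA}
    (hq : q ∈ (chartAt (ModelProd EM (Fib EG EM →L[ℝ] ℝ)) p).source) :
    q.proj ∈ (chartAt EM p.proj).source := by
  rw [FiberBundle.chartedSpace_chartAt] at hq
  exact hq.2.1

theorem extChartAt_proj (p q : Γ.DualA) : (extChartAt Γ.modelDual p q).1 = extChartAt 𝓘(ℝ, EM) p.proj q.proj := by
  rw [FiberBundle.extChartAt]
  rfl

/-- The charts of $A^*G$ are bundle charts over those of $M$, so in them $T\tau^*$ is the first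
projection. -/
theorem mdCoord_extChartAt_dProj {p q : Γ.DualA}
    (hq : q ∈ (chartAt (ModelProd EM (Fib EG EM →L[ℝ] ℝ)) p).source)
    (W : EM × (Fib EG EM →L[ℝ] ℝ)) :
    mdCoord 𝓘(ℝ, EM) 𝓘(ℝ, EM) (extChartAt 𝓘(ℝ, EM) p.proj) q.proj (Γ.dProj q W) =
      (mdCoord Γ.modelDual 𝓘(ℝ, EM × (Fib EG EM →L[ℝ] ℝ)) (extChartAt Γ.modelDual p) q W).1 := by
  have h1 := mdCoord_comp (I := Γ.modelDual) (f := fun q : Γ.DualA => q.proj) (x := q) rfl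
    (mdifferentiableAt_extChartAt (I := 𝓘(ℝ, EM)) (proj_mem_chartAt_source hq)) (mdifferentiableAt_proj q) W
  have h2 := mdCoord_comp (I := Γ.modelDual) (I'' := 𝓘(ℝ, EM)) (x := q) (g := Prod.fst) rfl
    differentiableAt_fst.mdifferentiableAt (mdifferentiableAt_extChartAt (I := Γ.modelDual) hq) W
  rw [← h1, mdCoord_congr (g := Prod.fst ∘ extChartAt Γ.modelDual p), h2, mdCoord, mfderiv_eq_fderiv]
  · exact congrArg (fun A : (EM × (Fib EG EM →L[ℝ] ℝ)) →L[ℝ] EM => A _) fderiv_fst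
  · exact Eventually.of_forall fun q => (extChartAt_proj p q).symm

/-- Every element of the prolongation extends to a projectable section. -/
theorem exists_isProjectable {p : Γ.DualA} {v : EG} {W : EM × (Fib EG EM →L[ℝ] ℝ)}
    (h : ((v, W) : TangentSpace 𝓘(ℝ, EG) (Γ.unit p.proj) × TangentSpace Γ.modelDual p) ∈
      Γ.Prol p) :
    ∃ (X : ∀ x, Γ.A x) (U : Γ.DualA → EM × (Fib EG EM →L[ℝ] ℝ)), Γ.IsProjectable X U p ∧
      (X p.proj).1 = v ∧ U p = W := by
  rw [mem_Prol_iff] at h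
  obtain ⟨X, hX, hXv⟩ := Γ.exists_smoothAt p.proj h.1
  -- Projectability near `p` forces the base coordinates to be those of the anchor of `X`; the fibre
  -- coordinates are free and frozen at `W.2`. Membership in `Prol` makes the base part at `p` equal
  -- to `W.1`.
  have hc : ContMDiffAt Γ.modelDual 𝓘(ℝ, EM × (Fib EG EM →L[ℝ] ℝ)) ∞ (fun q : Γ.DualA =>
      (mdCoord 𝓘(ℝ, EM) 𝓘(ℝ, EM) (extChartAt 𝓘(ℝ, EM) p.proj) q.proj (Γ.anchor X q.proj), W.2)) p :=
    (ContMDiffAt.comp p (hX.anchor.mdCoord_extChartAt_apply) (contMDiff_proj Γ.DualFib p)).prodMk_space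
      contMDiffAt_const
  obtain ⟨U, hU, hUp, hUc⟩ := exists_contMDiffAt_field hc
  have hcs : ∀ᶠ q in 𝓝 p, q ∈ (chartAt (ModelProd EM (Fib EG EM →L[ℝ] ℝ)) p).source :=
    (chartAt (ModelProd EM (Fib EG EM →L[ℝ] ℝ)) p).open_source.mem_nhds (mem_chart_source _ p)
  refine ⟨X, U, ⟨hX, hU, ?_⟩, hXv, hUp.trans ?_⟩
  · filter_upwards [hUc, hcs] with q h1 h2
    refine mem_Prol_iff.2 ⟨(X q.proj).2, ?_⟩
    have h3 := mdCoord_extChartAt_dProj h2 (U q)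
    rw [h1] at h3
    exact (mdCoord_extChartAt_isInvertible (proj_mem_chartAt_source h2)).injective h3.symm
  · rw [mdCoord_extChartAt_self]
    have h3 := mdCoord_extChartAt_dProj hcs.self_of_nhds W
    rw [mdCoord_extChartAt_self, mdCoord_extChartAt_self] at h3
    refine Prod.ext ?_ rfl
    rw [← h3, ← h.2, ← hXv]
    rfl

theorem mdifferentiableAt_pairing {X : ∀ x, Γ.A x} {p : Γ.DualA} (hX : Γ.SmoothAt X p.proj) :
    MDifferentiableAt Γ.modelDual 𝓘(ℝ, ℝ) (fun q : Γ.DualA => (q.2 (X q.proj) : ℝ)) p := by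
  have h := ContMDiffAt.clm_bundle_apply (n := ∞) (E₂ := Bundle.Trivial M ℝ) (F₂ := ℝ)
    (b := fun q : Γ.DualA => q.proj) (v := fun q => X q.proj) (ϕ := fun q : Γ.DualA => q.2)
    (x := p) (IM := Γ.modelDual) (IB := 𝓘(ℝ, EM))
    contMDiffAt_id (ContMDiffAt.comp p hX (contMDiff_proj Γ.DualFib p))
  exact (contMDiffAt_totalSpace.1 h).2.mdifferentiableAt (by simp)

/-- `U` and `U'` are $\tau^*$-related to the anchors, so their bracket is related to the anchor of
the bracket. This keeps `evalForm` off its default value in `koszulProl`. -/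
theorem bracket_mem_Prol {X X' : ∀ x, Γ.A x} {U U' : Γ.DualA → EM × (Fib EG EM →L[ℝ] ℝ)}
    {p : Γ.DualA} (h : Γ.IsProjectable X U p) (h' : Γ.IsProjectable X' U' p) :
    (((Γ.bracket X X' p.proj).1, brCoord (E := EM × (Fib EG EM →L[ℝ] ℝ)) Γ.modelDual U U' p) :
      TangentSpace 𝓘(ℝ, EG) (Γ.unit p.proj) × TangentSpace Γ.modelDual p) ∈ Γ.Prol p := by
  have := FiniteDimensional.complete ℝ EM
  refine mem_Prol_iff.2 ⟨(Γ.bracket X X' p.proj).2, (anchor_bracket h.1 h'.1).trans ?_⟩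
  exact (mdCoord_brCoord_of_related (f := fun q : Γ.DualA => q.proj) rfl
    (contMDiff_proj Γ.DualFib (n := 2) p)
    (ContMDiffAt.mdifferentiableAt h.2.1 (by simp)) (ContMDiffAt.mdifferentiableAt h'.2.1 (by simp))
    (h.1.anchor.mdifferentiableAt (by simp)) (h'.1.anchor.mdifferentiableAt (by simp))
    (h.2.2.mono fun q hq => (mem_Prol_iff.1 hq).2.symm)
    (h'.2.2.mono fun q hq => (mem_Prol_iff.1 hq).2.symm)).symm

/-- The differential of the Liouville section along a map into `A^*G`. -/
theorem koszulProl_liouville {F : G → Γ.DualA} {g : G}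
    (hF : MDifferentiableAt 𝓘(ℝ, EG) Γ.modelDual F g)
    {X X' : ∀ x, Γ.A x} {U U' : Γ.DualA → EM × (Fib EG EM →L[ℝ] ℝ)}
    (h : Γ.IsProjectable X U (F g)) (h' : Γ.IsProjectable X' U' (F g)) {u u' : EG}
    (hu : U (F g) = mdCoord 𝓘(ℝ, EG) Γ.modelDual F g u)
    (hu' : U' (F g) = mdCoord 𝓘(ℝ, EG) Γ.modelDual F g u') :
    Γ.koszulProl Γ.liouville X U X' U' (F g) =
      mdCoord 𝓘(ℝ, EG) 𝓘(ℝ, ℝ) (fun k => ((F k).2 (X' (F k).proj) : ℝ)) g u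
      - mdCoord 𝓘(ℝ, EG) 𝓘(ℝ, ℝ) (fun k => ((F k).2 (X (F k).proj) : ℝ)) g u'
      - (F g).2 (Γ.bracket X X' (F g).proj) := by
  -- Near `F g`, evaluating $\Theta$ on the section is pairing with `Z`. Its derivative along an
  -- image vector of `F` is, by the chain rule, that of the pairing pulled back to `G`.
  have key : ∀ {Z : ∀ x, Γ.A x} {V : Γ.DualA → EM × (Fib EG EM →L[ℝ] ℝ)} (v : EG),
      Γ.IsProjectable Z V (F g) → mdCoord Γ.modelDual 𝓘(ℝ, ℝ)
        (fun q => evalForm (Γ.liouville q) (((Z q.proj).1, V q) :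
          TangentSpace 𝓘(ℝ, EG) (Γ.unit q.proj) × TangentSpace Γ.modelDual q)) (F g)
        (mdCoord 𝓘(ℝ, EG) Γ.modelDual F g v) =
      mdCoord 𝓘(ℝ, EG) 𝓘(ℝ, ℝ) (fun k => ((F k).2 (Z (F k).proj) : ℝ)) g v := by
    intro Z V v hZ
    rw [mdCoord_congr (g := fun q : Γ.DualA => (q.2 (Z q.proj) : ℝ))]
    · exact (mdCoord_comp (f := F) rfl (mdifferentiableAt_pairing hZ.1) hF v).symm
    · exact hZ.2.2.mono fun q hq => evalForm_of_mem _ hq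
  rw [← key u h', ← key u' h, ← hu, ← hu']
  exact congrArg₂ (fun a b : ℝ => a - b) rfl (evalForm_of_mem _ (bracket_mem_Prol h h'))

end LieGroupoid

/-- The differentials are choices over extensions; this evaluates them once extensions exist and all
give the same value. -/
theorem epsilon_eq_of_unique {P : ℝ → Prop} {c : ℝ} (he : ∃ b, P b) (h : ∀ b, P b → b = c) :
    Classical.epsilon P = c :=
  h _ (Classical.epsilon_spec he)

namespace LieGroupoid

variable {EG EM G M : Type*}
  [NormedAddCommGroup EG] [NormedSpace ℝ EG] [FiniteDimensional ℝ EG]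
  [NormedAddCommGroup EM] [NormedSpace ℝ EM] [FiniteDimensional ℝ EM]
  [TopologicalSpace G] [ChartedSpace EG G] [IsManifold 𝓘(ℝ, EG) ∞ G]
  [TopologicalSpace M] [ChartedSpace EM M] [IsManifold 𝓘(ℝ, EM) ∞ M]
  {Γ : LieGroupoid EG EM G M}

/-! ### Values of the differentials -/

/-- The outer derivative depends only on the value of its field at `g`; commuting brings either
field to the outside. This is the tensoriality behind independence of the extensions. -/
theorem rfD_lfD_congr {L : G → ℝ} (hL : ContMDiff 𝓘(ℝ, EG) 𝓘(ℝ, ℝ) ∞ L)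
    {X X' Y Y' : ∀ x, Γ.A x} {g : G} (hX' : Γ.SmoothAt X' (Γ.src g))
    (hY : Γ.SmoothAt Y (Γ.tgt g)) (hY' : Γ.SmoothAt Y' (Γ.tgt g))
    (hX : Γ.rf X g = Γ.rf X' g) (h : Γ.lf Y g = Γ.lf Y' g) :
    rfD X (lfD Y L) g = rfD X' (lfD Y' L) g := by
  rw [rfD, hX, ← rfD, lfD_rfD_comm hL hX' hY, lfD, h, ← lfD, lfD_rfD_comm hL hX' hY']

/-- The components of an element of `P^τ G`, as elements of the model space. -/
def pgCoord {g : G} (w : Γ.PG g) : EG × EG := w.1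

theorem dTgt_pgCoord {g : G} (w : Γ.PG g) : Γ.dTgt g (pgCoord w).1 = 0 := w.2.1

theorem dSrc_pgCoord {g : G} (w : Γ.PG g) : Γ.dSrc g (pgCoord w).2 = 0 := w.2.2

/-- The differential of `Θ_L^+`, computed with invariant extensions. -/
theorem dPG_thetaPlus_apply {L : G → ℝ} (hL : ContMDiff 𝓘(ℝ, EG) 𝓘(ℝ, ℝ) ∞ L)
    {X Y X' Y' : ∀ x, Γ.A x} {g : G} {u v : Γ.PG g}
    (hX : Γ.SmoothAt X (Γ.src g)) (hY : Γ.SmoothAt Y (Γ.tgt g))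
    (hX' : Γ.SmoothAt X' (Γ.src g)) (hY' : Γ.SmoothAt Y' (Γ.tgt g))
    (hXu : Γ.rf X g = (pgCoord u).1) (hYu : Γ.lf Y g = (pgCoord u).2)
    (hXv : Γ.rf X' g = (pgCoord v).1) (hYv : Γ.lf Y' g = (pgCoord v).2) :
    Γ.dPG (Γ.thetaPlus L) g u v = rfD X (lfD Y' L) g - rfD X' (lfD Y L) g := by
  refine epsilon_eq_of_unique ⟨_, X, Y, X', Y', hX, hY, hX', hY', Prod.ext hXu hYu,
    Prod.ext hXv hYv, rfl⟩ ?_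
  rintro _ ⟨Z, W, Z', W', -, hW, -, hW', hu, hv, rfl⟩
  have e1 : Γ.rf Z g = (pgCoord u).1 := congrArg Prod.fst hu
  have e2 : Γ.lf W g = (pgCoord u).2 := congrArg Prod.snd hu
  have e3 : Γ.rf Z' g = (pgCoord v).1 := congrArg Prod.fst hv
  have e4 : Γ.lf W' g = (pgCoord v).2 := congrArg Prod.snd hv
  rw [koszulPG_thetaPlus hL hW hW',
    rfD_lfD_congr hL hX hW' hY' (e1.trans hXu.symm) (e4.trans hYv.symm),
    rfD_lfD_congr hL hX' hW hY (e3.trans hXv.symm) (e2.trans hYu.symm)]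

/-- Every pair of elements of `P^τ G` extends to invariant sections. -/
theorem exists_invariant_extension {g : G} (w : Γ.PG g) : ∃ X Y : ∀ x, Γ.A x,
    Γ.SmoothAt X (Γ.src g) ∧ Γ.SmoothAt Y (Γ.tgt g) ∧
      Γ.rf X g = (pgCoord w).1 ∧ Γ.lf Y g = (pgCoord w).2 := by
  obtain ⟨X, hX, hX'⟩ := exists_smoothAt_rf (Γ := Γ) (g := g) (u := (pgCoord w).1) (dTgt_pgCoord w)
  obtain ⟨Y, hY, hY'⟩ := exists_smoothAt_lf (Γ := Γ) (g := g) (v := (pgCoord w).2) (dSrc_pgCoord w)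
  exact ⟨X, Y, hX, hY, hX', hY'⟩

/-! ### The prolongations of the Legendre transformations -/

theorem isoTgt_fst {g : G} (w : Γ.PG g) : (Γ.isoTgt g w).1 = Γ.dL (Γ.inv g) g (pgCoord w).2 := by
  have h := Γ.tgt_inv g
  rw [dL, h]
  rfl

/-- On the target fibre of $g$ one has $(kg^{-1})^{-1}=g\,k^{-1}$. -/
theorem isoSrc_fst {g : G} (w : Γ.PG g) :
    (Γ.isoSrc g w).1 = Γ.dL g (Γ.inv g) (Γ.dInv g (pgCoord w).1) := by
  have h0 := HasMdWithinAt.comp (f := Γ.inv) (s := {k | Γ.tgt k = Γ.tgt g}) rfl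
    (Γ.hasMdWithinAt_mul_left (g := g) (Γ.src_inv g)) (Γ.hasMdAt_inv g).hasMdWithinAt
    fun k hk => (Γ.src_inv k).trans hk
  have h1 := h0.congr_of_eventuallyEq (g := fun k => Γ.inv (Γ.mul k (Γ.inv g))) (by
    filter_upwards [self_mem_nhdsWithin] with k hk
    rw [Γ.mul_inv_rev (by rw [Γ.src_inv]; exact hk), Γ.inv_inv]
    rfl) rfl
  exact Γ.submersion_tgt.hasMdWithinAt_unique (v := (pgCoord w).1) (dTgt_pgCoord w) rfl
    (MDifferentiableWithinAt.hasMFDerivWithinAt (HasMFDerivWithinAt.mdifferentiableWithinAt h1)) h1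
    fun _ _ => rfl

theorem dProj_comp {F : G → Γ.DualA} {g : G} (hF : MDifferentiableAt 𝓘(ℝ, EG) Γ.modelDual F g)
    (v : EG) : Γ.dProj (F g) (mdCoord 𝓘(ℝ, EG) Γ.modelDual F g v) =
      mdCoord 𝓘(ℝ, EG) 𝓘(ℝ, EM) (fun h => (F h).proj) g v :=
  (mdCoord_comp (f := F) rfl (mdifferentiableAt_proj (F g)) hF v).symm

/-- $\mathbb F^+L$ covers $\beta$, which is invariant under left translation, and $T\beta$ kills the
first component of `w`. -/
theorem prolPlus_mem {L : G → ℝ} (hL : ContMDiff 𝓘(ℝ, EG) 𝓘(ℝ, ℝ) ∞ L) (g : G) (w : Γ.PG g) :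
    Γ.prolPlus L g w ∈ Γ.Prol (Γ.legPlus L g) := by
  have hs := Γ.dSrc_dL (Γ.tgt_inv g).symm (v := (pgCoord w).2) (dSrc_pgCoord w)
  have ht := Γ.dTgt_dL (Γ.tgt_inv g).symm (v := (pgCoord w).2) (dSrc_pgCoord w)
  rw [Γ.inv_mul] at hs ht
  have e : (Γ.isoTgt g w).1 = Γ.dL (Γ.inv g) g (pgCoord w).2 := isoTgt_fst w
  have ha : Γ.dTgt g ((pgCoord w).1 + (pgCoord w).2) = Γ.dTgt g (pgCoord w).2 := by
    have h : Γ.dTgt g (pgCoord w).1 = 0 := dTgt_pgCoord w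
    rw [map_add, h, zero_add]
  refine mem_Prol_iff.2 ⟨(congrArg (Γ.dSrc (Γ.unit (Γ.tgt g))) e).trans hs,
    (congrArg (Γ.dTgt (Γ.unit (Γ.tgt g))) e).trans (ht.trans (ha.symm.trans ?_))⟩
  exact (dProj_comp ((contMDiff_legPlus hL).mdifferentiable (by simp) g) _).symm

/-- $\mathbb F^-L$ covers $\alpha=\beta\circ i$, and $T\alpha$ kills the second component of `w`. -/
theorem prolMinus_mem {L : G → ℝ} (hL : ContMDiff 𝓘(ℝ, EG) 𝓘(ℝ, ℝ) ∞ L) (g : G) (w : Γ.PG g) :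
    Γ.prolMinus L g w ∈ Γ.Prol (Γ.legMinus L g) := by
  have hv : Γ.dSrc (Γ.inv g) (Γ.dInv g (pgCoord w).1) = 0 := (Γ.dSrc_dInv g (pgCoord w).1).trans (dTgt_pgCoord w)
  have hs := Γ.dSrc_dL (Γ.src_inv g) hv
  have ht := Γ.dTgt_dL (Γ.src_inv g) hv
  rw [Γ.mul_inv] at hs ht
  have e : (Γ.isoSrc g w).1 = Γ.dL g (Γ.inv g) (Γ.dInv g (pgCoord w).1) := isoSrc_fst w
  have ha : Γ.dSrc g ((pgCoord w).1 + (pgCoord w).2) = Γ.dSrc g (pgCoord w).1 := by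
    have h : Γ.dSrc g (pgCoord w).2 = 0 := dSrc_pgCoord w
    rw [map_add, h, add_zero]
  refine mem_Prol_iff.2 ⟨(congrArg (Γ.dSrc (Γ.unit (Γ.src g))) e).trans hs,
    (congrArg (Γ.dTgt (Γ.unit (Γ.src g))) e).trans (ht.trans ((Γ.dTgt_dInv g (pgCoord w).1).trans
      (ha.symm.trans ?_)))⟩
  exact (dProj_comp ((contMDiff_legMinus hL).mdifferentiable (by simp) g) _).symm

theorem liouville_prolPlus {L : G → ℝ} (hL : ContMDiff 𝓘(ℝ, EG) 𝓘(ℝ, ℝ) ∞ L) (g : G)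
    (w : Γ.PG g) (h : Γ.prolPlus L g w ∈ Γ.Prol (Γ.legPlus L g)) :
    Γ.liouville (Γ.legPlus L g) ⟨Γ.prolPlus L g w, h⟩ = Γ.thetaPlus L g w := by
  have e : (Γ.isoTgt g w).1 = Γ.dL (Γ.inv g) g (pgCoord w).2 := isoTgt_fst w
  refine (legPlus_apply hL g ⟨(Γ.isoTgt g w).1, h.1⟩).trans ?_
  exact congrArg (mdCoord 𝓘(ℝ, EG) 𝓘(ℝ, ℝ) L g)
    ((congrArg (Γ.dL g (Γ.unit (Γ.tgt g))) e).trans (dL_dL_inv (v := (pgCoord w).2) (dSrc_pgCoord w)))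

theorem liouville_prolMinus {L : G → ℝ} (hL : ContMDiff 𝓘(ℝ, EG) 𝓘(ℝ, ℝ) ∞ L) (g : G)
    (w : Γ.PG g) (h : Γ.prolMinus L g w ∈ Γ.Prol (Γ.legMinus L g)) :
    Γ.liouville (Γ.legMinus L g) ⟨Γ.prolMinus L g w, h⟩ = Γ.thetaMinus L g w := by
  obtain ⟨X, -, hX⟩ := Γ.exists_smoothAt (Γ.src g) (v := (Γ.isoSrc g w).1) h.1
  have e1 : Γ.rf X g = -(pgCoord w).1 := (rf_eq_iff (u := (pgCoord w).1) (dTgt_pgCoord w)).2 (hX.trans (isoSrc_fst w))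
  have e2 : (⟨(Γ.isoSrc g w).1, h.1⟩ : Γ.A (Γ.src g)) = X (Γ.src g) := Subtype.ext hX.symm
  refine (congrArg (Γ.legMinus L g).2 e2).trans ((legMinus_apply_section hL X g).trans ?_)
  rw [rfD, e1]
  exact map_neg (mdCoord 𝓘(ℝ, EG) 𝓘(ℝ, ℝ) L g) _

/-- The left fields of projectable extensions `Z`, `Z'` take the left components of `v`, `w` at `g`.
Hence the left-left terms cancel against $\overleftarrow{[\![Z,Z']\!]}(L)$, and the mixed terms are
those of $d\Theta_L^+$ with `Z`, `Z'` as left extensions. -/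
theorem dProl_legPlus {L : G → ℝ} (hL : ContMDiff 𝓘(ℝ, EG) 𝓘(ℝ, ℝ) ∞ L) (g : G) (v w : Γ.PG g)
    (hv : Γ.prolPlus L g v ∈ Γ.Prol (Γ.legPlus L g))
    (hw : Γ.prolPlus L g w ∈ Γ.Prol (Γ.legPlus L g)) :
    Γ.dProl Γ.liouville (Γ.legPlus L g) ⟨Γ.prolPlus L g v, hv⟩ ⟨Γ.prolPlus L g w, hw⟩ =
      Γ.dPG (Γ.thetaPlus L) g v w := by
  obtain ⟨X, Y, hX, hY, hXv, hYv⟩ := exists_invariant_extension v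
  obtain ⟨X', Y', hX', hY', hXw, hYw⟩ := exists_invariant_extension w
  obtain ⟨Z, U, hZU, hZ, hU⟩ := exists_isProjectable hv
  obtain ⟨Z', U', hZU', hZ', hU'⟩ := exists_isProjectable hw
  refine epsilon_eq_of_unique ⟨_, Z, U, Z', U', hZU, hZU', Prod.ext hZ hU, Prod.ext hZ' hU', rfl⟩ ?_
  -- These extensions only witness existence; the value is now computed for arbitrary ones.
  clear! Z U Z' U'
  rintro _ ⟨Z, U, Z', U', hZU, hZU', h, h', rfl⟩
  have hZ : Γ.lf Z g = (pgCoord v).2 := (lf_eq_iff (v := (pgCoord v).2) (dSrc_pgCoord v)).2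
    ((congrArg Prod.fst h).trans (isoTgt_fst v))
  have hZ' : Γ.lf Z' g = (pgCoord w).2 := (lf_eq_iff (v := (pgCoord w).2) (dSrc_pgCoord w)).2
    ((congrArg Prod.fst h').trans (isoTgt_fst w))
  have hs : Γ.SmoothAt Z (Γ.tgt g) := hZU.1
  have hs' : Γ.SmoothAt Z' (Γ.tgt g) := hZU'.1
  have e : ∀ W : ∀ x, Γ.A x, (fun k => ((Γ.legPlus L k).2 (W (Γ.legPlus L k).proj) : ℝ)) =
      lfD W L := fun W => funext fun k => legPlus_apply_section hL W k
  have hk := koszulProl_liouville (F := Γ.legPlus L) (u := (pgCoord v).1 + (pgCoord v).2) (u' := (pgCoord w).1 + (pgCoord w).2)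
    ((contMDiff_legPlus hL).mdifferentiable (by simp) g) hZU hZU' (congrArg Prod.snd h)
    (congrArg Prod.snd h')
  have hb : ((Γ.legPlus L g).2 (Γ.bracket Z Z' (Γ.legPlus L g).proj) : ℝ) = _ :=
    (legPlus_apply_section hL (Γ.bracket Z Z') g).trans (lfD_bracket hL hs hs')
  rw [e, e, hb, ← hXv, ← hXw, ← hZ, ← hZ'] at hk
  refine hk.trans ?_
  rw [dPG_thetaPlus_apply hL hX hs hX' hs' hXv hZ hXw hZ', rfD, rfD, lfD, lfD]
  have ha : ∀ (A : EG →L[ℝ] ℝ) (x y : EG), A (x + y) = A x + A y := fun A => map_add A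
  refine (congrArg₂ (fun a b : ℝ => a - b - _) (ha _ _ _) (ha _ _ _)).trans ?_
  ring

/-- Here $\overrightarrow Z(g)=-\overrightarrow X(g)$, likewise for `Z'` and `X'`. With this sign
the right-right derivatives cancel the bracket term, and what remains is $\overleftarrow
Y\,\overrightarrow{Z'}L-\overleftarrow{Y'}\,\overrightarrow ZL$. -/
theorem dProl_legMinus {L : G → ℝ} (hL : ContMDiff 𝓘(ℝ, EG) 𝓘(ℝ, ℝ) ∞ L) (g : G) (v w : Γ.PG g)
    (hv : Γ.prolMinus L g v ∈ Γ.Prol (Γ.legMinus L g))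
    (hw : Γ.prolMinus L g w ∈ Γ.Prol (Γ.legMinus L g)) :
    Γ.dProl Γ.liouville (Γ.legMinus L g) ⟨Γ.prolMinus L g v, hv⟩ ⟨Γ.prolMinus L g w, hw⟩ =
      Γ.dPG (Γ.thetaPlus L) g v w := by
  obtain ⟨X, Y, hX, hY, hXv, hYv⟩ := exists_invariant_extension v
  obtain ⟨X', Y', hX', hY', hXw, hYw⟩ := exists_invariant_extension w
  obtain ⟨Z, U, hZU, hZ, hU⟩ := exists_isProjectable hv
  obtain ⟨Z', U', hZU', hZ', hU'⟩ := exists_isProjectable hw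
  refine epsilon_eq_of_unique ⟨_, Z, U, Z', U', hZU, hZU', Prod.ext hZ hU, Prod.ext hZ' hU', rfl⟩ ?_
  clear! Z U Z' U'
  rintro _ ⟨Z, U, Z', U', hZU, hZU', h, h', rfl⟩
  have hZ : Γ.rf Z g = -(pgCoord v).1 := (rf_eq_iff (u := (pgCoord v).1) (dTgt_pgCoord v)).2
    ((congrArg Prod.fst h).trans (isoSrc_fst v))
  have hZ' : Γ.rf Z' g = -(pgCoord w).1 := (rf_eq_iff (u := (pgCoord w).1) (dTgt_pgCoord w)).2
    ((congrArg Prod.fst h').trans (isoSrc_fst w))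
  have hs : Γ.SmoothAt Z (Γ.src g) := hZU.1
  have hs' : Γ.SmoothAt Z' (Γ.src g) := hZU'.1
  have e : ∀ W : ∀ x, Γ.A x, (fun k => ((Γ.legMinus L k).2 (W (Γ.legMinus L k).proj) : ℝ)) =
      rfD W L := fun W => funext fun k => legMinus_apply_section hL W k
  have hk := koszulProl_liouville (F := Γ.legMinus L) (u := (pgCoord v).1 + (pgCoord v).2) (u' := (pgCoord w).1 + (pgCoord w).2)
    ((contMDiff_legMinus hL).mdifferentiable (by simp) g) hZU hZU' (congrArg Prod.snd h)
    (congrArg Prod.snd h')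
  have hb : ((Γ.legMinus L g).2 (Γ.bracket Z Z' (Γ.legMinus L g).proj) : ℝ) = _ :=
    (legMinus_apply_section hL (Γ.bracket Z Z') g).trans (rfD_bracket hL hs hs')
  rw [e, e, hb, ← hXv, ← hXw, ← hYv, ← hYw] at hk
  refine hk.trans ?_
  have n1 : Γ.rf Z g = -Γ.rf X g := by rw [hZ, hXv]
  have n2 : Γ.rf Z' g = -Γ.rf X' g := by rw [hZ', hXw]
  -- The fields of `A` and `-B` agree only at `g`, so the right derivative must be commuted outside
  -- before one replaces the other.
  have m : ∀ {A B C : ∀ x, Γ.A x}, Γ.SmoothAt A (Γ.src g) → Γ.SmoothAt C (Γ.tgt g) →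
      Γ.rf A g = -Γ.rf B g → lfD C (rfD A L) g = -rfD B (lfD C L) g := by
    intro A B C hA hC h
    rw [← lfD_rfD_comm hL hA hC, rfD, h, map_neg, rfD]
  have c1 := m hs hY' n1
  have c2 := m hs' hY n2
  rw [dPG_thetaPlus_apply hL hX hY hX' hY' hXv hYv hXw hYw]
  rw [lfD] at c1 c2
  have ha : ∀ (A : EG →L[ℝ] ℝ) (x y : EG), A (x + y) = A x + A y := fun A => map_add A
  refine (congrArg₂ (fun a b : ℝ => a - b - _) (ha _ _ _) (ha _ _ _)).trans ?_
  rw [c1, c2]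
  have d1 : rfD Z (rfD Z' L) g = -mdCoord 𝓘(ℝ, EG) 𝓘(ℝ, ℝ) (rfD Z' L) g (Γ.rf X g) := by
    rw [rfD, n1, map_neg]
  have d2 : rfD Z' (rfD Z L) g = -mdCoord 𝓘(ℝ, EG) 𝓘(ℝ, ℝ) (rfD Z L) g (Γ.rf X' g) := by
    rw [rfD, n2, map_neg]
  rw [d1, d2]
  ring

end LieGroupoid

end

theorem mainTheorem9 {EG EM G M : Type*}
    [NormedAddCommGroup EG] [NormedSpace ℝ EG] [FiniteDimensional ℝ EG]
    [NormedAddCommGroup EM] [NormedSpace ℝ EM] [FiniteDimensional ℝ EM]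
    [TopologicalSpace G] [ChartedSpace EG G] [IsManifold 𝓘(ℝ, EG) ∞ G]
    [TopologicalSpace M] [ChartedSpace EM M] [IsManifold 𝓘(ℝ, EM) ∞ M]
    (Γ : LieGroupoid EG EM G M) (L : G → ℝ) (hL : ContMDiff 𝓘(ℝ, EG) 𝓘(ℝ, ℝ) ∞ L) :
    -- the two discrete Legendre transformations are smooth
    ContMDiff 𝓘(ℝ, EG) Γ.modelDual ∞ (Γ.legMinus L) ∧
    ContMDiff 𝓘(ℝ, EG) Γ.modelDual ∞ (Γ.legPlus L) ∧
    -- `Ω_L = -dΘ_L^+ = -dΘ_L^-`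
    Γ.dPG (Γ.thetaPlus L) = Γ.dPG (Γ.thetaMinus L) ∧
    -- the prolongation of `F^-L` takes values in `P^{τ*}(AG)`, and pulls back `Θ` and `Ω`
    (∃ hm : ∀ g w, Γ.prolMinus L g w ∈ Γ.Prol (Γ.legMinus L g),
      (∀ g w, Γ.liouville (Γ.legMinus L g) ⟨Γ.prolMinus L g w, hm g w⟩ = Γ.thetaMinus L g w) ∧
      ∀ g v w, Γ.omega (Γ.legMinus L g) ⟨Γ.prolMinus L g v, hm g v⟩ ⟨Γ.prolMinus L g w, hm g w⟩ =
        Γ.omegaLag L g v w) ∧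
    -- the prolongation of `F^+L` takes values in `P^{τ*}(AG)`, and pulls back `Θ` and `Ω`
    ∃ hp : ∀ g w, Γ.prolPlus L g w ∈ Γ.Prol (Γ.legPlus L g),
      (∀ g w, Γ.liouville (Γ.legPlus L g) ⟨Γ.prolPlus L g w, hp g w⟩ = Γ.thetaPlus L g w) ∧
      ∀ g v w, Γ.omega (Γ.legPlus L g) ⟨Γ.prolPlus L g v, hp g v⟩ ⟨Γ.prolPlus L g w, hp g w⟩ =
        Γ.omegaLag L g v w := by

  refine ⟨LieGroupoid.contMDiff_legMinus hL, LieGroupoid.contMDiff_legPlus hL,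
    LieGroupoid.dPG_thetaPlus_eq hL,
    ⟨LieGroupoid.prolMinus_mem hL, fun g w => LieGroupoid.liouville_prolMinus hL g w _,
      fun g v w => congrArg Neg.neg (LieGroupoid.dProl_legMinus hL g v w _ _)⟩,
    ⟨LieGroupoid.prolPlus_mem hL, fun g w => LieGroupoid.liouville_prolPlus hL g w _,
      fun g v w => congrArg Neg.neg (LieGroupoid.dProl_legPlus hL g v w _ _)⟩⟩
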